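/- Let $q>0$ and $J\in\mathbb N$, $J\ge 1$. On a complete probability space $(\Omega,\mathcal F,\mathbb P)$ let arms $j\in\mathcal J=\{1,\dots,J\}$ be given by sequences $(X^j_s,W^j_s,\mathcal F^j_s)_{s\ge 0}$, where $\mathbb F^j=(\mathcal F^j_s)_{s\ge0}$ is a $\mathbb P$-completed filtration, the $\sigma$-algebras $\bigvee_{s}\mathcal F^j_s$, $j\in\mathcal J$, are independent, the real random variable $X^j_s$ is $\mathcal F^j_s$-measurable, and for each $j$ the $W^j_s$ are i.i.d. and strictly positive, with $W^j_s$ independent of $\mathcal F^j_s$ and $\mathcal F^j_{s+1}$-measurable. Put $T^j_s=W^j_0+\dots+W^j_{s-1}$ and assume $$\mathbb E\Big[\sum_{s\ge0}|X^j_s|\int_{T^j_s}^{T^j_{s+1}}e^{-qr}\,dr\Big]<\infty,\qquad j\in\mathcal J.$$ For $\mathbf s\in\mathbb N_0^J$ let $\mathcal F_{\mathbf s}=\mathcal F^1_{s^1}\vee\dots\vee\mathcal F^J_{s^J}$. An admissible strategy is an $\mathbb N_0^J$-valued process $\pi=(\pi(t))_{t\in\mathbb N_0}$ with $\pi(0)=0$,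 $\sum_j\pi^j(t)=t$, $\pi(t+1)=\pi(t)+\mathbf e_{j}$ for some $j=\mathrm j_t\in\mathcal J$ (the arm operated in period $t$), and $\{\pi(t)=\mathbf s\}\in\mathcal F_{\mathbf s}$ for all $t,\mathbf s$. Period $t$ has duration $\mathcal W_t=W^{\mathrm j_t}_{\pi^{\mathrm j_t}(t)}$ and reward $\mathcal X_t=X^{\mathrm j_t}_{\pi^{\mathrm j_t}(t)}$; put $\mathcal T_t=\mathcal W_0+\dots+\mathcal W_{t-1}$ and $$V(\pi)=\mathbb E\Big[\sum_{t\ge0}\mathcal X_t\int_{\mathcal T_t}^{\mathcal T_{t+1}}e^{-qr}\,dr\,\Big|\,\mathcal F_{\mathbf 0}\Big].$$ The Gittins index of arm $j$ after $s$ operations is $$\Gamma^j_s=\operatorname*{ess\,sup}_{\tau>s}\frac{\mathbb E\big[\sum_{u=s}^{\tau-1}e^{-q(W^j_s+\dots+W^j_{u-1})}X^j_u\,\big|\,\mathcal F^j_s\big]}{\mathbb E\big[\sum_{u=s}^{\tau-1}e^{-q(W^j_s+\dots+W^j_{u-1})}\,\big|\,\mathcal F^j_s\big]},$$ the essential supremum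 being over all (possibly infinite) $\mathbb F^j$-stopping times $\tau>s$; here $\mathbb E[Z\,|\,\mathcal G]$ denotes $\mathbb E[Z^+|\mathcal G]-\mathbb E[Z^-|\mathcal G]$. Then: 1. for every admissible $\pi$ the series in $V(\pi)$ converges almost surely to an integrable random variable; 2. the indices $\Gamma^j_s$ exist as real-valued random variables, and $$\Gamma^j_s=\operatorname*{ess\,sup}_{\tau>s}\frac{\mathbb E\big[\sum_{u=s}^{\tau-1}e^{-qT^j_u}X^j_u\,\big|\,\mathcal F^j_s\big]}{\mathbb E\big[\sum_{u=s}^{\tau-1}e^{-qT^j_u}\,\big|\,\mathcal F^j_s\big]}\quad\text{almost surely};$$ 3. the Gittins index strategy is optimal: there is an admissible strategy $\pi$ that at the onset of each period $t\in\mathbb N_0$ operates an arm in $\arg\max_{j\in\mathcal J}\Gamma^j_{\pi^j(t)}$, and every admissible strategy $\pi^*$ that almost surely does so in each period satisfies $V(\pi)\le V(\pi^*)$ almost surely for every admissible strategy $\pi$. -/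

import Mathlib

open MeasureTheory ProbabilityTheory Filter
open scoped ENNReal

noncomputable section

/-- The conditional expectation `E[Z | 𝓖] = E[Z⁺ | 𝓖] - E[Z⁻ | 𝓖]` of a real random variable `Z`,
built from the conditional expectations of the nonnegative variables `Z⁺` and `Z⁻`. It agrees almost
surely with `P[Z | 𝓖]` when `Z` is integrable, and it is also meaningful when only
`E[|Z| | 𝓖] < ∞` almost surely. -/
def genCondExp {Ω : Type*} {mΩ : MeasurableSpace Ω} (P : Measure Ω) (𝓖 : MeasurableSpace Ω)
    (Z : Ω → ℝ) : Ω → ℝ := fun ω =>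
  (condLExp 𝓖 P (fun ω' => ENNReal.ofReal (Z ω')) ω).toReal -
    (condLExp 𝓖 P (fun ω' => ENNReal.ofReal (-Z ω')) ω).toReal

/-- `g` is (a version of) the essential supremum of the family `S` of real random variables: the
least measurable function, up to almost sure order, that dominates every member of `S`. -/
def IsEssSup {Ω : Type*} {mΩ : MeasurableSpace Ω} (P : Measure Ω) (S : Set (Ω → ℝ))
    (g : Ω → ℝ) : Prop :=
  AEMeasurable g P ∧ (∀ f ∈ S, f ≤ᵐ[P] g) ∧
    ∀ h : Ω → ℝ, AEMeasurable h P → (∀ f ∈ S, f ≤ᵐ[P] h) → g ≤ᵐ[P] h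

/-- A bandit with `J` independent arms. `X j s` is the reward (rate) of arm `j` when it is selected
after `s` previous operations, `W j s` the duration for which it then stays active, and `F j` the
filtration of arm `j`. -/
structure RenewalBandit {Ω : Type*} {mΩ : MeasurableSpace Ω} (P : Measure Ω) (J : ℕ) where
  X : Fin J → ℕ → Ω → ℝ
  W : Fin J → ℕ → Ω → ℝ
  F : Fin J → Filtration ℕ mΩ
  /-- The filtrations, hence also the probability space, are complete: they contain all subsets of
  null sets (for a set that is not known to be measurable, `P A` is its outer measure). -/
  complete : ∀ j s (A : Set Ω), P A = 0 → MeasurableSet[F j s] A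
  measurable_X : ∀ j s, Measurable[F j s] (X j s)
  measurable_W : ∀ j s, Measurable[F j (s + 1)] (W j s)
  /-- `W j s` is independent of `F j s`. -/
  indep_W : ∀ j s, Indep (MeasurableSpace.comap (W j s) inferInstance) (F j s) P
  iIndep_W : ∀ j, iIndepFun (W j) P
  ident_W : ∀ j s, IdentDistrib (W j s) (W j 0) P P
  pos_W : ∀ j s, ∀ᵐ ω ∂P, 0 < W j s ω
  /-- The arms are independent. -/
  indep_arms : iIndep (fun j => ⨆ s, (F j s : MeasurableSpace Ω)) P

namespace RenewalBandit

variable {Ω : Type*} {mΩ : MeasurableSpace Ω} {P : Measure Ω} {J : ℕ}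

/-- The total operating time `T j s = W j 0 + ⋯ + W j (s - 1)` of the first `s` operations of
arm `j`. -/
def T (B : RenewalBandit P J) (j : Fin J) (s : ℕ) (ω : Ω) : ℝ :=
  ∑ u ∈ Finset.range s, B.W j u ω

/-- The standing integrability assumption
`E [∑ₛ |X j s| ∫_{T j s}^{T j (s+1)} e^{-qr} dr] < ∞` for every arm `j`. -/
def RewardsIntegrable (B : RenewalBandit P J) (q : ℝ) : Prop :=
  ∀ j, ∫⁻ ω, ∑' s : ℕ, ENNReal.ofReal
    (|B.X j s ω| * ∫ r in (B.T j s ω)..(B.T j (s + 1) ω), Real.exp (-q * r)) ∂P < ∞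

/-- The information `F_s = F¹_{s¹} ∨ ⋯ ∨ Fᴶ_{sᴶ}` after `s j` operations of each arm `j`. -/
abbrev info (B : RenewalBandit P J) (s : Fin J → ℕ) : MeasurableSpace Ω :=
  ⨆ j, (B.F j (s j) : MeasurableSpace Ω)

/-- An admissible strategy: `count t ω j` is the number of times that arm `j` has been selected
during periods `0, …, t - 1`. -/
structure Strategy (B : RenewalBandit P J) where
  count : ℕ → Ω → Fin J → ℕ
  count_zero : ∀ ω, count 0 ω = 0
  sum_count : ∀ t ω, ∑ j, count t ω j = t
  count_succ : ∀ t ω, ∃ j, count (t + 1) ω = count t ω + Pi.single j 1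
  measurableSet_count : ∀ t (s : Fin J → ℕ), MeasurableSet[B.info s] {ω | count t ω = s}

namespace Strategy

variable {B : RenewalBandit P J}

/-- The arm selected at the onset of period `t`, i.e. the unique `j` with
`count (t + 1) ω = count t ω + e_j`. -/
def arm (π : B.Strategy) (t : ℕ) (ω : Ω) : Fin J := (π.count_succ t ω).choose

/-- The duration of period `t`. -/
def duration (π : B.Strategy) (t : ℕ) (ω : Ω) : ℝ :=
  B.W (π.arm t ω) (π.count t ω (π.arm t ω)) ω

/-- The reward (rate) collected in period `t`. -/
def reward (π : B.Strategy) (t : ℕ) (ω : Ω) : ℝ :=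
  B.X (π.arm t ω) (π.count t ω (π.arm t ω)) ω

/-- The real time at which period `t` begins. -/
def time (π : B.Strategy) (t : ℕ) (ω : Ω) : ℝ :=
  ∑ u ∈ Finset.range t, π.duration u ω

/-- The discounted reward collected in period `t`. -/
def periodReward (π : B.Strategy) (q : ℝ) (t : ℕ) (ω : Ω) : ℝ :=
  π.reward t ω * ∫ r in (π.time t ω)..(π.time (t + 1) ω), Real.exp (-q * r)

/-- The total discounted reward. -/
def totalReward (π : B.Strategy) (q : ℝ) (ω : Ω) : ℝ :=
  ∑' t : ℕ, π.periodReward q t ω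

/-- The expected discounted reward given the initial information; a random variable. -/
def value (π : B.Strategy) (q : ℝ) : Ω → ℝ :=
  condExp (B.info 0) P (π.totalReward q)

/-- `π` is optimal: its value dominates that of every admissible strategy. -/
def IsOptimal (π : B.Strategy) (q : ℝ) : Prop :=
  ∀ π' : B.Strategy, π'.value q ≤ᵐ[P] π.value q

/-- At the onset of every period, `π` operates an arm whose current index is maximal. -/
def FollowsIndex (π : B.Strategy) (Γ : Fin J → ℕ → Ω → ℝ) : Prop :=
  ∀ t, ∀ᵐ ω ∂P, ∀ j, Γ j (π.count t ω j) ω ≤ Γ (π.arm t ω) (π.count t ω (π.arm t ω)) ω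

end Strategy

/-- `∑_{u = s}^{τ - 1} e^{-q (W j s + ⋯ + W j (u - 1))} Y_u`; the sum is over all `u ≥ s` where
`τ = ∞`. -/
def discountedSum (B : RenewalBandit P J) (q : ℝ) (j : Fin J) (s : ℕ) (τ : Ω → WithTop ℕ)
    (Y : ℕ → Ω → ℝ) (ω : Ω) : ℝ :=
  ∑' u : ℕ, Set.indicator {u : ℕ | s ≤ u ∧ (u : WithTop ℕ) < τ ω}
    (fun u => Real.exp (-q * ∑ v ∈ Finset.Ico s u, B.W j v ω) * Y u ω) u

/-- `∑_{u = s}^{τ - 1} e^{-q T j u} Y_u`, discounted to time `0` instead. -/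
def discountedSum₀ (B : RenewalBandit P J) (q : ℝ) (j : Fin J) (s : ℕ) (τ : Ω → WithTop ℕ)
    (Y : ℕ → Ω → ℝ) (ω : Ω) : ℝ :=
  ∑' u : ℕ, Set.indicator {u : ℕ | s ≤ u ∧ (u : WithTop ℕ) < τ ω}
    (fun u => Real.exp (-q * B.T j u ω) * Y u ω) u

/-- The ratio of conditional expected discounted rewards to discounted time for the rule `τ`. -/
def ratio (B : RenewalBandit P J) (q : ℝ) (j : Fin J) (s : ℕ) (τ : Ω → WithTop ℕ) : Ω → ℝ :=
  fun ω => genCondExp P (B.F j s) (B.discountedSum q j s τ (B.X j)) ω /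
    genCondExp P (B.F j s) (B.discountedSum q j s τ (fun _ _ => 1)) ω

/-- The same ratio with all terms discounted to time `0`. -/
def ratio₀ (B : RenewalBandit P J) (q : ℝ) (j : Fin J) (s : ℕ) (τ : Ω → WithTop ℕ) : Ω → ℝ :=
  fun ω => genCondExp P (B.F j s) (B.discountedSum₀ q j s τ (B.X j)) ω /
    genCondExp P (B.F j s) (B.discountedSum₀ q j s τ (fun _ _ => 1)) ω

/-- The stopping times (possibly infinite) of arm `j` that are larger than `s`. -/
def stoppingTimesAfter (B : RenewalBandit P J) (j : Fin J) (s : ℕ) : Set (Ω → WithTop ℕ) :=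
  {τ | IsStoppingTime (B.F j) τ ∧ ∀ ω, (s : WithTop ℕ) < τ ω}

/-- `Γ` is (a version of) the Gittins index process. -/
def IsGittinsIndex (B : RenewalBandit P J) (q : ℝ) (Γ : Fin J → ℕ → Ω → ℝ) : Prop :=
  ∀ j s, IsEssSup P (B.ratio q j s '' B.stoppingTimesAfter j s) (Γ j s)

end RenewalBandit

end

/-! The proof compares the rewards of an arm with the running minimum of its index. Fix an arm,
write d_s = e^{-qT_s} and M_s = min(Γ_0, ..., Γ_s), call d_s (X_s - M_s) the excess of operation s,
and let the potential Φ_u be the conditional expectation, given F_u, of the sum of all excesses from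
u on.

Two facts carry the argument. First, Φ_u ≤ 0 where u is a record, that is where Γ_u = M_u: between
consecutive records M is constant and equal to the index at the start of the block, and the
definition of the index makes the expected excess of each block nonpositive
(`setIntegral_sum_Ico_excess_nonpos`). Second, Φ_u ≥ 0 everywhere: if continuing in the problem of
optimally stopping the sum of excesses had a negative value, Γ_u could be lowered and would not be
the least upper bound (`nonneg_of_forall_expReward_le`). So continuing is always optimal, and never
stopping has a nonnegative value. No stopping time that attains the index is needed.

Under a strategy, operation s of an arm is discounted further by a weight R_s, which comes from the
time spent on other arms. Weights lie in [0, 1], decrease in s, and are measurable with respect to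
F_s and the other, independent arms. Since Φ_0 = 0, summation by parts turns the expected weighted
excess into minus the sum of E[(R_s - R_{s+1}) Φ_{s+1}], up to a boundary term, so it is at most 0.
It equals 0 if the weight drops only at records, and this holds for an index strategy: it leaves an
arm only when the index of that arm is at most every index met before
(`index_eq_runMin_of_weight_ne`). The random durations contribute only a constant factor per arm,
because they are independent of the past.

Hence every strategy earns in expectation at most what it would earn at the rates M, with equality
for index strategies. At the rates M the comparison is pathwise: index strategies collect these
rates in decreasing order, which is best under discounting (`tsum_slot_le_of_antitone`). Integrating
over events of the initial information gives the conditional statement. -/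

set_option linter.unusedSectionVars false

/-! ### Conditional expectations of products with a nonintegrable known factor. -/

section GeneralizedConditionalExpectation

variable {Ω : Type*} {m mΩ : MeasurableSpace Ω} {P : Measure Ω} [IsProbabilityMeasure P]

theorem condLExp_mul_of_measurable_left (hm : m ≤ mΩ) {c Z : Ω → ℝ≥0∞} (hc : Measurable[m] c)
    (hZ : AEMeasurable Z P) :
    condLExp m P (fun ω => c ω * Z ω) =ᵐ[P] fun ω => c ω * condLExp m P Z ω := by
  symm
  refine ae_eq_condLExp hm P _ (hc.mul (measurable_condLExp _ _ _)) fun s hs => ?_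
  -- Both densities define the same measure on `m`, so they integrate every `m`-measurable function
  -- alike, with no finiteness needed.
  have key : (P.withDensity (condLExp m P Z)).trim hm = (P.withDensity Z).trim hm := by
    refine @Measure.ext _ m _ _ fun t ht => ?_
    rw [trim_measurableSet_eq hm ht, trim_measurableSet_eq hm ht, withDensity_apply _ (hm t ht),
      withDensity_apply _ (hm t ht), setLIntegral_condLExp hm P Z ht]
  have h1 : ∀ f : Ω → ℝ≥0∞, AEMeasurable f P →
      ∫⁻ ω in s, c ω * f ω ∂P = ∫⁻ ω in s, c ω ∂((P.withDensity f).trim hm) := by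
    intro f hf
    rw [setLIntegral_trim hm hc hs, restrict_withDensity (hm s hs),
      lintegral_withDensity_eq_lintegral_mul₀ hf.restrict (hc.mono hm le_rfl).aemeasurable]
    exact lintegral_congr fun ω => mul_comm _ _
  rw [h1 _ (measurable_condLExp' _ _ _).aemeasurable, key, ← h1 _ hZ]

/-- Needed for the factor e^{qT_s}, which may be nonintegrable: it cancels in the ratio that defines
the index once it is pulled out of both conditional expectations. -/
theorem genCondExp_mul (hm : m ≤ mΩ) {c Z : Ω → ℝ} (hc : Measurable[m] c) (hc0 : ∀ ω, 0 ≤ c ω)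
    (hZ : Integrable Z P) :
    genCondExp P m (fun ω => c ω * Z ω) =ᵐ[P] fun ω => c ω * (P[Z | m]) ω := by
  have part : ∀ Y : Ω → ℝ, Integrable Y P →
      (fun ω => (condLExp m P (fun ω' => ENNReal.ofReal (c ω' * Y ω')) ω).toReal) =ᵐ[P]
        fun ω => c ω * (P[fun ω => max (Y ω) 0 | m]) ω := by
    intro Y hY
    have e : (fun ω' => ENNReal.ofReal (c ω' * Y ω')) =
        fun ω' => ENNReal.ofReal (c ω') * ENNReal.ofReal (Y ω') :=
      funext fun ω => ENNReal.ofReal_mul (hc0 ω)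
    have h1 := condLExp_mul_of_measurable_left (P := P) hm hc.ennreal_ofReal
      hY.aemeasurable.ennreal_ofReal
    have h2 := toReal_condLExp m (μ := P) hY.aemeasurable.ennreal_ofReal
      hY.lintegral_lt_top.ne
    rw [e]
    filter_upwards [h1, h2] with ω h1 h2
    rw [h1, ENNReal.toReal_mul, ENNReal.toReal_ofReal (hc0 ω), h2]
    rfl
  have h3 : P[Z | m] =ᵐ[P] P[fun ω => max (Z ω) 0 | m] - P[fun ω => max (-Z ω) 0 | m] := by
    have := condExp_sub hZ.pos_part hZ.neg_part m
    refine EventuallyEq.trans (condExp_congr_ae (Eventually.of_forall fun ω => ?_)) this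
    simp only [Pi.sub_apply]
    rcases le_total (Z ω) 0 with h | h
    · rw [max_eq_right h, max_eq_left (by linarith)]; ring
    · rw [max_eq_left h, max_eq_right (by linarith)]; ring
  have h4 := part _ hZ.neg
  filter_upwards [part Z hZ, h4, h3] with ω h5 h6 h7
  simp only [genCondExp]
  simp only [Pi.neg_apply, mul_neg] at h6
  rw [h5, h6, h7, Pi.sub_apply, mul_sub]

theorem genCondExp_eq_condExp (hm : m ≤ mΩ) {Z : Ω → ℝ} (hZ : Integrable Z P) :
    genCondExp P m Z =ᵐ[P] P[Z | m] := by
  have := genCondExp_mul (P := P) hm (c := fun _ => 1) measurable_const (fun _ => zero_le_one) hZ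
  simpa using this

end GeneralizedConditionalExpectation

/-! ### Existence and measurability of essential suprema. -/

section EssSup

variable {Ω : Type*} {m mΩ : MeasurableSpace Ω} {P : Measure Ω}

theorem IsEssSup.congr_image {ι : Type*} {T : Set ι} {f f' : ι → Ω → ℝ} {g : Ω → ℝ}
    (h : IsEssSup P (f '' T) g) (hf : ∀ i ∈ T, f i =ᵐ[P] f' i) : IsEssSup P (f' '' T) g := by
  refine ⟨h.1, ?_, fun k hk hb => h.2.2 k hk ?_⟩
  · rintro _ ⟨i, hi, rfl⟩
    exact (hf i hi).symm.le.trans (h.2.1 _ ⟨i, hi, rfl⟩)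
  · rintro _ ⟨i, hi, rfl⟩
    exact (hf i hi).le.trans (hb _ ⟨i, hi, rfl⟩)

variable [IsProbabilityMeasure P]

/-- The map f ↦ exp(f - b) sends the family into (0, 1]. The supremum of the measures with these
densities is dominated by `P`, and its Radon-Nikodym derivative is the essential supremum of the
densities; taking the logarithm returns to the original scale. One member of `S` keeps the
derivative positive. -/
theorem exists_isEssSup {S : Set (Ω → ℝ)} (hne : S.Nonempty) {b : Ω → ℝ} (hb : AEMeasurable b P)
    (hS : ∀ f ∈ S, AEMeasurable f P) (hSb : ∀ f ∈ S, f ≤ᵐ[P] b) : ∃ g, IsEssSup P S g := by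
  set e : (Ω → ℝ) → Ω → ℝ≥0∞ := fun f ω => ENNReal.ofReal (Real.exp (f ω - b ω)) with he
  have hem : ∀ f, AEMeasurable f P → AEMeasurable (e f) P := fun f hf =>
    (Real.measurable_exp.comp_aemeasurable (hf.sub hb)).ennreal_ofReal
  set μ : Measure Ω := sSup ((fun f => P.withDensity (e f)) '' S) with hμ
  have hle : μ ≤ P := by
    refine sSup_le ?_
    rintro _ ⟨f, hf, rfl⟩
    refine (withDensity_mono (g := 1) ?_).trans (by rw [withDensity_one])
    filter_upwards [hSb f hf] with ω h
    simp only [he, Pi.one_apply]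
    rw [ENNReal.ofReal_le_one]
    exact Real.exp_le_one_iff.2 (by linarith)
  have : IsFiniteMeasure μ := isFiniteMeasure_of_le P hle
  set G := μ.rnDeriv P with hG
  have hGm : Measurable G := Measure.measurable_rnDeriv _ _
  have hμG : P.withDensity G = μ :=
    Measure.withDensity_rnDeriv_eq _ _ (Measure.absolutelyContinuous_of_le hle)
  have hGfin : ∀ᵐ ω ∂P, G ω < ∞ := Measure.rnDeriv_lt_top _ _
  have hfG : ∀ f ∈ S, e f ≤ᵐ[P] G := by
    intro f hf
    refine ae_le_of_forall_setLIntegral_le_of_sigmaFinite₀ (hem f (hS f hf)) fun s hs _ => ?_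
    rw [← withDensity_apply _ hs, ← withDensity_apply _ hs, hμG]
    exact le_sSup (Set.mem_image_of_mem (fun f => P.withDensity (e f)) hf) s
  have hGle : ∀ h, AEMeasurable h P → (∀ f ∈ S, f ≤ᵐ[P] h) → G ≤ᵐ[P] e h := by
    intro h hh hub
    refine ae_le_of_forall_setLIntegral_le_of_sigmaFinite hGm fun s hs _ => ?_
    rw [← withDensity_apply _ hs, ← withDensity_apply _ hs, hμG]
    have hle' : μ ≤ P.withDensity (e h) := by
      refine sSup_le ?_
      rintro _ ⟨f, hf, rfl⟩
      refine withDensity_mono ?_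
      filter_upwards [hub f hf] with ω h
      exact ENNReal.ofReal_le_ofReal (Real.exp_le_exp.2 (by linarith))
    exact hle' s
  obtain ⟨f₀, hf₀⟩ := hne
  have hGpos : ∀ᵐ ω ∂P, 0 < (G ω).toReal := by
    filter_upwards [hfG f₀ hf₀, hGfin] with ω h1 h2
    refine ENNReal.toReal_pos (fun h0 => ?_) h2.ne
    rw [h0] at h1
    exact absurd (ENNReal.ofReal_pos.2 (Real.exp_pos _)) (not_lt.2 h1)
  refine ⟨fun ω => b ω + Real.log (G ω).toReal,
    hb.add (Real.measurable_log.comp hGm.ennreal_toReal).aemeasurable, fun f hf => ?_,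
    fun h hh hub => ?_⟩
  · filter_upwards [hfG f hf, hGfin, hGpos] with ω h1 h2 h3
    have h4 : Real.exp (f ω - b ω) ≤ (G ω).toReal :=
      (ENNReal.ofReal_le_iff_le_toReal h2.ne).1 h1
    have := (Real.le_log_iff_exp_le h3).2 h4
    linarith
  · filter_upwards [hGle h hh hub, hGfin, hGpos] with ω h1 h2 h3
    have h4 : (G ω).toReal ≤ Real.exp (h ω - b ω) :=
      ENNReal.toReal_le_of_le_ofReal (Real.exp_pos _).le h1
    have := (Real.log_le_iff_le_exp h3).2 h4
    linarith

/-- With E = exp(g - b), each member f of `S` satisfies exp(f - b) ≤ P[E | m] because the left side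
is `m`-measurable. By minimality E ≤ P[E | m], and equal integrals force equality almost surely. -/
theorem IsEssSup.exists_measurable (hm : m ≤ mΩ) {S : Set (Ω → ℝ)}
    {g : Ω → ℝ} (hg : IsEssSup P S g) {b : Ω → ℝ} (hb : Measurable[m] b)
    (hS : ∀ f ∈ S, Measurable[m] f) (hSb : ∀ f ∈ S, f ≤ᵐ[P] b) :
    ∃ g', Measurable[m] g' ∧ g =ᵐ[P] g' := by
  have hbm : Measurable b := hb.mono hm le_rfl
  have hgb : g ≤ᵐ[P] b := hg.2.2 b hbm.aemeasurable hSb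
  have hint : ∀ f : Ω → ℝ, AEMeasurable f P → f ≤ᵐ[P] b →
      Integrable (fun ω => Real.exp (f ω - b ω)) P := by
    intro f hf hfb
    refine Integrable.of_bound
      (Real.measurable_exp.comp_aemeasurable (hf.sub hbm.aemeasurable)).aestronglyMeasurable 1 ?_
    filter_upwards [hfb] with ω h
    rw [Real.norm_eq_abs, abs_of_pos (Real.exp_pos _)]
    exact Real.exp_le_one_iff.2 (by linarith)
  set E : Ω → ℝ := fun ω => Real.exp (g ω - b ω) with hE
  have hEi : Integrable E P := hint g hg.1 hgb
  have hcm : Measurable[m] (P[E | m]) := stronglyMeasurable_condExp.measurable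
  have hpos : ∀ᵐ ω ∂P, 0 < (P[E | m]) ω := by
    have hs : MeasurableSet[m] {ω | (P[E | m]) ω ≤ 0} := measurableSet_le hcm measurable_const
    have h1 : ∫ ω in {ω | (P[E | m]) ω ≤ 0}, E ω ∂P ≤ 0 := by
      rw [← setIntegral_condExp hm hEi hs]
      exact setIntegral_nonpos (hm _ hs) fun ω h => h
    have h2 := (setIntegral_pos_iff_support_of_nonneg_ae
      (Eventually.of_forall fun ω => (Real.exp_pos (g ω - b ω)).le) hEi.integrableOn).not.1
      (not_lt.2 h1)
    have h3 : Function.support E = Set.univ :=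
      Set.eq_univ_of_forall fun ω => (Real.exp_pos _).ne'
    change ¬ 0 < P (Function.support E ∩ _) at h2
    rw [h3, Set.univ_inter, not_lt, nonpos_iff_eq_zero] at h2
    rw [ae_iff]
    simpa using h2
  have hle : g ≤ᵐ[P] fun ω => b ω + Real.log ((P[E | m]) ω) := by
    refine hg.2.2 _ (hb.add (Real.measurable_log.comp hcm) |>.mono hm le_rfl).aemeasurable
      fun f hf => ?_
    have hfm : Measurable f := (hS f hf).mono hm le_rfl
    have hfi := hint f hfm.aemeasurable (hSb f hf)
    have h1 : P[fun ω => Real.exp (f ω - b ω) | m] ≤ᵐ[P] P[E | m] := by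
      refine condExp_mono hfi hEi ?_
      filter_upwards [hg.2.1 f hf] with ω h
      exact Real.exp_le_exp.2 (by linarith)
    have hfs : StronglyMeasurable[m] fun ω => Real.exp (f ω - b ω) :=
      (Real.measurable_exp.comp ((hS f hf).sub hb)).stronglyMeasurable
    rw [condExp_of_stronglyMeasurable hm hfs hfi] at h1
    filter_upwards [h1, hpos] with ω h1 h2
    have := (Real.le_log_iff_exp_le h2).2 h1
    linarith
  have hE' : E =ᵐ[P] P[E | m] := by
    have h1 : E ≤ᵐ[P] P[E | m] := by
      filter_upwards [hle, hpos] with ω h1 h2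
      rw [← Real.le_log_iff_exp_le h2]
      linarith
    exact (integral_eq_iff_of_ae_le hEi integrable_condExp h1).1 (integral_condExp hm).symm
  refine ⟨fun ω => b ω + Real.log ((P[E | m]) ω), hb.add (Real.measurable_log.comp hcm), ?_⟩
  filter_upwards [hE'] with ω h
  rw [← h]
  simp [hE]

end EssSup

/-! ### Conditioning on joins of independent σ-algebras. -/

section Independence

variable {Ω : Type*}

theorem sup_eq_generateFrom_inter (m₁ m₂ : MeasurableSpace Ω) :
    m₁ ⊔ m₂ = MeasurableSpace.generateFrom
      {s | ∃ a b, MeasurableSet[m₁] a ∧ MeasurableSet[m₂] b ∧ s = a ∩ b} := by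
  apply le_antisymm
  · refine sup_le (fun a ha => ?_) fun b hb => ?_
    · exact MeasurableSpace.measurableSet_generateFrom
        ⟨a, Set.univ, ha, @MeasurableSet.univ _ m₂, (Set.inter_univ a).symm⟩
    · exact MeasurableSpace.measurableSet_generateFrom
        ⟨Set.univ, b, @MeasurableSet.univ _ m₁, hb, (Set.univ_inter b).symm⟩
  · refine MeasurableSpace.generateFrom_le ?_
    rintro _ ⟨a, b, ha, hb, rfl⟩
    exact @MeasurableSet.inter _ (m₁ ⊔ m₂) _ _ (le_sup_left (a := m₁) (b := m₂) _ ha)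
      (le_sup_right (a := m₁) (b := m₂) _ hb)

theorem isPiSystem_inter (m₁ m₂ : MeasurableSpace Ω) :
    IsPiSystem {s : Set Ω | ∃ a b, MeasurableSet[m₁] a ∧ MeasurableSet[m₂] b ∧ s = a ∩ b} := by
  rintro _ ⟨a, b, ha, hb, rfl⟩ _ ⟨a', b', ha', hb', rfl⟩ _
  exact ⟨a ∩ a', b ∩ b', @MeasurableSet.inter _ m₁ _ _ ha ha', @MeasurableSet.inter _ m₂ _ _ hb hb',
    Set.inter_inter_inter_comm _ _ _ _⟩

variable {m n₁ n₂ m₁ m₂ mΩ : MeasurableSpace Ω} {P : Measure Ω}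

theorem setIntegral_eq_of_sup (h₁ : m₁ ≤ mΩ) (h₂ : m₂ ≤ mΩ) {f g : Ω → ℝ} (hf : Integrable f P)
    (hg : Integrable g P)
    (h : ∀ a b, MeasurableSet[m₁] a → MeasurableSet[m₂] b →
      ∫ ω in a ∩ b, f ω ∂P = ∫ ω in a ∩ b, g ω ∂P) {s : Set Ω} (hs : MeasurableSet[m₁ ⊔ m₂] s) :
    ∫ ω in s, f ω ∂P = ∫ ω in s, g ω ∂P := by
  have hle : m₁ ⊔ m₂ ≤ mΩ := sup_le h₁ h₂
  have huniv : ∫ ω, f ω ∂P = ∫ ω, g ω ∂P := by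
    simpa using h Set.univ Set.univ (@MeasurableSet.univ _ m₁) (@MeasurableSet.univ _ m₂)
  refine MeasurableSpace.induction_on_inter
    (C := fun s _ => ∫ ω in s, f ω ∂P = ∫ ω in s, g ω ∂P) (sup_eq_generateFrom_inter m₁ m₂)
    (isPiSystem_inter m₁ m₂) (by simp) ?_ ?_ ?_ s hs
  · rintro _ ⟨a, b, ha, hb, rfl⟩
    exact h a b ha hb
  · intro t ht hC
    rw [setIntegral_compl (hle _ ht) hf, setIntegral_compl (hle _ ht) hg, hC, huniv]
  · intro t hd ht hC
    rw [integral_iUnion (fun i => hle _ (ht i)) hd hf.integrableOn,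
      integral_iUnion (fun i => hle _ (ht i)) hd hg.integrableOn]
    exact tsum_congr hC

variable [IsProbabilityMeasure P]

theorem setIntegral_inter_of_indep (h₁ : m₁ ≤ mΩ) (h₂ : m₂ ≤ mΩ) (hi : Indep m₁ m₂ P) {f : Ω → ℝ}
    (hf : StronglyMeasurable[m₁] f) (hfi : Integrable f P) {a b : Set Ω} (ha : MeasurableSet[m₁] a)
    (hb : MeasurableSet[m₂] b) :
    ∫ ω in a ∩ b, f ω ∂P = P.real b * ∫ ω in a, f ω ∂P := by
  have h := condExp_indep_eq h₁ h₂ (hf.indicator ha) hi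
  rw [Set.inter_comm, ← setIntegral_indicator (h₁ _ ha),
    ← setIntegral_condExp h₂ (hfi.indicator (h₁ _ ha)) hb,
    setIntegral_congr_ae (h₂ _ hb) (h.mono fun ω hω _ => hω), setIntegral_const,
    integral_indicator (h₁ _ ha), smul_eq_mul]

/-- By a π-λ argument it suffices to test on intersections a ∩ b, where independence splits off the
factor P(b) on both sides. -/
theorem condExp_sup_of_indep (hm : m ≤ m₁) (h₁ : m₁ ≤ mΩ) (h₂ : m₂ ≤ mΩ)
    (hi : Indep m₁ m₂ P) {f : Ω → ℝ} (hf : StronglyMeasurable[m₁] f) (hfi : Integrable f P) :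
    P[f | m ⊔ m₂] =ᵐ[P] P[f | m] := by
  symm
  have hsm : StronglyMeasurable[m ⊔ m₂] (P[f | m]) :=
    (stronglyMeasurable_condExp (m := m)).mono le_sup_left
  refine ae_eq_condExp_of_forall_setIntegral_eq (sup_le (hm.trans h₁) h₂) hfi
    (fun s _ _ => integrable_condExp.integrableOn) (fun s hs _ => ?_) hsm.aestronglyMeasurable
  refine setIntegral_eq_of_sup (hm.trans h₁) h₂ integrable_condExp hfi (fun a b ha hb => ?_) hs
  rw [setIntegral_inter_of_indep h₁ h₂ hi (stronglyMeasurable_condExp.mono hm) integrable_condExp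
    (hm _ ha) hb, setIntegral_inter_of_indep h₁ h₂ hi hf hfi (hm _ ha) hb,
    setIntegral_condExp (hm.trans h₁) hfi ha]

/-- Lets a weight that also depends on the independent arms `m₂` be treated like an `m`-measurable
one. -/
theorem integral_mul_condExp_of_indep (hm : m ≤ m₁) (h₁ : m₁ ≤ mΩ)
    (h₂ : m₂ ≤ mΩ) (hi : Indep m₁ m₂ P) {f R : Ω → ℝ} (hf : StronglyMeasurable[m₁] f)
    (hfi : Integrable f P) (hR : StronglyMeasurable[m ⊔ m₂] R)
    (hRf : Integrable (fun ω => R ω * f ω) P) :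
    ∫ ω, R ω * (P[f | m]) ω ∂P = ∫ ω, R ω * f ω ∂P := by
  have h := condExp_mul_of_stronglyMeasurable_left hR hRf hfi
  rw [← integral_condExp (sup_le (hm.trans h₁) h₂) (f := fun ω => R ω * f ω)]
  refine integral_congr_ae ?_
  filter_upwards [h, condExp_sup_of_indep hm h₁ h₂ hi hf hfi] with ω h h'
  change _ = (P[R * f | m ⊔ m₂]) ω
  rw [h, Pi.mul_apply, h']

/-- An event that needs no extra information of the second arm, and also none of the first, needs
neither up to a null set. The indicator of A is shown to equal its conditional expectation given n₁
⊔ n₂, tested on a ∩ b with a in n₁ and b in m₂. -/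
theorem exists_measurableSet_ae_eq_of_indep (hn₁ : n₁ ≤ m₁)
    (hn₂ : n₂ ≤ m₂) (h₁ : m₁ ≤ mΩ) (h₂ : m₂ ≤ mΩ) (hi : Indep m₁ m₂ P) {A : Set Ω}
    (hA₁ : MeasurableSet[m₁ ⊔ n₂] A) (hA₂ : MeasurableSet[n₁ ⊔ m₂] A) :
    ∃ A', MeasurableSet[n₁ ⊔ n₂] A' ∧ A =ᵐ[P] A' := by
  have hM : n₁ ⊔ n₂ ≤ mΩ := sup_le (hn₁.trans h₁) (hn₂.trans h₂)
  have hA : MeasurableSet A := sup_le h₁ (hn₂.trans h₂) _ hA₁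
  set I : Set Ω → Ω → ℝ := fun s => s.indicator 1 with hI
  have hIi : ∀ {s}, MeasurableSet s → Integrable (I s) P := fun hs =>
    (integrable_const 1).indicator hs
  have hIm : ∀ {m : MeasurableSpace Ω} {s}, MeasurableSet[m] s → StronglyMeasurable[m] (I s) :=
    fun hs => stronglyMeasurable_one.indicator hs
  have hII : ∀ s t ω, I (s ∩ t) ω = I s ω * I t ω := fun s t ω => by
    simp only [hI, Set.inter_indicator_one, Pi.mul_apply]
  have bdd : ∀ {s} {f : Ω → ℝ}, MeasurableSet s → Integrable f P →
      Integrable (fun ω => I s ω * f ω) P := by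
    intro s f hs hf
    have : (fun ω => I s ω * f ω) = s.indicator f := by
      funext ω; by_cases h : ω ∈ s <;> simp [hI, h]
    rw [this]
    exact hf.indicator hs
  have setI : ∀ {s} {f : Ω → ℝ}, MeasurableSet s → ∫ ω in s, f ω ∂P = ∫ ω, I s ω * f ω ∂P := by
    intro s f hs
    rw [← integral_indicator hs]
    refine integral_congr_ae (Eventually.of_forall fun ω => ?_)
    by_cases h : ω ∈ s <;> simp [hI, h]
  have key : I A =ᵐ[P] P[I A | n₁ ⊔ n₂] := by
    have hle : n₁ ⊔ m₂ ≤ mΩ := sup_le (hn₁.trans h₁) h₂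
    have e1 : P[I A | n₁ ⊔ m₂] = I A :=
      condExp_of_stronglyMeasurable hle (hIm hA₂) (hIi hA)
    rw [← e1]
    refine (ae_eq_condExp_of_forall_setIntegral_eq hle (hIi hA)
      (fun s _ _ => integrable_condExp.integrableOn) (fun s hs _ => ?_)
      (stronglyMeasurable_condExp.mono (sup_le_sup_left hn₂ n₁)).aestronglyMeasurable).symm.trans
      (by rw [e1])
    refine setIntegral_eq_of_sup (hn₁.trans h₁) h₂ integrable_condExp (hIi hA)
      (fun a b ha hb => ?_) hs
    have ha' := h₁ _ (hn₁ _ ha)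
    have hb' := h₂ _ hb
    -- conditioning `b` on either enlargement of `n₂` by part of `m₁` gives `P[I b | n₂]`
    have c1 : P[I b | n₂ ⊔ m₁] =ᵐ[P] P[I b | n₂] :=
      condExp_sup_of_indep hn₂ h₂ h₁ hi.symm (hIm hb) (hIi hb')
    have c2 : P[I b | n₂ ⊔ n₁] =ᵐ[P] P[I b | n₂] :=
      condExp_sup_of_indep hn₂ h₂ (hn₁.trans h₁) (indep_of_indep_of_le_left hi hn₁).symm (hIm hb)
        (hIi hb')
    have pull : ∀ {n : MeasurableSpace Ω} {f g : Ω → ℝ}, n ≤ mΩ → StronglyMeasurable[n] f →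
        Integrable g P → Integrable (fun ω => f ω * g ω) P →
        ∫ ω, f ω * g ω ∂P = ∫ ω, f ω * (P[g | n]) ω ∂P := by
      intro n f g hn hf hg hfg
      rw [← integral_condExp hn (f := fun ω => f ω * g ω)]
      exact integral_congr_ae (condExp_mul_of_stronglyMeasurable_left hf hfg hg)
    have bA : Integrable (P[I A | n₁ ⊔ n₂]) P := integrable_condExp
    have bI : Integrable (P[I b | n₁ ⊔ n₂]) P := integrable_condExp
    have hAm : StronglyMeasurable[n₁ ⊔ n₂] (P[I A | n₁ ⊔ n₂]) := stronglyMeasurable_condExp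
    have hbm : StronglyMeasurable[n₁ ⊔ n₂] (P[I b | n₁ ⊔ n₂]) := stronglyMeasurable_condExp
    have haM : StronglyMeasurable[n₁ ⊔ n₂] (I a) := hIm (le_sup_left (a := n₁) (b := n₂) _ ha)
    have hAb : Integrable (fun ω => I A ω * (P[I b | n₁ ⊔ n₂]) ω) P := bdd hA bI
    have hAb' : Integrable (fun ω => (P[I A | n₁ ⊔ n₂]) ω * I b ω) P :=
      (bdd hb' bA).congr (Eventually.of_forall fun ω => mul_comm _ _)
    -- The projection moves from b to A by self-adjointness. Then the projection of b onto n₁ ⊔ n₂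
    -- is exchanged for that onto m₁ ⊔ n₂, past which A itself can be pulled.
    calc ∫ ω in a ∩ b, (P[I A | n₁ ⊔ n₂]) ω ∂P
        = ∫ ω, (I a ω * (P[I A | n₁ ⊔ n₂]) ω) * I b ω ∂P := by
          rw [setI (ha'.inter hb')]
          exact integral_congr_ae (Eventually.of_forall fun ω => by
            simp only [hII]; ring)
      _ = ∫ ω, (I a ω * (P[I A | n₁ ⊔ n₂]) ω) * (P[I b | n₁ ⊔ n₂]) ω ∂P := by
          refine pull hM (haM.mul hAm) (hIi hb') ?_
          exact (bdd ha' hAb').congr (Eventually.of_forall fun ω => by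
            dsimp only; ring)
      _ = ∫ ω, (I a ω * (P[I b | n₁ ⊔ n₂]) ω) * (P[I A | n₁ ⊔ n₂]) ω ∂P :=
          integral_congr_ae (Eventually.of_forall fun ω => by
            dsimp only; ring)
      _ = ∫ ω, (I a ω * (P[I b | n₁ ⊔ n₂]) ω) * I A ω ∂P := by
          refine (pull hM (haM.mul hbm) (hIi hA) ?_).symm
          exact (bdd ha' hAb).congr (Eventually.of_forall fun ω => by
            simp only [Pi.mul_apply]; ring)
      _ = ∫ ω, (I a ω * I A ω) * (P[I b | m₁ ⊔ n₂]) ω ∂P := by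
          refine integral_congr_ae ?_
          rw [sup_comm n₂ m₁] at c1
          rw [sup_comm n₂ n₁] at c2
          filter_upwards [c1, c2] with ω h h'
          rw [h, h']; ring
      _ = ∫ ω, (I a ω * I A ω) * I b ω ∂P := by
          refine (pull (sup_le h₁ (hn₂.trans h₂)) ((hIm (le_sup_left (a := m₁) (b := n₂) _
            (hn₁ _ ha))).mul (hIm hA₁)) (hIi hb') ?_).symm
          exact (bdd (ha'.inter hA) (hIi hb')).congr (Eventually.of_forall fun ω => by
            simp only [hII, Pi.mul_apply])
      _ = ∫ ω in a ∩ b, I A ω ∂P := by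
          rw [setI (ha'.inter hb')]
          exact integral_congr_ae (Eventually.of_forall fun ω => by simp only [hII]; ring)
  refine ⟨{ω | (P[I A | n₁ ⊔ n₂]) ω = 1}, ?_, ?_⟩
  · exact measurableSet_eq_fun stronglyMeasurable_condExp.measurable measurable_const
  · filter_upwards [key] with ω h
    refine propext ⟨fun hω => ?_, fun hω => ?_⟩
    · change (P[I A | n₁ ⊔ n₂]) ω = 1
      rw [← h]
      simp only [hI]
      exact Set.indicator_of_mem (f := (1 : Ω → ℝ)) hω
    · by_contra hn
      have h' : (P[I A | n₁ ⊔ n₂]) ω = 1 := hω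
      rw [← h] at h'
      simp only [hI] at h'
      rw [Set.indicator_of_notMem hn] at h'
      exact zero_ne_one h'

end Independence

/-! ### Series that converge absolutely in L¹. -/

section AbsSummable

variable {Ω ι : Type*} [Countable ι] {mΩ : MeasurableSpace Ω} {P : Measure Ω}

/-- The family `f` of random variables is absolutely summable in `L¹`. -/
def AbsSummable (P : Measure Ω) (f : ι → Ω → ℝ) : Prop :=
  (∀ i, AEStronglyMeasurable (f i) P) ∧ ∑' i, ∫⁻ ω, ‖f i ω‖ₑ ∂P ≠ ∞

namespace AbsSummable

variable {f g : ι → Ω → ℝ}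

theorem integrable (hf : AbsSummable P f) (i : ι) : Integrable (f i) P :=
  ⟨hf.1 i, (ENNReal.ne_top_of_tsum_ne_top hf.2 i).lt_top⟩

theorem ae_summable_abs (hf : AbsSummable P f) : ∀ᵐ ω ∂P, Summable fun i => |f i ω| := by
  have h := hf.2
  rw [← lintegral_tsum fun i => (hf.1 i).enorm] at h
  filter_upwards [ae_lt_top' (AEMeasurable.tsum fun i => (hf.1 i).enorm) h] with ω hω
  exact tsum_enorm_ne_top_iff_summable_norm.1 hω.ne

theorem ae_summable (hf : AbsSummable P f) : ∀ᵐ ω ∂P, Summable fun i => f i ω :=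
  hf.ae_summable_abs.mono fun _ h => h.of_abs

theorem mono (hf : AbsSummable P f) (hg : ∀ i, AEStronglyMeasurable (g i) P)
    (hgf : ∀ i, ∀ᵐ ω ∂P, |g i ω| ≤ |f i ω|) : AbsSummable P g := by
  refine ⟨hg, ne_top_of_le_ne_top hf.2 (ENNReal.tsum_le_tsum fun i => lintegral_mono_ae ?_)⟩
  filter_upwards [hgf i] with ω h
  rwa [← ofReal_norm, ← ofReal_norm, ENNReal.ofReal_le_ofReal_iff (norm_nonneg _)]

theorem abs (hf : AbsSummable P f) : AbsSummable P fun i ω => |f i ω| :=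
  hf.mono (fun i => (hf.1 i).norm) fun i => Eventually.of_forall fun ω => by rw [abs_abs]

theorem add (hf : AbsSummable P f) (hg : AbsSummable P g) :
    AbsSummable P fun i ω => f i ω + g i ω := by
  refine ⟨fun i => (hf.1 i).add (hg.1 i), ne_top_of_le_ne_top (ENNReal.add_ne_top.2 ⟨hf.2, hg.2⟩) ?_⟩
  rw [← ENNReal.tsum_add]
  refine ENNReal.tsum_le_tsum fun i => ?_
  rw [← lintegral_add_left' (hf.1 i).enorm]
  exact lintegral_mono fun ω => enorm_add_le _ _

theorem neg (hf : AbsSummable P f) : AbsSummable P fun i ω => -f i ω :=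
  hf.mono (fun i => (hf.1 i).neg) fun i => Eventually.of_forall fun ω => by rw [abs_neg]

theorem sub (hf : AbsSummable P f) (hg : AbsSummable P g) :
    AbsSummable P fun i ω => f i ω - g i ω := by
  simpa only [sub_eq_add_neg] using hf.add hg.neg

theorem comp_injective {κ : Type*} [Countable κ] (hf : AbsSummable P f) {e : κ → ι}
    (he : Function.Injective e) : AbsSummable P fun k => f (e k) :=
  ⟨fun _ => hf.1 _, ne_top_of_le_ne_top hf.2 (ENNReal.tsum_comp_le_tsum_of_injective he _)⟩

theorem indicator (hf : AbsSummable P f) {S : ι → Set Ω} (hS : ∀ i, MeasurableSet (S i)) :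
    AbsSummable P fun i => (S i).indicator (f i) := by
  refine hf.mono (fun i => (hf.1 i).indicator (hS i)) fun i => Eventually.of_forall fun ω => ?_
  by_cases h : ω ∈ S i <;> simp [h]

theorem hasSum_setIntegral (hf : AbsSummable P f) (A : Set Ω) :
    HasSum (fun i => ∫ ω in A, f i ω ∂P) (∫ ω in A, ∑' i, f i ω ∂P) := by
  have h2 : ∑' i, ∫⁻ ω in A, ‖f i ω‖ₑ ∂P ≠ ∞ :=
    ne_top_of_le_ne_top hf.2 (ENNReal.tsum_le_tsum fun i => setLIntegral_le_lintegral _ _)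
  rw [integral_tsum (fun i => (hf.1 i).restrict) h2]
  refine Summable.hasSum (Summable.of_norm ?_)
  refine Summable.of_nonneg_of_le (fun _ => norm_nonneg _)
    (fun i => ?_) (ENNReal.summable_toReal h2)
  rw [← integral_norm_eq_lintegral_enorm (hf.1 i).restrict]
  exact norm_integral_le_integral_norm _

theorem hasSum_integral (hf : AbsSummable P f) :
    HasSum (fun i => ∫ ω, f i ω ∂P) (∫ ω, ∑' i, f i ω ∂P) := by
  simpa using hf.hasSum_setIntegral Set.univ

theorem integrable_tsum (hf : AbsSummable P f) : Integrable (fun ω => ∑' i, f i ω) P := by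
  have hm : AEMeasurable (fun ω => ∑' i, ‖f i ω‖ₑ) P :=
    AEMeasurable.tsum fun i => (hf.1 i).enorm
  have hlt : ∫⁻ ω, ∑' i, ‖f i ω‖ₑ ∂P ≠ ∞ := by
    rw [lintegral_tsum fun i => (hf.1 i).enorm]; exact hf.2
  have hb : Integrable (fun ω => (∑' i, ‖f i ω‖ₑ).toReal) P :=
    integrable_toReal_of_lintegral_ne_top hm hlt
  refine hb.mono' ?_ ?_
  · obtain ⟨s, hs⟩ := (atTop : Filter (Finset ι)).exists_seq_tendsto
    refine aestronglyMeasurable_of_tendsto_ae atTop (f := fun n ω => ∑ i ∈ s n, f i ω)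
      (fun n => Finset.aestronglyMeasurable_fun_sum _ fun i _ => hf.1 i) ?_
    filter_upwards [hf.ae_summable] with ω hω
    exact hω.hasSum.comp hs
  · filter_upwards [hf.ae_summable_abs, ae_lt_top' hm hlt] with ω hω h
    rw [← ENNReal.ofReal_le_iff_le_toReal h.ne, ofReal_norm]
    exact enorm_tsum_le_tsum_enorm

end AbsSummable

end AbsSummable

/-! ### Optimal stopping of a sum: the Snell envelope. -/

section Snell

variable {Ω : Type*} {mΩ : MeasurableSpace Ω}

/-- `k` steps of backward induction for the problem of stopping the accumulation of `Y`. -/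
noncomputable def snellIterate (P : Measure Ω) (F : Filtration ℕ mΩ) (Y : ℕ → Ω → ℝ) :
    ℕ → ℕ → Ω → ℝ
  | 0, _ => 0
  | k + 1, u => fun ω => max 0 (Y u ω + (P[snellIterate P F Y k (u + 1) | F u]) ω)

/-- The Snell envelope of the problem of stopping the accumulation of `Y`: the optimal expected
future gain. -/
noncomputable def snellEnvelope (P : Measure Ω) (F : Filtration ℕ mΩ) (Y : ℕ → Ω → ℝ)
    (u : ℕ) (ω : Ω) : ℝ := ⨆ k, snellIterate P F Y k u ω

variable {P : Measure Ω} [IsProbabilityMeasure P] {F : Filtration ℕ mΩ} {Y : ℕ → Ω → ℝ}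

theorem stronglyMeasurable_snellIterate (hY : ∀ u, StronglyMeasurable[F u] (Y u)) (k u : ℕ) :
    StronglyMeasurable[F u] (snellIterate P F Y k u) := by
  cases k with
  | zero => exact stronglyMeasurable_zero
  | succ k =>
    exact (measurable_const.max
      ((hY u).measurable.add stronglyMeasurable_condExp.measurable)).stronglyMeasurable

theorem snellIterate_nonneg (k u : ℕ) (ω : Ω) : 0 ≤ snellIterate P F Y k u ω := by
  cases k with
  | zero => exact le_rfl
  | succ k => exact le_max_left _ _

theorem integrable_snellIterate (hY : AbsSummable P Y) (k u : ℕ) :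
    Integrable (snellIterate P F Y k u) P := by
  cases k with
  | zero => exact integrable_zero _ _ _
  | succ k =>
    exact (integrable_zero _ _ _).sup ((hY.integrable u).add integrable_condExp)

theorem snellIterate_le_succ (hY : AbsSummable P Y) (k u : ℕ) :
    snellIterate P F Y k u ≤ᵐ[P] snellIterate P F Y (k + 1) u := by
  induction k generalizing u with
  | zero => exact Eventually.of_forall fun ω => snellIterate_nonneg _ _ _
  | succ k ih =>
    filter_upwards [condExp_mono (m := F u) (integrable_snellIterate hY k (u + 1))
      (integrable_snellIterate hY (k + 1) (u + 1)) (ih (u + 1))] with ω h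
    exact max_le_max_left _ (by linarith)

theorem ae_tsum_shift (hY : AbsSummable P Y) (u : ℕ) :
    (fun ω => ∑' v, Y (u + v) ω) =ᵐ[P] fun ω => Y u ω + ∑' v, Y (u + 1 + v) ω := by
  filter_upwards [(hY.comp_injective (add_right_injective u)).ae_summable] with ω h
  rw [h.tsum_eq_zero_add]
  simp only [add_zero, add_assoc, add_comm 1]

theorem snellIterate_le (hY : AbsSummable P Y) (hYm : ∀ u, StronglyMeasurable[F u] (Y u))
    (k u : ℕ) : snellIterate P F Y k u ≤ᵐ[P] P[fun ω => ∑' v, |Y (u + v) ω| | F u] := by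
  have hT : ∀ u, Integrable (fun ω => ∑' v, |Y (u + v) ω|) P := fun u =>
    (hY.abs.comp_injective (add_right_injective u)).integrable_tsum
  induction k generalizing u with
  | zero =>
    exact condExp_nonneg (Eventually.of_forall fun ω => tsum_nonneg fun v => abs_nonneg _)
  | succ k ih =>
    have h1 := condExp_mono (m := F u) (integrable_snellIterate hY k (u + 1)) integrable_condExp
      (ih (u + 1))
    have h2 := condExp_condExp_of_le (μ := P) (f := fun ω => ∑' v, |Y (u + 1 + v) ω|)
      (F.mono (Nat.le_succ u)) (F.le (u + 1))
    have h3 := (condExp_congr_ae (m := F u) (ae_tsum_shift hY.abs u)).trans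
      (condExp_add (hY.integrable u).abs (hT (u + 1)) (F u))
    have hYa : StronglyMeasurable[F u] fun ω => |Y u ω| :=
      continuous_abs.comp_stronglyMeasurable (hYm u)
    have h4 := condExp_of_stronglyMeasurable (F.le u) hYa (hY.integrable u).abs
    have h5 : 0 ≤ᵐ[P] P[fun ω => ∑' v, |Y (u + 1 + v) ω| | F u] :=
      condExp_nonneg (Eventually.of_forall fun ω => tsum_nonneg fun v => abs_nonneg _)
    filter_upwards [h1, h2, h3, h5] with ω h1 h2 h3 h5
    rw [h3, Pi.add_apply, h4]
    refine max_le (add_nonneg (abs_nonneg _) h5) (add_le_add (le_abs_self _) ?_)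
    exact h1.trans_eq h2

/-- Where the iterates are unbounded the real supremum is 0 by default; the bound by the expected
absolute tail confines this to a null set. -/
theorem ae_tendsto_snellIterate (hY : AbsSummable P Y) (hYm : ∀ u, StronglyMeasurable[F u] (Y u))
    (u : ℕ) : ∀ᵐ ω ∂P, (∀ k, snellIterate P F Y k u ω ≤ snellEnvelope P F Y u ω) ∧
      Tendsto (fun k => snellIterate P F Y k u ω) atTop (nhds (snellEnvelope P F Y u ω)) := by
  filter_upwards [ae_all_iff.2 fun k => snellIterate_le_succ (F := F) hY k u,
    ae_all_iff.2 fun k => snellIterate_le hY hYm k u] with ω h1 h2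
  have hb : BddAbove (Set.range fun k => snellIterate P F Y k u ω) :=
    ⟨_, by rintro _ ⟨k, rfl⟩; exact h2 k⟩
  exact ⟨fun k => le_ciSup hb k, tendsto_atTop_ciSup (monotone_nat_of_le_succ h1) hb⟩

theorem measurable_snellEnvelope (hYm : ∀ u, StronglyMeasurable[F u] (Y u)) (u : ℕ) :
    Measurable[F u] (snellEnvelope P F Y u) :=
  Measurable.iSup fun k => (stronglyMeasurable_snellIterate hYm k u).measurable

theorem snellEnvelope_nonneg (u : ℕ) (ω : Ω) : 0 ≤ snellEnvelope P F Y u ω :=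
  Real.iSup_nonneg fun k => snellIterate_nonneg k u ω

theorem snellEnvelope_le (hY : AbsSummable P Y) (hYm : ∀ u, StronglyMeasurable[F u] (Y u))
    (u : ℕ) : snellEnvelope P F Y u ≤ᵐ[P] P[fun ω => ∑' v, |Y (u + v) ω| | F u] := by
  filter_upwards [ae_all_iff.2 fun k => snellIterate_le hY hYm k u] with ω h2
  exact ciSup_le h2

theorem integrable_snellEnvelope (hY : AbsSummable P Y) (hYm : ∀ u, StronglyMeasurable[F u] (Y u))
    (u : ℕ) : Integrable (snellEnvelope P F Y u) P := by
  refine (integrable_condExp (m := F u) (f := fun ω => ∑' v, |Y (u + v) ω|)).mono'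
    ((measurable_snellEnvelope hYm u).mono (F.le u) le_rfl).aestronglyMeasurable ?_
  filter_upwards [snellEnvelope_le hY hYm u] with ω h
  rwa [Real.norm_of_nonneg (snellEnvelope_nonneg u ω)]

theorem tendsto_setIntegral_tsum_shift (hY : AbsSummable P Y) (A : Set Ω) :
    Tendsto (fun n => ∫ ω in A, ∑' v, Y (n + v) ω ∂P) atTop (nhds 0) := by
  have h := tendsto_sum_nat_add fun v => ∫ ω in A, Y v ω ∂P
  refine h.congr fun n => ?_
  rw [← ((hY.comp_injective (add_right_injective n)).hasSum_setIntegral A).tsum_eq]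
  exact tsum_congr fun v => by rw [add_comm]

theorem tendsto_integral_snellEnvelope (hY : AbsSummable P Y)
    (hYm : ∀ u, StronglyMeasurable[F u] (Y u)) :
    Tendsto (fun n => ∫ ω, snellEnvelope P F Y n ω ∂P) atTop (nhds 0) := by
  have h := tendsto_setIntegral_tsum_shift hY.abs Set.univ
  refine squeeze_zero (fun n => integral_nonneg (snellEnvelope_nonneg n)) (fun n => ?_) h
  rw [setIntegral_univ, ← integral_condExp (F.le n) (f := fun ω => ∑' v, |Y (n + v) ω|)]
  exact integral_mono_ae (integrable_snellEnvelope hY hYm n) integrable_condExp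
    (snellEnvelope_le hY hYm n)

theorem setIntegral_add_snellEnvelope_le (hY : AbsSummable P Y)
    (hYm : ∀ u, StronglyMeasurable[F u] (Y u)) {u : ℕ} {A : Set Ω} (hA : MeasurableSet[F u] A) :
    ∫ ω in A, (Y u ω + snellEnvelope P F Y (u + 1) ω) ∂P ≤
      ∫ ω in A, snellEnvelope P F Y u ω ∂P := by
  have hA' := F.le u _ hA
  have hlim : Tendsto (fun k => ∫ ω in A, (Y u ω + snellIterate P F Y k (u + 1) ω) ∂P) atTop
      (nhds (∫ ω in A, (Y u ω + snellEnvelope P F Y (u + 1) ω) ∂P)) := by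
    refine tendsto_integral_of_dominated_convergence
      (fun ω => |Y u ω| + |snellEnvelope P F Y (u + 1) ω|)
      (fun k => ((hY.integrable u).add (integrable_snellIterate hY k _)).1.restrict)
      ((hY.integrable u).abs.add (integrable_snellEnvelope hY hYm _).abs).integrableOn
      (fun k => ae_restrict_of_ae ?_) (ae_restrict_of_ae ?_)
    · filter_upwards [ae_tendsto_snellIterate hY hYm (u + 1)] with ω h
      refine (norm_add_le _ _).trans (add_le_add le_rfl ?_)
      rw [Real.norm_of_nonneg (snellIterate_nonneg _ _ _)]
      exact (h.1 k).trans (le_abs_self _)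
    · filter_upwards [ae_tendsto_snellIterate hY hYm (u + 1)] with ω h
      exact tendsto_const_nhds.add h.2
  refine le_of_tendsto' hlim fun k => ?_
  rw [integral_add (hY.integrable u).integrableOn (integrable_snellIterate hY k _).integrableOn,
    ← setIntegral_condExp (F.le u) (integrable_snellIterate hY k _) hA,
    ← integral_add (hY.integrable u).integrableOn integrable_condExp.integrableOn]
  refine integral_mono_ae ((hY.integrable u).add integrable_condExp).integrableOn
    (integrable_snellEnvelope hY hYm u).integrableOn (ae_restrict_of_ae ?_)
  filter_upwards [ae_tendsto_snellIterate hY hYm u] with ω h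
  exact (le_max_right _ _).trans (h.1 (k + 1))

/-- With the supermartingale inequality above, this is the half of the dynamic programming equation
that shows continuing to be optimal wherever the continuation value is nonnegative. -/
theorem snellEnvelope_le_max (hY : AbsSummable P Y) (hYm : ∀ u, StronglyMeasurable[F u] (Y u))
    (u : ℕ) : ∀ᵐ ω ∂P, snellEnvelope P F Y u ω ≤
      max 0 (Y u ω + (P[snellEnvelope P F Y (u + 1) | F u]) ω) := by
  have h : ∀ k, P[snellIterate P F Y k (u + 1) | F u] ≤ᵐ[P]
      P[snellEnvelope P F Y (u + 1) | F u] := fun k =>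
    condExp_mono (integrable_snellIterate hY k _) (integrable_snellEnvelope hY hYm _)
      ((ae_tendsto_snellIterate hY hYm (u + 1)).mono fun ω h => h.1 k)
  filter_upwards [ae_all_iff.2 h] with ω h
  refine ciSup_le fun k => ?_
  cases k with
  | zero => exact le_max_left _ _
  | succ k => exact max_le_max_left _ (add_le_add le_rfl (h k))

/-- The sum of `Z u` over `s ≤ u < τ`. -/
noncomputable def blockSum (s : ℕ) (τ : Ω → WithTop ℕ) (Z : ℕ → Ω → ℝ) (ω : Ω) : ℝ :=
  ∑' u : ℕ, Set.indicator {u : ℕ | s ≤ u ∧ (u : WithTop ℕ) < τ ω} (fun u => Z u ω) u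

theorem indicator_block (s u : ℕ) (τ : Ω → WithTop ℕ) (Z : ℕ → Ω → ℝ) (ω : Ω) :
    Set.indicator {u : ℕ | s ≤ u ∧ (u : WithTop ℕ) < τ ω} (fun u => Z u ω) u =
      Set.indicator {ω | s ≤ u ∧ (u : WithTop ℕ) < τ ω} (Z u) ω := by
  simp only [Set.indicator_apply, Set.mem_ofPred_eq]

theorem measurableSet_block {τ : Ω → WithTop ℕ} (hτ : IsStoppingTime F τ) (s u : ℕ) :
    MeasurableSet[F u] {ω | s ≤ u ∧ (u : WithTop ℕ) < τ ω} := by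
  by_cases h : s ≤ u
  · simpa [h] using hτ.measurableSet_gt u
  · simp [h]

theorem AbsSummable.block (hY : AbsSummable P Y) {τ : Ω → WithTop ℕ} (hτ : IsStoppingTime F τ)
    (s : ℕ) : AbsSummable P fun u => Set.indicator {ω | s ≤ u ∧ (u : WithTop ℕ) < τ ω} (Y u) :=
  hY.indicator fun u => F.le u _ (measurableSet_block hτ s u)

theorem blockSum_eq (s : ℕ) (τ : Ω → WithTop ℕ) (Z : ℕ → Ω → ℝ) :
    blockSum s τ Z = fun ω => ∑' u, Set.indicator {ω | s ≤ u ∧ (u : WithTop ℕ) < τ ω} (Z u) ω :=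
  funext fun ω => tsum_congr fun u => indicator_block s u τ Z ω

theorem integrable_blockSum (hY : AbsSummable P Y) {τ : Ω → WithTop ℕ} (hτ : IsStoppingTime F τ)
    (s : ℕ) : Integrable (blockSum s τ Y) P := by
  rw [blockSum_eq]
  exact (hY.block hτ s).integrable_tsum

/-- The gain collected so far plus the envelope on the event that `τ` has not yet stopped is
decreasing in expectation, by the supermartingale property and the sign of the envelope. -/
theorem setIntegral_blockSum_le (hY : AbsSummable P Y) (hYm : ∀ u, StronglyMeasurable[F u] (Y u))
    {τ : Ω → WithTop ℕ} (hτ : IsStoppingTime F τ) {s : ℕ} (hs : ∀ ω, (s : WithTop ℕ) < τ ω)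
    {A : Set Ω} (hA : MeasurableSet[F s] A) :
    ∫ ω in A, blockSum s τ Y ω ∂P ≤ ∫ ω in A, (Y s ω + snellEnvelope P F Y (s + 1) ω) ∂P := by
  have hsum := (hY.block hτ s).hasSum_setIntegral A
  rw [← blockSum_eq] at hsum
  have key : ∀ k, ∑ u ∈ Finset.range (s + 1 + k),
      ∫ ω in A, Set.indicator {ω | s ≤ u ∧ (u : WithTop ℕ) < τ ω} (Y u) ω ∂P +
      ∫ ω in A ∩ {ω | ((s + k : ℕ) : WithTop ℕ) < τ ω}, snellEnvelope P F Y (s + 1 + k) ω ∂P ≤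
      ∫ ω in A, (Y s ω + snellEnvelope P F Y (s + 1) ω) ∂P := by
    intro k
    induction k with
    | zero =>
      rw [add_zero, Finset.sum_range_succ, Finset.sum_eq_zero, add_zero, zero_add,
        integral_add (hY.integrable s).integrableOn (integrable_snellEnvelope hY hYm _).integrableOn]
      · simp [hs]
      · intro u hu
        simp [Nat.not_le.2 (Finset.mem_range.1 hu)]
    | succ k ih =>
      refine le_trans ?_ ih
      have hm : MeasurableSet[F (s + 1 + k)] (A ∩ {ω | ((s + 1 + k : ℕ) : WithTop ℕ) < τ ω}) :=
        MeasurableSet.inter (F.mono (by omega) _ hA) (hτ.measurableSet_gt _)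
      have hm' := F.le _ _ hm
      have h1 := setIntegral_add_snellEnvelope_le hY hYm hm
      rw [integral_add (hY.integrable _).integrableOn
        (integrable_snellEnvelope hY hYm _).integrableOn] at h1
      have h2 : ∫ ω in A ∩ {ω | ((s + 1 + k : ℕ) : WithTop ℕ) < τ ω},
          snellEnvelope P F Y (s + 1 + k) ω ∂P ≤
          ∫ ω in A ∩ {ω | ((s + k : ℕ) : WithTop ℕ) < τ ω},
            snellEnvelope P F Y (s + 1 + k) ω ∂P := by
        refine setIntegral_mono_set (integrable_snellEnvelope hY hYm _).integrableOn
          (Eventually.of_forall fun ω => snellEnvelope_nonneg _ ω) (LE.le.eventuallyLE ?_)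
        refine Set.inter_subset_inter_right _ (fun ω hω => ?_)
        have h4 : ((s + 1 + k : ℕ) : WithTop ℕ) < τ ω := hω
        have h5 : ((s + k : ℕ) : WithTop ℕ) < ((s + 1 + k : ℕ) : WithTop ℕ) := by
          exact_mod_cast (by omega : s + k < s + 1 + k)
        exact h5.trans h4
      have h3 : ∫ ω in A, Set.indicator {ω | s ≤ s + 1 + k ∧ ((s + 1 + k : ℕ) : WithTop ℕ) < τ ω}
          (Y (s + 1 + k)) ω ∂P =
          ∫ ω in A ∩ {ω | ((s + 1 + k : ℕ) : WithTop ℕ) < τ ω}, Y (s + 1 + k) ω ∂P := by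
        rw [setIntegral_indicator (F.le _ _ (measurableSet_block hτ s _))]
        simp [show s ≤ s + 1 + k by omega]
      rw [show s + 1 + (k + 1) = s + 1 + k + 1 by ring, Finset.sum_range_succ, h3,
        show s + (k + 1) = s + 1 + k by ring]
      linarith
  refine le_of_tendsto' (hsum.tendsto_sum_nat.comp (tendsto_add_atTop_nat (s + 1))) fun k => ?_
  refine le_trans ?_ (key k)
  simp only [Function.comp_apply, add_comm k]
  exact le_add_of_nonneg_right (integral_nonneg (snellEnvelope_nonneg _))

/-- If the continuation value is never negative, the positive part in the recursion is superfluous.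
Iterating it bounds the nonnegative envelope by a partial sum plus a later envelope, whose
expectation tends to 0. -/
theorem setIntegral_tail_nonneg_of_snell (hY : AbsSummable P Y)
    (hYm : ∀ u, StronglyMeasurable[F u] (Y u))
    (hC : ∀ u, ∀ᵐ ω ∂P, 0 ≤ Y u ω + (P[snellEnvelope P F Y (u + 1) | F u]) ω) {s : ℕ} {A : Set Ω}
    (hA : MeasurableSet[F s] A) : 0 ≤ ∫ ω in A, ∑' v, Y (s + v) ω ∂P := by
  have step : ∀ u, MeasurableSet[F u] A → ∫ ω in A, snellEnvelope P F Y u ω ∂P ≤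
      ∫ ω in A, Y u ω ∂P + ∫ ω in A, snellEnvelope P F Y (u + 1) ω ∂P := by
    intro u hAu
    rw [← setIntegral_condExp (F.le u) (integrable_snellEnvelope hY hYm (u + 1)) hAu,
      ← integral_add (hY.integrable u).integrableOn integrable_condExp.integrableOn]
    refine integral_mono_ae (integrable_snellEnvelope hY hYm u).integrableOn
      ((hY.integrable u).add integrable_condExp).integrableOn (ae_restrict_of_ae ?_)
    filter_upwards [hC u, snellEnvelope_le_max hY hYm u] with ω h1 h2
    rwa [max_eq_right h1] at h2
  have key : ∀ n, 0 ≤ ∑ v ∈ Finset.range n, ∫ ω in A, Y (s + v) ω ∂P +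
      ∫ ω, snellEnvelope P F Y (s + n) ω ∂P := by
    intro n
    have h : ∫ ω in A, snellEnvelope P F Y s ω ∂P ≤ ∑ v ∈ Finset.range n, ∫ ω in A, Y (s + v) ω ∂P +
        ∫ ω in A, snellEnvelope P F Y (s + n) ω ∂P := by
      induction n with
      | zero => simp
      | succ n ih =>
        rw [Finset.sum_range_succ]
        have := step (s + n) (F.mono (by omega) _ hA)
        rw [← add_assoc s n 1]
        linarith
    have h1 : 0 ≤ ∫ ω in A, snellEnvelope P F Y s ω ∂P := integral_nonneg (snellEnvelope_nonneg s)
    have h2 : ∫ ω in A, snellEnvelope P F Y (s + n) ω ∂P ≤ ∫ ω, snellEnvelope P F Y (s + n) ω ∂P :=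
      setIntegral_le_integral (integrable_snellEnvelope hY hYm _)
        (Eventually.of_forall (snellEnvelope_nonneg _))
    linarith
  have hsum := (hY.comp_injective (add_right_injective s)).hasSum_setIntegral A
  have hV : Tendsto (fun n => ∫ ω, snellEnvelope P F Y (s + n) ω ∂P) atTop (nhds 0) := by
    have := (tendsto_integral_snellEnvelope hY hYm).comp (tendsto_add_atTop_nat s)
    refine this.congr fun n => ?_
    simp only [Function.comp_apply, add_comm n]
  have := ge_of_tendsto' (hsum.tendsto_sum_nat.add hV) key
  simpa using this

end Snell

/-! ### Criteria in terms of integrals. -/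

section SetIntegral

variable {Ω : Type*} {m mΩ : MeasurableSpace Ω} {P : Measure Ω} [IsProbabilityMeasure P]

theorem condExp_le_of_forall_setIntegral_le (hm : m ≤ mΩ) {f g : Ω → ℝ} (hf : Integrable f P)
    (hg : Integrable g P) (hgm : StronglyMeasurable[m] g)
    (h : ∀ A, MeasurableSet[m] A → ∫ ω in A, f ω ∂P ≤ ∫ ω in A, g ω ∂P) :
    P[f | m] ≤ᵐ[P] g := by
  have hc : StronglyMeasurable[m] (P[f | m]) := stronglyMeasurable_condExp
  refine ae_le_of_ae_le_trim (hm := hm) (ae_le_of_forall_setIntegral_le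
    (integrable_condExp.trim hm hc) (hg.trim hm hgm) fun A hA _ => ?_)
  rw [← setIntegral_trim hm hc hA, ← setIntegral_trim hm hgm hA, setIntegral_condExp hm hf hA]
  exact h A hA

theorem AbsSummable.of_summable_integral {ι : Type*} [Countable ι] {f b : ι → Ω → ℝ}
    (hf : ∀ i, AEStronglyMeasurable (f i) P) (hb : ∀ i, Integrable (b i) P)
    (hfb : ∀ i, ∀ᵐ ω ∂P, |f i ω| ≤ b i ω) (hs : Summable fun i => ∫ ω, b i ω ∂P) :
    AbsSummable P f := by
  have h0 : ∀ i, 0 ≤ᵐ[P] b i := fun i => (hfb i).mono fun ω h => (abs_nonneg _).trans h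
  refine ⟨hf, ne_top_of_le_ne_top
    (hs.tsum_ofReal_ne_top) (ENNReal.tsum_le_tsum fun i => ?_)⟩
  rw [ofReal_integral_eq_lintegral_ofReal (hb i) (h0 i)]
  refine lintegral_mono_ae ?_
  filter_upwards [hfb i] with ω h
  rw [← ofReal_norm]
  exact ENNReal.ofReal_le_ofReal h

theorem AbsSummable.summable_integral_abs {ι : Type*} [Countable ι] {f : ι → Ω → ℝ}
    (hf : AbsSummable P f) : Summable fun i => ∫ ω, |f i ω| ∂P :=
  hf.abs.hasSum_integral.summable

end SetIntegral

/-! ### Running minima and their records. -/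

section RunningMinimum

variable {Ω : Type*}

/-- The running minimum `min (g 0, …, g s)`. -/
noncomputable def runMin (g : ℕ → Ω → ℝ) (s : ℕ) (ω : Ω) : ℝ :=
  (Finset.range (s + 1)).inf' Finset.nonempty_range_add_one fun u => g u ω

theorem runMin_le {g : ℕ → Ω → ℝ} {u s : ℕ} (h : u ≤ s) (ω : Ω) : runMin g s ω ≤ g u ω :=
  Finset.inf'_le _ (Finset.mem_range.2 (Nat.lt_succ_of_le h))

theorem le_runMin {g : ℕ → Ω → ℝ} {s : ℕ} {ω : Ω} {a : ℝ} (h : ∀ u ≤ s, a ≤ g u ω) :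
    a ≤ runMin g s ω :=
  Finset.le_inf' _ _ fun u hu => h u (Nat.le_of_lt_succ (Finset.mem_range.1 hu))

theorem runMin_antitone (g : ℕ → Ω → ℝ) (ω : Ω) : Antitone fun s => runMin g s ω :=
  fun _ _ h => le_runMin fun _ hu => runMin_le (hu.trans h) ω

theorem exists_runMin_eq (g : ℕ → Ω → ℝ) (s : ℕ) (ω : Ω) : ∃ u ≤ s, runMin g s ω = g u ω := by
  obtain ⟨u, hu, h⟩ := Finset.exists_mem_eq_inf' (Finset.nonempty_range_add_one (n := s))
    fun u => g u ω
  exact ⟨u, Nat.le_of_lt_succ (Finset.mem_range.1 hu), h⟩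

theorem runMin_succ_of_ne {g : ℕ → Ω → ℝ} {s : ℕ} {ω : Ω}
    (h : g (s + 1) ω ≠ runMin g (s + 1) ω) : runMin g (s + 1) ω = runMin g s ω := by
  refine le_antisymm (runMin_antitone g ω (Nat.le_succ s)) ?_
  obtain ⟨u, hu, hu'⟩ := exists_runMin_eq g (s + 1) ω
  rcases hu.lt_or_eq with hlt | rfl
  · rw [hu']
    exact runMin_le (Nat.le_of_lt_succ hlt) ω
  · exact absurd hu'.symm h

theorem measurable_runMin {mΩ : MeasurableSpace Ω} {F : Filtration ℕ mΩ} {g : ℕ → Ω → ℝ}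
    (hg : ∀ s, Measurable[F s] (g s)) (s : ℕ) : Measurable[F s] (runMin g s) := by
  have h : runMin g s = (Finset.range (s + 1)).inf' Finset.nonempty_range_add_one g := by
    funext ω
    rw [Finset.inf'_apply]
    rfl
  rw [h]
  refine Finset.inf'_induction (p := fun f => Measurable[F s] f) _ _ (fun _ h _ h' => h.inf h')
    fun u hu => (hg u).mono (F.mono (Nat.le_of_lt_succ (Finset.mem_range.1 hu))) le_rfl

end RunningMinimum

section BlockSum

variable {Ω : Type*}

theorem blockSum_coe (s : ℕ) (t : Ω → ℕ) (Z : ℕ → Ω → ℝ) (ω : Ω) :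
    blockSum s (fun ω => (t ω : WithTop ℕ)) Z ω = ∑ u ∈ Finset.Ico s (t ω), Z u ω := by
  unfold blockSum
  rw [tsum_eq_sum (s := Finset.Ico s (t ω))]
  · refine Finset.sum_congr rfl fun u hu => ?_
    rw [Finset.mem_Ico] at hu
    exact Set.indicator_of_mem (show u ∈ {u : ℕ | s ≤ u ∧ (u : WithTop ℕ) < (t ω : WithTop ℕ)} from
      ⟨hu.1, WithTop.coe_lt_coe.2 hu.2⟩) _
  · intro u hu
    rw [Finset.mem_Ico] at hu
    exact Set.indicator_of_notMem (fun h : u ∈ {u : ℕ | s ≤ u ∧ (u : WithTop ℕ) < (t ω : WithTop ℕ)}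
      => hu ⟨h.1, WithTop.coe_lt_coe.1 h.2⟩) _

end BlockSum

/-! ### A single arm with geometric expected discounting. -/

section Arm

variable {Ω : Type*} {mΩ : MeasurableSpace Ω}

/-- A single arm: rewards `X`, discount factors `d`, and the expected one-step discount `β`. -/
structure DiscountedArm (P : Measure Ω) where
  F : Filtration ℕ mΩ
  X : ℕ → Ω → ℝ
  d : ℕ → Ω → ℝ
  β : ℝ
  measurable_X : ∀ s, Measurable[F s] (X s)
  measurable_d : ∀ s, Measurable[F s] (d s)
  d_pos : ∀ s ω, 0 < d s ω
  d_zero : ∀ ω, d 0 ω = 1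
  β_nonneg : 0 ≤ β
  β_lt_one : β < 1
  integrable_d_succ : ∀ s (Z : Ω → ℝ), Measurable[F s] Z → Integrable (fun ω => d s ω * Z ω) P →
    Integrable (fun ω => d (s + 1) ω * Z ω) P
  integral_d_succ : ∀ s (Z : Ω → ℝ), Measurable[F s] Z → Integrable (fun ω => d s ω * Z ω) P →
    ∫ ω, d (s + 1) ω * Z ω ∂P = β * ∫ ω, d s ω * Z ω ∂P
  absSummable_reward : AbsSummable P fun s ω => d s ω * X s ω

namespace DiscountedArm

variable {P : Measure Ω} [IsProbabilityMeasure P] (a : DiscountedArm P)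

/-- The discounted reward of the operation number `s`. -/
noncomputable def reward (s : ℕ) (ω : Ω) : ℝ := a.d s ω * a.X s ω

/-- The stopping times larger than `s`. -/
def stopsAfter (s : ℕ) : Set (Ω → WithTop ℕ) :=
  {τ | IsStoppingTime a.F τ ∧ ∀ ω, (s : WithTop ℕ) < τ ω}

/-- Conditional expected discounted time in `[s, τ)`. -/
noncomputable def expTime (s : ℕ) (τ : Ω → WithTop ℕ) : Ω → ℝ := P[blockSum s τ a.d | a.F s]

/-- Conditional expected discounted reward in `[s, τ)`. -/
noncomputable def expReward (s : ℕ) (τ : Ω → WithTop ℕ) : Ω → ℝ := P[blockSum s τ a.reward | a.F s]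

/-- Reward per unit of time in `[s, τ)`. -/
noncomputable def rate (s : ℕ) (τ : Ω → WithTop ℕ) (ω : Ω) : ℝ := a.expReward s τ ω / a.expTime s τ ω

/-- Conditional expected absolute discounted reward from the operation number `s` on. -/
noncomputable def absReward (s : ℕ) : Ω → ℝ := P[fun ω => ∑' v, |a.reward (s + v) ω| | a.F s]

theorem absSummable_reward' : AbsSummable P a.reward := a.absSummable_reward

theorem stronglyMeasurable_reward (s : ℕ) : StronglyMeasurable[a.F s] (a.reward s) :=
  ((a.measurable_d s).mul (a.measurable_X s)).stronglyMeasurable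

theorem integrable_d_add_mul {s : ℕ} {Z : Ω → ℝ} (hZ : Measurable[a.F s] Z)
    (hi : Integrable (fun ω => a.d s ω * Z ω) P) (v : ℕ) :
    Integrable (fun ω => a.d (s + v) ω * Z ω) P := by
  induction v with
  | zero => exact hi
  | succ v ih => exact a.integrable_d_succ _ _ (hZ.mono (a.F.mono (Nat.le_add_right _ _)) le_rfl) ih

theorem integral_d_add_mul {s : ℕ} {Z : Ω → ℝ} (hZ : Measurable[a.F s] Z)
    (hi : Integrable (fun ω => a.d s ω * Z ω) P) (v : ℕ) :
    ∫ ω, a.d (s + v) ω * Z ω ∂P = a.β ^ v * ∫ ω, a.d s ω * Z ω ∂P := by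
  induction v with
  | zero => simp
  | succ v ih =>
    rw [← add_assoc, a.integral_d_succ _ _ (hZ.mono (a.F.mono (Nat.le_add_right _ _)) le_rfl)
      (a.integrable_d_add_mul hZ hi v), ih]
    ring

theorem measurable_d' (s : ℕ) : Measurable (a.d s) := (a.measurable_d s).mono (a.F.le s) le_rfl

theorem absSummable_d_add_mul {s : ℕ} {Z : Ω → ℝ} (hZ : Measurable[a.F s] Z)
    (hi : Integrable (fun ω => a.d s ω * Z ω) P) :
    AbsSummable P fun v ω => a.d (s + v) ω * Z ω := by
  have hZa : Measurable[a.F s] fun ω => |Z ω| := continuous_abs.measurable.comp hZ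
  have hia : Integrable (fun ω => a.d s ω * |Z ω|) P :=
    hi.abs.congr (Eventually.of_forall fun ω => by
      simp only [abs_mul, abs_of_pos (a.d_pos s ω)])
  refine AbsSummable.of_summable_integral (fun v => (a.integrable_d_add_mul hZ hi v).1)
    (fun v => a.integrable_d_add_mul hZa hia v)
    (fun v => Eventually.of_forall fun ω => by rw [abs_mul, abs_of_pos (a.d_pos _ ω)]) ?_
  simp only [a.integral_d_add_mul hZa hia]
  exact (summable_geometric_of_lt_one a.β_nonneg a.β_lt_one).mul_right _

theorem absSummable_d : AbsSummable P a.d := by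
  have h := a.absSummable_d_add_mul (s := 0) (Z := fun _ => 1) measurable_const
    ((integrable_const (1 : ℝ)).congr (Eventually.of_forall fun ω => by simp [a.d_zero]))
  simpa using h

/-- Each operation multiplies the expected discount factor by `β`, so the total remaining time is a
geometric series. -/
theorem setIntegral_tsum_d {s : ℕ} {A : Set Ω} (hA : MeasurableSet[a.F s] A) :
    ∫ ω in A, ∑' v, a.d (s + v) ω ∂P = ∫ ω in A, (1 - a.β)⁻¹ * a.d s ω ∂P := by
  have hA' := a.F.le s _ hA
  have hs := (a.absSummable_d.comp_injective (add_right_injective s)).hasSum_setIntegral A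
  have e : ∀ v, ∫ ω in A, a.d (s + v) ω ∂P = a.β ^ v * ∫ ω in A, a.d s ω ∂P := by
    intro v
    have e' : ∀ v, ∫ ω in A, a.d (s + v) ω ∂P =
        ∫ ω, a.d (s + v) ω * A.indicator (fun _ => (1 : ℝ)) ω ∂P := fun v => by
      rw [← integral_indicator hA']
      exact integral_congr_ae (Eventually.of_forall fun ω => by
        by_cases h : ω ∈ A <;> simp [h])
    rw [e', a.integral_d_add_mul (measurable_const.indicator hA), ← add_zero s, ← e' 0]
    exact ((a.absSummable_d.integrable s).indicator hA').congr (Eventually.of_forall fun ω => by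
      by_cases h : ω ∈ A <;> simp [h])
  rw [integral_const_mul, ← hs.tsum_eq]
  simp only [e]
  rw [tsum_mul_right, tsum_geometric_of_lt_one a.β_nonneg a.β_lt_one]

variable {a} {s : ℕ} {τ : Ω → WithTop ℕ}

theorem blockSum_d_bounds (hτ : ∀ ω, (s : WithTop ℕ) < τ ω) : ∀ᵐ ω ∂P,
    a.d s ω ≤ blockSum s τ a.d ω ∧ blockSum s τ a.d ω ≤ ∑' v, a.d (s + v) ω := by
  filter_upwards [a.absSummable_d.ae_summable] with ω hω
  have h0 : ∀ u, 0 ≤ Set.indicator {u : ℕ | s ≤ u ∧ (u : WithTop ℕ) < τ ω} (fun u => a.d u ω) u :=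
    fun u => Set.indicator_nonneg (fun u _ => (a.d_pos u ω).le) u
  have hsum : Summable
      (Set.indicator {u : ℕ | s ≤ u ∧ (u : WithTop ℕ) < τ ω} (fun u => a.d u ω)) :=
    hω.indicator _
  constructor
  · have := hsum.le_tsum s fun u _ => h0 u
    rwa [Set.indicator_of_mem (show s ∈ {u : ℕ | s ≤ u ∧ (u : WithTop ℕ) < τ ω} from
      ⟨le_rfl, hτ ω⟩)] at this
  · have e : ∑' v, a.d (s + v) ω = ∑' u, Set.indicator (Set.range fun v => s + v)
        (fun u => a.d u ω) u := by
      rw [← (add_right_injective s).tsum_eq (f := Set.indicator (Set.range fun v => s + v)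
        (fun u => a.d u ω)) Set.support_indicator_subset]
      exact tsum_congr fun v => by simp
    rw [e]
    refine hsum.tsum_le_tsum (fun u => ?_) (hω.indicator _)
    refine Set.indicator_le_indicator_of_subset (fun u hu => ?_) (fun u => (a.d_pos u ω).le) u
    exact ⟨u - s, Nat.add_sub_cancel' hu.1⟩

end DiscountedArm

end Arm

/-! ### Rates of stopping rules and the index as their essential supremum. -/

namespace DiscountedArm

variable {Ω : Type*} {mΩ : MeasurableSpace Ω} {P : Measure Ω} [IsProbabilityMeasure P]
variable {a : DiscountedArm P} {s : ℕ} {τ : Ω → WithTop ℕ}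

theorem integrable_blockSum_d (hτ : τ ∈ a.stopsAfter s) : Integrable (blockSum s τ a.d) P :=
  integrable_blockSum a.absSummable_d hτ.1 s

theorem integrable_blockSum_reward (hτ : τ ∈ a.stopsAfter s) :
    Integrable (blockSum s τ a.reward) P :=
  integrable_blockSum a.absSummable_reward' hτ.1 s

theorem d_le_expTime (hτ : τ ∈ a.stopsAfter s) : a.d s ≤ᵐ[P] a.expTime s τ := by
  have h := condExp_mono (m := a.F s) (a.absSummable_d.integrable s) (integrable_blockSum_d hτ)
    ((blockSum_d_bounds hτ.2).mono fun ω h => h.1)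
  rwa [condExp_of_stronglyMeasurable (a.F.le s) (a.measurable_d s).stronglyMeasurable
    (a.absSummable_d.integrable s)] at h

/-- With `d_le_expTime`, this makes the denominator of a rate comparable to d_s uniformly in `τ`, so
that a gap in expected reward becomes a gap in rate. -/
theorem expTime_le (hτ : τ ∈ a.stopsAfter s) :
    ∀ᵐ ω ∂P, a.expTime s τ ω ≤ (1 - a.β)⁻¹ * a.d s ω := by
  refine condExp_le_of_forall_setIntegral_le (a.F.le s) (integrable_blockSum_d hτ)
    ((a.absSummable_d.integrable s).const_mul _)
    (measurable_const.mul (a.measurable_d s)).stronglyMeasurable fun A hA => ?_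
  rw [← a.setIntegral_tsum_d hA]
  exact integral_mono_ae (integrable_blockSum_d hτ).integrableOn
    (a.absSummable_d.comp_injective (add_right_injective s)).integrable_tsum.integrableOn
    (ae_restrict_of_ae ((blockSum_d_bounds hτ.2).mono fun ω h => h.2))

theorem abs_expReward_le (hτ : τ ∈ a.stopsAfter s) :
    ∀ᵐ ω ∂P, |a.expReward s τ ω| ≤ a.absReward s ω := by
  have h1 := abs_condExp_ae_le_condExp_abs (μ := P) (m := a.F s) (blockSum s τ a.reward)
  have hi : Integrable |blockSum s τ a.reward| P := (integrable_blockSum_reward hτ).abs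
  have h2 : condExp (a.F s) P |blockSum s τ a.reward| ≤ᵐ[P] a.absReward s := by
    refine condExp_mono hi
      (a.absSummable_reward'.abs.comp_injective (add_right_injective s)).integrable_tsum ?_
    filter_upwards [a.absSummable_reward'.ae_summable_abs] with ω hω
    have hs1 : Summable (Set.indicator {u : ℕ | s ≤ u ∧ (u : WithTop ℕ) < τ ω}
        (fun u => |a.reward u ω|)) := hω.indicator _
    have e : ∑' v, |a.reward (s + v) ω| = ∑' u, Set.indicator (Set.range fun v => s + v)
        (fun u => |a.reward u ω|) u := by
      rw [← (add_right_injective s).tsum_eq (f := Set.indicator (Set.range fun v => s + v)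
        (fun u => |a.reward u ω|)) Set.support_indicator_subset]
      exact tsum_congr fun v => by simp
    have e2 : ∀ u, |Set.indicator {u : ℕ | s ≤ u ∧ (u : WithTop ℕ) < τ ω}
        (fun u => a.reward u ω) u| = Set.indicator {u : ℕ | s ≤ u ∧ (u : WithTop ℕ) < τ ω}
        (fun u => |a.reward u ω|) u := fun u => by
      by_cases h : u ∈ {u : ℕ | s ≤ u ∧ (u : WithTop ℕ) < τ ω}
      · rw [Set.indicator_of_mem h, Set.indicator_of_mem h]
      · rw [Set.indicator_of_notMem h, Set.indicator_of_notMem h, abs_zero]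
    rw [e, Pi.abs_apply]
    have hs2 : Summable fun u => ‖Set.indicator {u : ℕ | s ≤ u ∧ (u : WithTop ℕ) < τ ω}
        (fun u => a.reward u ω) u‖ := by simpa only [Real.norm_eq_abs, e2] using hs1
    refine (norm_tsum_le_tsum_norm hs2).trans ?_
    simp only [Real.norm_eq_abs, e2]
    refine hs1.tsum_le_tsum (fun u => ?_) (hω.indicator _)
    refine Set.indicator_le_indicator_of_subset (fun u hu => ?_) (fun u => abs_nonneg _) u
    exact ⟨u - s, Nat.add_sub_cancel' hu.1⟩
  filter_upwards [h1, h2] with ω h1 h2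
  exact h1.trans h2

theorem measurable_rate (s : ℕ) (τ : Ω → WithTop ℕ) : Measurable[a.F s] (a.rate s τ) :=
  (stronglyMeasurable_condExp (m := a.F s)).measurable.div
    (stronglyMeasurable_condExp (m := a.F s)).measurable

theorem measurable_absReward (s : ℕ) : Measurable[a.F s] (a.absReward s) :=
  (stronglyMeasurable_condExp (m := a.F s)).measurable

theorem rate_le (hτ : τ ∈ a.stopsAfter s) :
    a.rate s τ ≤ᵐ[P] fun ω => a.absReward s ω / a.d s ω := by
  filter_upwards [abs_expReward_le hτ, d_le_expTime hτ] with ω h1 h2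
  have h3 := a.d_pos s ω
  unfold rate
  rw [div_le_div_iff₀ (h3.trans_le h2) h3]
  calc a.expReward s τ ω * a.d s ω ≤ a.absReward s ω * a.d s ω := by
        gcongr
        exact (le_abs_self _).trans h1
    _ ≤ a.absReward s ω * a.expTime s τ ω := by
        gcongr
        exact (abs_nonneg _).trans h1

theorem natCast_succ_mem_stopsAfter (s : ℕ) :
    (fun _ => ((s + 1 : ℕ) : WithTop ℕ)) ∈ a.stopsAfter s :=
  ⟨isStoppingTime_const a.F (s + 1), fun _ => WithTop.coe_lt_coe.2 (Nat.lt_succ_self s)⟩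

/-- Stopping after one operation earns exactly X_s; this bounds the index from below. -/
theorem rate_succ (a : DiscountedArm P) (s : ℕ) :
    a.rate s (fun _ => ((s + 1 : ℕ) : WithTop ℕ)) = a.X s := by
  have e : ∀ Z : ℕ → Ω → ℝ, blockSum s (fun _ => ((s + 1 : ℕ) : WithTop ℕ)) Z = Z s := fun Z => by
    funext ω
    rw [blockSum_coe s (fun _ => s + 1)]
    simp
  funext ω
  unfold rate expReward expTime
  rw [e, e, condExp_of_stronglyMeasurable (a.F.le s) (a.stronglyMeasurable_reward s)
    (a.absSummable_reward'.integrable s), condExp_of_stronglyMeasurable (a.F.le s)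
    (a.measurable_d s).stronglyMeasurable (a.absSummable_d.integrable s)]
  exact mul_div_cancel_left₀ _ (a.d_pos s ω).ne'

/-- `γ` is an adapted version of the index process of the arm. -/
def IsIndex (a : DiscountedArm P) (γ : ℕ → Ω → ℝ) : Prop :=
  ∀ s, Measurable[a.F s] (γ s) ∧ IsEssSup P (a.rate s '' a.stopsAfter s) (γ s)

theorem exists_isEssSup_rate (a : DiscountedArm P) (s : ℕ) :
    ∃ g, IsEssSup P (a.rate s '' a.stopsAfter s) g := by
  refine exists_isEssSup ⟨_, ⟨_, natCast_succ_mem_stopsAfter s, rfl⟩⟩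
    (b := fun ω => a.absReward s ω / a.d s ω)
    (((measurable_absReward s).div (a.measurable_d s)).mono (a.F.le s) le_rfl).aemeasurable ?_ ?_
  · rintro _ ⟨τ, -, rfl⟩
    exact ((measurable_rate s τ).mono (a.F.le s) le_rfl).aemeasurable
  · rintro _ ⟨τ, hτ, rfl⟩
    exact rate_le hτ

theorem exists_measurable_version {g : Ω → ℝ}
    (hg : IsEssSup P (a.rate s '' a.stopsAfter s) g) :
    ∃ g', Measurable[a.F s] g' ∧ g =ᵐ[P] g' := by
  refine hg.exists_measurable (a.F.le s) (b := fun ω => a.absReward s ω / a.d s ω)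
    ((measurable_absReward s).div (a.measurable_d s)) ?_ ?_
  · rintro _ ⟨τ, -, rfl⟩
    exact measurable_rate s τ
  · rintro _ ⟨τ, hτ, rfl⟩
    exact rate_le hτ

variable {γ : ℕ → Ω → ℝ}

namespace IsIndex

theorem reward_le (hγ : a.IsIndex γ) (s : ℕ) : a.X s ≤ᵐ[P] γ s := by
  rw [← a.rate_succ s]
  exact (hγ s).2.2.1 _ ⟨_, natCast_succ_mem_stopsAfter s, rfl⟩

theorem le_absReward_div (hγ : a.IsIndex γ) (s : ℕ) :
    γ s ≤ᵐ[P] fun ω => a.absReward s ω / a.d s ω := by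
  refine (hγ s).2.2.2 _
    (((measurable_absReward s).div (a.measurable_d s)).mono (a.F.le s) le_rfl).aemeasurable ?_
  rintro _ ⟨τ, hτ, rfl⟩
  exact rate_le hτ

theorem abs_mul_le (hγ : a.IsIndex γ) (s : ℕ) :
    ∀ᵐ ω ∂P, |a.d s ω * γ s ω| ≤ a.absReward s ω := by
  filter_upwards [hγ.reward_le s, hγ.le_absReward_div s,
    abs_expReward_le (natCast_succ_mem_stopsAfter s),
    d_le_expTime (natCast_succ_mem_stopsAfter (a := a) s)] with ω h1 h2 h3 h4
  have h5 := a.d_pos s ω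
  have h6 : a.rate s (fun _ => ((s + 1 : ℕ) : WithTop ℕ)) ω = a.X s ω := congrFun (a.rate_succ s) ω
  unfold rate at h6
  rw [div_eq_iff (h5.trans_le h4).ne'] at h6
  rw [le_div_iff₀ h5] at h2
  rw [abs_le]
  constructor
  · rcases le_total 0 (γ s ω) with h | h
    · exact (neg_nonpos.2 ((abs_nonneg _).trans h3)).trans (mul_nonneg h5.le h)
    · have h7 := (abs_le.1 h3).1
      rw [h6] at h7
      have h8 : a.X s ω ≤ 0 := h1.trans h
      nlinarith [mul_le_mul_of_nonpos_left h4 h8, mul_le_mul_of_nonneg_right h1 h5.le]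
  · linarith

theorem integrable_mul (hγ : a.IsIndex γ) (s : ℕ) : Integrable (fun ω => a.d s ω * γ s ω) P :=
  (integrable_condExp (m := a.F s)).mono'
    (((a.measurable_d s).mul (hγ s).1).mono (a.F.le s) le_rfl).aestronglyMeasurable
    (hγ.abs_mul_le s)

theorem expReward_le (hγ : a.IsIndex γ) (hτ : τ ∈ a.stopsAfter s) :
    ∀ᵐ ω ∂P, a.expReward s τ ω ≤ γ s ω * a.expTime s τ ω := by
  filter_upwards [(hγ s).2.2.1 _ ⟨τ, hτ, rfl⟩, d_le_expTime hτ] with ω h1 h2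
  exact (div_le_iff₀ ((a.d_pos s ω).trans_le h2)).1 h1

theorem _root_.DiscountedArm.integrable_mul_blockSum_d {Z : Ω → ℝ} (hZ : Measurable[a.F s] Z)
    (hi : Integrable (fun ω => a.d s ω * Z ω) P) (hτ : τ ∈ a.stopsAfter s) :
    Integrable (fun ω => Z ω * blockSum s τ a.d ω) P := by
  have h := (a.absSummable_d_add_mul hZ hi).abs.integrable_tsum
  refine h.mono' ((hZ.mono (a.F.le s) le_rfl).aestronglyMeasurable.mul
    (integrable_blockSum_d hτ).1) ?_
  filter_upwards [blockSum_d_bounds (a := a) hτ.2, a.absSummable_d.ae_summable] with ω h1 h2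
  have h3 : ∑' v, |a.d (s + v) ω * Z ω| = (∑' v, a.d (s + v) ω) * |Z ω| := by
    rw [← tsum_mul_right]
    exact tsum_congr fun v => by rw [abs_mul, abs_of_pos (a.d_pos _ _)]
  rw [h3, norm_mul, Real.norm_eq_abs, Real.norm_of_nonneg ((a.d_pos s ω).le.trans h1.1), mul_comm]
  exact mul_le_mul_of_nonneg_right h1.2 (abs_nonneg _)

theorem _root_.DiscountedArm.condExp_mul_blockSum_d {Z : Ω → ℝ} (hZ : Measurable[a.F s] Z)
    (hi : Integrable (fun ω => a.d s ω * Z ω) P) (hτ : τ ∈ a.stopsAfter s) :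
    P[fun ω => Z ω * blockSum s τ a.d ω | a.F s] =ᵐ[P] fun ω => Z ω * a.expTime s τ ω :=
  condExp_mul_of_stronglyMeasurable_left hZ.stronglyMeasurable (integrable_mul_blockSum_d hZ hi hτ)
    (integrable_blockSum_d hτ)

theorem setIntegral_blockSum_le (hγ : a.IsIndex γ) (hτ : τ ∈ a.stopsAfter s) {A : Set Ω}
    (hA : MeasurableSet[a.F s] A) :
    ∫ ω in A, (blockSum s τ a.reward ω - γ s ω * blockSum s τ a.d ω) ∂P ≤ 0 := by
  have hi := integrable_mul_blockSum_d (hγ s).1 (hγ.integrable_mul s) hτ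
  rw [integral_sub (integrable_blockSum_reward hτ).integrableOn hi.integrableOn,
    ← setIntegral_condExp (a.F.le s) (integrable_blockSum_reward hτ) hA,
    ← setIntegral_condExp (a.F.le s) hi hA, sub_nonpos]
  refine integral_mono_ae integrable_condExp.integrableOn integrable_condExp.integrableOn
    (ae_restrict_of_ae ?_)
  filter_upwards [hγ.expReward_le hτ, condExp_mul_blockSum_d (hγ s).1 (hγ.integrable_mul s) hτ]
    with ω h1 h2
  rw [h2]
  exact h1

/-- If C were negative, every rule would earn strictly less than the rate γ_s, by a margin that
`expTime_le` makes uniform in `τ`. The index could then be lowered, against its minimality. -/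
theorem nonneg_of_forall_expReward_le (hγ : a.IsIndex γ) {M C : Ω → ℝ} (hM : M ≤ᵐ[P] γ s)
    (hCm : Measurable[a.F s] C)
    (hC : ∀ τ ∈ a.stopsAfter s, ∀ᵐ ω ∂P, a.expReward s τ ω - M ω * a.expTime s τ ω ≤ C ω) :
    0 ≤ᵐ[P] C := by
  have hβ : 0 < 1 - a.β := sub_pos.2 a.β_lt_one
  -- The lowered candidate: a deficit C spread over an expected time of at most d_s / (1 - β) costs
  -- at least this much in rate.
  have h := (hγ s).2.2.2 (fun ω => γ s ω + min (C ω) 0 * ((1 - a.β) / a.d s ω))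
    ((((hγ s).1.add ((hCm.min measurable_const).mul
      (measurable_const.div (a.measurable_d s))))).mono (a.F.le s) le_rfl).aemeasurable ?_
  · filter_upwards [h] with ω h
    have h1 : 0 < (1 - a.β) / a.d s ω := div_pos hβ (a.d_pos s ω)
    have h2 : 0 ≤ min (C ω) 0 := by
      by_contra hn
      exact absurd (mul_neg_of_neg_of_pos (not_le.1 hn) h1) (by linarith)
    exact h2.trans (min_le_left _ _)
  · rintro _ ⟨τ, hτ, rfl⟩
    filter_upwards [(hγ s).2.2.1 _ ⟨τ, hτ, rfl⟩, d_le_expTime hτ, expTime_le hτ, hC τ hτ, hM]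
      with ω h1 h2 h3 h4 h5
    have hD := (a.d_pos s ω).trans_le h2
    rcases le_total 0 (C ω) with h6 | h6
    · rw [min_eq_right h6, zero_mul, add_zero]
      exact h1
    · rw [min_eq_left h6]
      have h7 : a.rate s τ ω ≤ M ω + C ω / a.expTime s τ ω := by
        unfold rate
        rw [div_le_iff₀ hD, add_mul, div_mul_cancel₀ _ hD.ne']
        linarith
      have h8 : C ω / a.expTime s τ ω ≤ C ω * ((1 - a.β) / a.d s ω) := by
        rw [div_eq_mul_inv]
        refine mul_le_mul_of_nonpos_left ?_ h6
        rw [← inv_div]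
        refine inv_anti₀ hD ?_
        rwa [div_eq_inv_mul]
      linarith

end IsIndex

end DiscountedArm

/-! ### Excess over the running minimum of the index, and its potential. -/

namespace DiscountedArm

variable {Ω : Type*} {mΩ : MeasurableSpace Ω} {P : Measure Ω} [IsProbabilityMeasure P]
variable {a : DiscountedArm P} {γ : ℕ → Ω → ℝ}

/-- The discounted excess of the reward over the running minimum of the index. -/
noncomputable def excess (a : DiscountedArm P) (γ : ℕ → Ω → ℝ) (s : ℕ) (ω : Ω) : ℝ :=
  a.reward s ω - a.d s ω * runMin γ s ω

/-- The conditional expected total excess from the operation number `u` on. -/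
noncomputable def potential (a : DiscountedArm P) (γ : ℕ → Ω → ℝ) (u : ℕ) : Ω → ℝ :=
  P[fun ω => ∑' v, a.excess γ (u + v) ω | a.F u]

namespace IsIndex

/-- The upper bound comes from the initial index, the lower one from γ_u ≥ X_u. -/
theorem abs_runMin_le (hγ : a.IsIndex γ) (s : ℕ) :
    ∀ᵐ ω ∂P, |runMin γ s ω| ≤ a.absReward 0 ω + ∑ u ∈ Finset.range (s + 1), |a.X u ω| := by
  filter_upwards [hγ.abs_mul_le 0, ae_all_iff.2 hγ.reward_le] with ω h1 h2
  rw [a.d_zero, one_mul] at h1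
  have h3 : 0 ≤ a.absReward 0 ω := (abs_nonneg _).trans h1
  have h4 : 0 ≤ ∑ u ∈ Finset.range (s + 1), |a.X u ω| := Finset.sum_nonneg fun u _ => abs_nonneg _
  rw [abs_le]
  constructor
  · refine le_runMin fun u hu => ?_
    have h5 : |a.X u ω| ≤ ∑ u ∈ Finset.range (s + 1), |a.X u ω| :=
      Finset.single_le_sum (f := fun u => |a.X u ω|) (fun u _ => abs_nonneg _)
        (Finset.mem_range.2 (Nat.lt_succ_of_le hu))
    linarith [h2 u, neg_abs_le (a.X u ω)]
  · linarith [runMin_le (g := γ) (Nat.zero_le s) ω, le_abs_self (γ 0 ω)]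

/-- By the geometric discounting, E[d_s |X_u|] = β^{s-u} E[d_u |X_u|] for u ≤ s. The dominating
series is therefore a geometric series plus a convolution of two summable sequences. -/
theorem absSummable_runMin (hγ : a.IsIndex γ) :
    AbsSummable P fun s ω => a.d s ω * runMin γ s ω := by
  have hm : ∀ s, Measurable (runMin γ s) := fun s =>
    (measurable_runMin (fun s => (hγ s).1) s).mono (a.F.le s) le_rfl
  have hXm : ∀ u, Measurable[a.F u] fun ω => |a.X u ω| := fun u =>
    continuous_abs.measurable.comp (a.measurable_X u)
  have hX : ∀ u, Integrable (fun ω => a.d u ω * |a.X u ω|) P := fun u =>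
    (a.absSummable_reward.integrable u).abs.congr (Eventually.of_forall fun ω => by
      simp only [abs_mul, abs_of_pos (a.d_pos u ω)])
  have hB : Integrable (fun ω => a.d 0 ω * a.absReward 0 ω) P := by
    simp only [a.d_zero, one_mul]
    exact integrable_condExp
  have i1 : ∀ s, Integrable (fun ω => a.d s ω * a.absReward 0 ω) P := fun s => by
    simpa using a.integrable_d_add_mul (measurable_absReward 0) hB s
  have i2 : ∀ s, ∀ u ∈ Finset.range (s + 1), Integrable (fun ω => a.d s ω * |a.X u ω|) P := by
    intro s u hu
    have := a.integrable_d_add_mul (hXm u) (hX u) (s - u)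
    rwa [Nat.add_sub_cancel' (Nat.le_of_lt_succ (Finset.mem_range.1 hu))] at this
  refine AbsSummable.of_summable_integral
    (b := fun s ω => a.d s ω * a.absReward 0 ω + ∑ u ∈ Finset.range (s + 1), a.d s ω * |a.X u ω|)
    (fun s => ((a.measurable_d' s).mul (hm s)).aestronglyMeasurable)
    (fun s => (i1 s).add (integrable_finsetSum _ (i2 s))) (fun s => ?_) ?_
  · filter_upwards [hγ.abs_runMin_le s] with ω h
    rw [abs_mul, abs_of_pos (a.d_pos s ω), ← Finset.mul_sum, ← mul_add]
    exact mul_le_mul_of_nonneg_left h (a.d_pos s ω).le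
  · have e : ∀ s, ∫ ω, (a.d s ω * a.absReward 0 ω +
        ∑ u ∈ Finset.range (s + 1), a.d s ω * |a.X u ω|) ∂P =
        a.β ^ s * ∫ ω, a.d 0 ω * a.absReward 0 ω ∂P +
        ∑ u ∈ Finset.range (s + 1), (∫ ω, a.d u ω * |a.X u ω| ∂P) * a.β ^ (s - u) := by
      intro s
      rw [integral_add (i1 s) (integrable_finsetSum _ (i2 s)), integral_finsetSum _ (i2 s)]
      congr 1
      · simpa using a.integral_d_add_mul (measurable_absReward 0) hB s
      · refine Finset.sum_congr rfl fun u hu => ?_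
        have := a.integral_d_add_mul (hXm u) (hX u) (s - u)
        rwa [Nat.add_sub_cancel' (Nat.le_of_lt_succ (Finset.mem_range.1 hu)), mul_comm] at this
    simp only [e]
    have hg := summable_geometric_of_lt_one a.β_nonneg a.β_lt_one
    refine (hg.mul_right _).add (summable_sum_mul_range_of_summable_norm'
      (f := fun u => ∫ ω, a.d u ω * |a.X u ω| ∂P) (g := fun v => a.β ^ v) ?_ ?_ ?_ ?_)
    · refine Summable.norm ?_
      refine a.absSummable_reward.summable_integral_abs.congr fun u => ?_
      exact integral_congr_ae (Eventually.of_forall fun ω => by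
        simp only [abs_mul, abs_of_pos (a.d_pos u ω)])
    · refine a.absSummable_reward.summable_integral_abs.congr fun u => ?_
      exact integral_congr_ae (Eventually.of_forall fun ω => by
        simp only [abs_mul, abs_of_pos (a.d_pos u ω)])
    · exact hg.norm
    · exact hg

theorem absSummable_excess (hγ : a.IsIndex γ) : AbsSummable P (a.excess γ) :=
  a.absSummable_reward'.sub hγ.absSummable_runMin

theorem stronglyMeasurable_excess (hγ : a.IsIndex γ) (s : ℕ) :
    StronglyMeasurable[a.F s] (a.excess γ s) :=
  ((a.stronglyMeasurable_reward s).measurable.sub ((a.measurable_d s).mul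
    (measurable_runMin (fun s => (hγ s).1) s))).stronglyMeasurable

theorem measurableSet_record (hγ : a.IsIndex γ) (s : ℕ) :
    MeasurableSet[a.F s] {ω | γ s ω = runMin γ s ω} :=
  measurableSet_eq_fun (hγ s).1 (measurable_runMin (fun s => (hγ s).1) s)

/-- The horizon `N` is cut into blocks at the records. On a block the running minimum stays at the
index of its first operation, so the index inequality for the stopping time that ends the block
bounds the expected excess of the block by 0. Induction handles what remains. -/
theorem setIntegral_sum_Ico_excess_nonpos (hγ : a.IsIndex γ) (N u : ℕ) {A : Set Ω}
    (hA : MeasurableSet[a.F u] A) (hrec : ∀ ω ∈ A, γ u ω = runMin γ u ω) :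
    ∫ ω in A, ∑ v ∈ Finset.Ico u N, a.excess γ v ω ∂P ≤ 0 := by
  induction hk : N - u using Nat.strong_induction_on generalizing u A with
  | _ k ih =>
    subst hk
    rcases Nat.lt_or_ge u N with huN | huN
    swap
    · simp [Finset.Ico_eq_empty_of_le huN]
    -- the first record after `u`, cut off at `N`
    have hex : ∀ ω, ∃ w, u < w ∧ (N ≤ w ∨ γ w ω = runMin γ w ω) := fun ω =>
      ⟨N, huN, Or.inl le_rfl⟩
    classical
    set t : Ω → ℕ := fun ω => Nat.find (hex ω) with ht
    have htu : ∀ ω, u < t ω := fun ω => (Nat.find_spec (hex ω)).1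
    have htN : ∀ ω, t ω ≤ N := fun ω => Nat.find_min' (hex ω) ⟨huN, Or.inl le_rfl⟩
    have hnot : ∀ ω w, u < w → w < t ω → γ w ω ≠ runMin γ w ω := fun ω w h1 h2 h3 =>
      Nat.find_min (hex ω) h2 ⟨h1, Or.inr h3⟩
    have hle : ∀ n, MeasurableSet[a.F n] {ω | t ω ≤ n} := by
      intro n
      have e : {ω | t ω ≤ n} = ⋃ w ∈ Finset.range (n + 1),
          {ω | u < w ∧ (N ≤ w ∨ γ w ω = runMin γ w ω)} := by
        ext ω
        simp only [Set.mem_ofPred_eq, ht, Nat.find_le_iff, Set.mem_iUnion, Finset.mem_range,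
          Nat.lt_succ_iff, exists_prop]
      rw [e]
      refine Finset.measurableSet_biUnion _ fun w hw => ?_
      refine (MeasurableSet.const _).inter ((MeasurableSet.const _).union ?_)
      exact a.F.mono (Nat.le_of_lt_succ (Finset.mem_range.1 hw)) _ (hγ.measurableSet_record w)
    have hτ : (fun ω => (t ω : WithTop ℕ)) ∈ a.stopsAfter u := by
      refine ⟨fun n => ?_, fun ω => WithTop.coe_lt_coe.2 (htu ω)⟩
      have e : {ω | ((t ω : ℕ) : WithTop ℕ) ≤ (n : WithTop ℕ)} = {ω | t ω ≤ n} :=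
        Set.ext fun ω => WithTop.coe_le_coe
      exact (congrArg (MeasurableSet[a.F n]) e).mpr (hle n)
    have hteq : ∀ w, MeasurableSet[a.F w] {ω | t ω = w} := by
      intro w
      have e : {ω | t ω = w} = {ω | t ω ≤ w} \ ⋃ n ∈ Finset.range w, {ω | t ω ≤ n} := by
        ext ω
        simp only [Set.mem_ofPred_eq, Set.mem_sdiff, Set.mem_iUnion, Finset.mem_range, exists_prop,
          not_exists, not_and, not_le]
        constructor
        · rintro rfl
          exact ⟨le_rfl, fun n hn => hn⟩
        · rintro ⟨h1, h2⟩
          by_contra h3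
          exact lt_irrefl _ (h2 (t ω) (lt_of_le_of_ne h1 h3))
      rw [e]
      refine (hle w).diff (Finset.measurableSet_biUnion _ fun n hn => ?_)
      exact a.F.mono (Finset.mem_range.1 hn).le _ (hle n)
    have hmin : ∀ ω ∈ A, ∀ v, u ≤ v → v < t ω → runMin γ v ω = γ u ω := by
      intro ω hω v huv
      induction v, huv using Nat.le_induction with
      | base => exact fun _ => (hrec ω hω).symm
      | succ v huv ihv =>
        intro hv
        rw [runMin_succ_of_ne (hnot ω (v + 1) (by omega) hv)]
        exact ihv (by omega)
    have hA' := a.F.le u _ hA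
    set S : ℕ → Ω → ℝ := fun w ω => ∑ v ∈ Finset.Ico w N, a.excess γ v ω with hS
    have hSi : ∀ w, Integrable (S w) P := fun w =>
      integrable_finsetSum _ fun v _ => hγ.absSummable_excess.integrable v
    set Q : Ω → ℝ := fun ω => blockSum u (fun ω => (t ω : WithTop ℕ)) a.reward ω -
      γ u ω * blockSum u (fun ω => (t ω : WithTop ℕ)) a.d ω with hQ
    have hQi : Integrable Q P := (integrable_blockSum_reward hτ).sub
      (integrable_mul_blockSum_d (hγ u).1 (hγ.integrable_mul u) hτ)
    -- The first block `Q` is followed by the remainder, sorted by its starting point. The value t =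
    -- N is omitted because nothing then remains, whether or not `N` is a record.
    have split : ∀ ω ∈ A, S u ω = Q ω +
        ∑ w ∈ Finset.Ioo u N, Set.indicator {ω | t ω = w} (S w) ω := by
      intro ω hω
      have e1 : Q ω = ∑ v ∈ Finset.Ico u (t ω), a.excess γ v ω := by
        simp only [hQ]
        rw [blockSum_coe, blockSum_coe, Finset.mul_sum, ← Finset.sum_sub_distrib]
        refine Finset.sum_congr rfl fun v hv => ?_
        rw [Finset.mem_Ico] at hv
        unfold excess
        rw [hmin ω hω v hv.1 hv.2, mul_comm (γ u ω)]
      have e2 : ∑ w ∈ Finset.Ioo u N, Set.indicator {ω | t ω = w} (S w) ω =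
          ∑ v ∈ Finset.Ico (t ω) N, a.excess γ v ω := by
        rcases (htN ω).lt_or_eq with h | h
        · rw [Finset.sum_eq_single (t ω)]
          · exact Set.indicator_of_mem (show ω ∈ {ω' | t ω' = t ω} from rfl) _
          · intro w _ hw
            exact Set.indicator_of_notMem (show ω ∉ {ω' | t ω' = w} from fun h' => hw h'.symm) _
          · intro h'
            exact absurd (Finset.mem_Ioo.2 ⟨htu ω, h⟩) h'
        · rw [h, Finset.Ico_self, Finset.sum_empty]
          refine Finset.sum_eq_zero fun w hw => Set.indicator_of_notMem (s := {ω | t ω = w}) ?_ _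
          rintro rfl
          exact absurd (Finset.mem_Ioo.1 hw).2 h.not_lt
      rw [e1, e2, Finset.sum_Ico_consecutive _ (htu ω).le (htN ω)]
    have hmeas : ∀ w, MeasurableSet {ω | t ω = w} := fun w => a.F.le w _ (hteq w)
    change ∫ ω in A, S u ω ∂P ≤ 0
    rw [setIntegral_congr_fun hA' split, integral_add hQi.integrableOn
      (integrable_finsetSum _ fun w _ => ((hSi w).indicator (hmeas w)).integrableOn),
      integral_finsetSum _ fun w _ => ((hSi w).indicator (hmeas w)).integrableOn]
    refine add_nonpos (hγ.setIntegral_blockSum_le hτ hA) (Finset.sum_nonpos fun w hw => ?_)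
    rw [Finset.mem_Ioo] at hw
    rw [setIntegral_indicator (hmeas w)]
    refine ih (N - w) (by omega) w ((a.F.mono hw.1.le _ hA).inter (hteq w)) ?_ rfl
    rintro ω ⟨-, hω⟩
    have hω' : t ω = w := hω
    rcases (Nat.find_spec (hex ω)).2 with h | h
    · exact absurd (show N ≤ t ω from h) (by omega)
    · change γ (t ω) ω = runMin γ (t ω) ω at h
      rwa [hω'] at h

theorem integrable_tail (hγ : a.IsIndex γ) (u : ℕ) :
    Integrable (fun ω => ∑' v, a.excess γ (u + v) ω) P :=
  (hγ.absSummable_excess.comp_injective (add_right_injective u)).integrable_tsum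

theorem setIntegral_tail_nonpos (hγ : a.IsIndex γ) (u : ℕ) {A : Set Ω}
    (hA : MeasurableSet[a.F u] A) (hrec : ∀ ω ∈ A, γ u ω = runMin γ u ω) :
    ∫ ω in A, ∑' v, a.excess γ (u + v) ω ∂P ≤ 0 := by
  have hs := (hγ.absSummable_excess.comp_injective (add_right_injective u)).hasSum_setIntegral A
  refine le_of_tendsto' hs.tendsto_sum_nat fun n => ?_
  have h := hγ.setIntegral_sum_Ico_excess_nonpos (u + n) u hA hrec
  rw [integral_finsetSum _ fun v _ => (hγ.absSummable_excess.integrable v).integrableOn,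
    Finset.sum_Ico_eq_sum_range, Nat.add_sub_cancel_left] at h
  exact h

/-- From u on, the excess is at least the reward minus the fixed charge runMin γ u, because the
running minimum only falls. Hence the best excess bounds what any rule earns against a charge not
above γ_u, and `nonneg_of_forall_expReward_le` applies. -/
theorem nonneg_continuation (hγ : a.IsIndex γ) (u : ℕ) : ∀ᵐ ω ∂P,
    0 ≤ a.excess γ u ω + (P[snellEnvelope P a.F (a.excess γ) (u + 1) | a.F u]) ω := by
  have hY := hγ.absSummable_excess
  have hYm := hγ.stronglyMeasurable_excess
  have hmm := measurable_runMin (fun s => (hγ s).1)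
  set C : Ω → ℝ :=
    fun ω => a.excess γ u ω + (P[snellEnvelope P a.F (a.excess γ) (u + 1) | a.F u]) ω with hC
  have hCm : Measurable[a.F u] C :=
    (hYm u).measurable.add (stronglyMeasurable_condExp (m := a.F u)).measurable
  have hCi : Integrable C P := (hY.integrable u).add integrable_condExp
  have hMi := hγ.absSummable_runMin.integrable u
  refine hγ.nonneg_of_forall_expReward_le (M := runMin γ u)
    (Eventually.of_forall fun ω => runMin_le le_rfl ω) hCm fun τ hτ => ?_
  have hBi := integrable_mul_blockSum_d (hmm u) hMi hτ
  have h1 : P[blockSum u τ (a.excess γ) | a.F u] ≤ᵐ[P] C := by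
    refine condExp_le_of_forall_setIntegral_le (a.F.le u) (integrable_blockSum hY hτ.1 u) hCi
      hCm.stronglyMeasurable fun A hA => ?_
    refine (_root_.setIntegral_blockSum_le hY hYm hτ.1 hτ.2 hA).trans_eq ?_
    rw [integral_add (hY.integrable u).integrableOn
      (integrable_snellEnvelope hY hYm _).integrableOn,
      ← setIntegral_condExp (a.F.le u) (integrable_snellEnvelope hY hYm _) hA,
      ← integral_add (hY.integrable u).integrableOn integrable_condExp.integrableOn]
  have h2 : ∀ᵐ ω ∂P, blockSum u τ a.reward ω - runMin γ u ω * blockSum u τ a.d ω ≤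
      blockSum u τ (a.excess γ) ω := by
    filter_upwards [a.absSummable_reward'.ae_summable, a.absSummable_d.ae_summable, hY.ae_summable]
      with ω s1 s2 s3
    have s1' := s1.indicator {v : ℕ | u ≤ v ∧ (v : WithTop ℕ) < τ ω}
    have s2' := s2.indicator {v : ℕ | u ≤ v ∧ (v : WithTop ℕ) < τ ω}
    have s3' := s3.indicator {v : ℕ | u ≤ v ∧ (v : WithTop ℕ) < τ ω}
    unfold blockSum
    rw [← tsum_mul_left, ← s1'.tsum_sub (s2'.mul_left _)]
    refine (s1'.sub (s2'.mul_left _)).tsum_le_tsum (fun v => ?_) s3'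
    by_cases hv : v ∈ {v : ℕ | u ≤ v ∧ (v : WithTop ℕ) < τ ω}
    · rw [Set.indicator_of_mem hv, Set.indicator_of_mem hv, Set.indicator_of_mem hv]
      unfold excess
      have := mul_le_mul_of_nonneg_left (runMin_antitone γ ω hv.1) (a.d_pos v ω).le
      simp only at this
      linarith
    · rw [Set.indicator_of_notMem hv, Set.indicator_of_notMem hv, Set.indicator_of_notMem hv]
      simp
  have h3 := condExp_mono (m := a.F u) ((integrable_blockSum_reward hτ).sub hBi)
    (integrable_blockSum hY hτ.1 u) h2
  have h4 := condExp_sub (integrable_blockSum_reward hτ) hBi (a.F u)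
  filter_upwards [h1, h3, h4, condExp_mul_blockSum_d (hmm u) hMi hτ] with ω h1 h3 h4 h5
  rw [Pi.sub_apply, h5] at h4
  exact (h4.symm.le.trans h3).trans h1

theorem potential_nonneg (hγ : a.IsIndex γ) (u : ℕ) : 0 ≤ᵐ[P] a.potential γ u := by
  have h : P[fun ω => -∑' v, a.excess γ (u + v) ω | a.F u] ≤ᵐ[P] 0 := by
    refine condExp_le_of_forall_setIntegral_le (a.F.le u) (hγ.integrable_tail u).neg
      (integrable_zero _ _ _) stronglyMeasurable_zero fun A hA => ?_
    have := setIntegral_tail_nonneg_of_snell hγ.absSummable_excess hγ.stronglyMeasurable_excess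
      hγ.nonneg_continuation hA
    rw [integral_neg]
    simpa using this
  filter_upwards [h, condExp_neg (μ := P) (fun ω => ∑' v, a.excess γ (u + v) ω) (a.F u)]
    with ω h1 h2
  exact neg_nonpos.1 (h2.symm.le.trans h1)

theorem potential_eq_zero (hγ : a.IsIndex γ) (u : ℕ) :
    ∀ᵐ ω ∂P, γ u ω = runMin γ u ω → a.potential γ u ω = 0 := by
  have hr := hγ.measurableSet_record u
  have h : P[Set.indicator {ω | γ u ω = runMin γ u ω} (fun ω => ∑' v, a.excess γ (u + v) ω) | a.F u]
      ≤ᵐ[P] 0 := by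
    refine condExp_le_of_forall_setIntegral_le (a.F.le u)
      ((hγ.integrable_tail u).indicator (a.F.le u _ hr))
      (integrable_zero _ _ _) stronglyMeasurable_zero fun A hA => ?_
    rw [setIntegral_indicator (a.F.le u _ hr)]
    refine (hγ.setIntegral_tail_nonpos u (hA.inter hr) fun ω hω => hω.2).trans ?_
    simp
  filter_upwards [h, condExp_indicator (hγ.integrable_tail u) hr, hγ.potential_nonneg u]
    with ω h1 h2 h3 hω
  rw [Set.indicator_of_mem (show ω ∈ {ω | γ u ω = runMin γ u ω} from hω)] at h2
  exact le_antisymm (h2.symm.le.trans h1) h3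

theorem potential_eq_add (hγ : a.IsIndex γ) (u : ℕ) :
    a.potential γ u =ᵐ[P] fun ω => a.excess γ u ω + (P[a.potential γ (u + 1) | a.F u]) ω := by
  have h1 := (condExp_congr_ae (m := a.F u) (ae_tsum_shift hγ.absSummable_excess u)).trans
    (condExp_add (hγ.absSummable_excess.integrable u) (hγ.integrable_tail (u + 1)) (a.F u))
  rw [condExp_of_stronglyMeasurable (a.F.le u) (hγ.stronglyMeasurable_excess u)
    (hγ.absSummable_excess.integrable u)] at h1
  have h2 := condExp_condExp_of_le (μ := P) (f := fun ω => ∑' v, a.excess γ (u + 1 + v) ω)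
    (a.F.mono (Nat.le_succ u)) (a.F.le (u + 1))
  filter_upwards [h1, h2] with ω h1 h2
  exact h1.trans (congrArg (a.excess γ u ω + ·) h2.symm)

theorem integrable_potential (a : DiscountedArm P) (γ : ℕ → Ω → ℝ) (u : ℕ) :
    Integrable (a.potential γ u) P := integrable_condExp

theorem tendsto_integral_potential (hγ : a.IsIndex γ) :
    Tendsto (fun n => ∫ ω, a.potential γ n ω ∂P) atTop (nhds 0) := by
  have h := tendsto_setIntegral_tsum_shift hγ.absSummable_excess Set.univ
  refine h.congr fun n => ?_
  rw [setIntegral_univ]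
  exact (integral_condExp (a.F.le n)).symm

end IsIndex

end DiscountedArm

/-! ### Weighted excess and summation by parts. -/

namespace DiscountedArm

variable {Ω : Type*} {H mΩ : MeasurableSpace Ω} {P : Measure Ω} [IsProbabilityMeasure P]
variable {a : DiscountedArm P} {γ : ℕ → Ω → ℝ} {R U : ℕ → Ω → ℝ} {c C : ℝ}

theorem integrable_mul_of_mem_Icc {r f : Ω → ℝ} (hr : AEStronglyMeasurable r P)
    (h0 : ∀ ω, 0 ≤ r ω) (h1 : ∀ᵐ ω ∂P, r ω ≤ 1) (hf : Integrable f P) :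
    Integrable (fun ω => r ω * f ω) P :=
  hf.bdd_mul (c := 1) hr (h1.mono fun ω h => by rwa [Real.norm_of_nonneg (h0 ω)])

namespace IsIndex

variable (hγ : a.IsIndex γ) (hH : H ≤ mΩ)
  (hind : Indep (⨆ s, (a.F s : MeasurableSpace Ω)) H P)
  (hRm : ∀ s, StronglyMeasurable[a.F s ⊔ H] (R s)) (hR0 : ∀ s ω, 0 ≤ R s ω)
  (hR1 : ∀ s, ∀ᵐ ω ∂P, R s ω ≤ 1) (hRa : ∀ s, ∀ᵐ ω ∂P, R (s + 1) ω ≤ R s ω)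
  (hUm : ∀ s, StronglyMeasurable[⨆ s, (a.F s : MeasurableSpace Ω)] (U s))
  (hUC : ∀ s, ∀ᵐ ω ∂P, |U s ω| ≤ C) (hUc : ∀ s, P[U s | a.F s] =ᵐ[P] fun _ => c)

include hH hRm in
theorem aestronglyMeasurable_weight (s : ℕ) : AEStronglyMeasurable (R s) P :=
  ((hRm s).mono (sup_le (a.F.le s) hH)).aestronglyMeasurable

include hH hind hRm hR0 hR1 in
theorem integral_weight_mul_condExp (s : ℕ) {f : Ω → ℝ}
    (hf : StronglyMeasurable[⨆ s, (a.F s : MeasurableSpace Ω)] f) (hfi : Integrable f P) :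
    ∫ ω, R s ω * (P[f | a.F s]) ω ∂P = ∫ ω, R s ω * f ω ∂P :=
  integral_mul_condExp_of_indep (le_iSup (fun s => (a.F s : MeasurableSpace Ω)) s)
    (iSup_le a.F.le) hH hind hf hfi (hRm s)
    (integrable_mul_of_mem_Icc (aestronglyMeasurable_weight hH hRm s) (hR0 s) (hR1 s) hfi)

include hγ hH hind hRm hR0 hR1 in
-- The excess is the expected one-step decrease of the potential. The weight is not `a.F
-- s`-measurable, but independence of `H` still allows P[Φ_{s+1} | F_s] to be replaced by Φ_{s+1}.
theorem integral_weight_mul_excess (s : ℕ) :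
    ∫ ω, R s ω * a.excess γ s ω ∂P =
      ∫ ω, R s ω * a.potential γ s ω ∂P - ∫ ω, R s ω * a.potential γ (s + 1) ω ∂P := by
  have hle := le_iSup (fun s => (a.F s : MeasurableSpace Ω))
  have hint : ∀ {f : Ω → ℝ}, Integrable f P → Integrable (fun ω => R s ω * f ω) P :=
    integrable_mul_of_mem_Icc (aestronglyMeasurable_weight hH hRm s) (hR0 s) (hR1 s)
  have hΦm : StronglyMeasurable[⨆ s, (a.F s : MeasurableSpace Ω)] (a.potential γ (s + 1)) :=
    (stronglyMeasurable_condExp (m := a.F (s + 1))).mono (hle (s + 1))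
  rw [← integral_weight_mul_condExp hH hind hRm hR0 hR1 s hΦm (integrable_potential a γ _),
    ← integral_sub (hint (integrable_potential a γ s)) (hint integrable_condExp)]
  refine integral_congr_ae ?_
  filter_upwards [hγ.potential_eq_add s] with ω h
  rw [h]
  ring

include hγ hH hind hRm hR0 hR1 in
theorem sum_integral_weight_mul_excess (n : ℕ) :
    ∑ s ∈ Finset.range n, ∫ ω, R s ω * a.excess γ s ω ∂P =
      -∫ ω, R n ω * a.potential γ n ω ∂P -
        ∑ s ∈ Finset.range n, ∫ ω, (R s ω - R (s + 1) ω) * a.potential γ (s + 1) ω ∂P := by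
  have hint : ∀ s u, Integrable (fun ω => R s ω * a.potential γ u ω) P := fun s u =>
    integrable_mul_of_mem_Icc (aestronglyMeasurable_weight hH hRm s) (hR0 s) (hR1 s)
      (integrable_potential a γ u)
  induction n with
  | zero =>
    -- Time 0 is always a record, so the initial potential vanishes.
    have h : ∫ ω, R 0 ω * a.potential γ 0 ω ∂P = 0 := by
      refine integral_eq_zero_of_ae ?_
      filter_upwards [hγ.potential_eq_zero 0] with ω h
      rw [h (by simp [runMin]), mul_zero, Pi.zero_apply]
    simp [h]
  | succ n ih =>
    rw [Finset.sum_range_succ, Finset.sum_range_succ, ih,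
      hγ.integral_weight_mul_excess hH hind hRm hR0 hR1]
    simp only [sub_mul]
    rw [integral_sub (hint n (n + 1)) (hint (n + 1) (n + 1))]
    ring

include hγ hH hRm hR0 hR1 hUm hUC in
theorem absSummable_weight {Z : ℕ → Ω → ℝ} (hZ : AbsSummable P Z) :
    AbsSummable P fun s ω => R s ω * (Z s ω * U s ω) := by
  refine AbsSummable.of_summable_integral (b := fun s ω => |Z s ω| * C) (fun s => ?_)
    (fun s => (hZ.integrable s).abs.mul_const C) (fun s => ?_) ?_
  · exact (aestronglyMeasurable_weight hH hRm s).mul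
      ((hZ.1 s).mul ((hUm s).mono (iSup_le a.F.le)).aestronglyMeasurable)
  · filter_upwards [hUC s, hR1 s] with ω h h1
    rw [abs_mul, abs_mul, abs_of_nonneg (hR0 s ω)]
    calc R s ω * (|Z s ω| * |U s ω|) ≤ 1 * (|Z s ω| * |U s ω|) := by gcongr
      _ ≤ |Z s ω| * C := by rw [one_mul]; gcongr
  · simp only [integral_mul_const]
    exact hZ.summable_integral_abs.mul_right C

include hγ hH hind hRm hR0 hR1 hUm hUC hUc in
-- `U s` is the length of operation s, unknown at its onset; given F_s only its mean `c` matters,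
-- and the weight does not disturb this.
theorem integral_weight_mul_excess_mul (s : ℕ) :
    ∫ ω, R s ω * (a.excess γ s ω * U s ω) ∂P = c * ∫ ω, R s ω * a.excess γ s ω ∂P := by
  have hle := le_iSup (fun s => (a.F s : MeasurableSpace Ω))
  have hUi : Integrable (U s) P := Integrable.of_bound
    ((hUm s).mono (iSup_le a.F.le)).aestronglyMeasurable C (hUC s)
  have hEU : Integrable (fun ω => a.excess γ s ω * U s ω) P :=
    (hγ.absSummable_excess.integrable s).mul_bdd (c := C) hUi.1 (hUC s)
  have h := integral_weight_mul_condExp hH hind hRm hR0 hR1 s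
    (((hγ.stronglyMeasurable_excess s).mono (hle s)).mul (hUm s)) hEU
  refine h.symm.trans ?_
  rw [← integral_const_mul]
  refine integral_congr_ae ?_
  filter_upwards [condExp_mul_of_stronglyMeasurable_left (hγ.stronglyMeasurable_excess s) hEU hUi,
    hUc s] with ω h1 h2
  have h3 : (P[a.excess γ s * U s | a.F s]) ω = a.excess γ s ω * c := by
    rw [← h2]; exact h1
  rw [h3]
  ring

include hγ hH hind hRm hR0 hR1 hRa hUm hUC hUc in
/-- Weights that decrease over time never make the total excess positive. -/
theorem integral_tsum_weight_mul_excess_nonpos (hc : 0 ≤ c) :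
    ∫ ω, ∑' s, R s ω * (a.excess γ s ω * U s ω) ∂P ≤ 0 := by
  have hs := (hγ.absSummable_weight hH hRm hR0 hR1 hUm hUC hγ.absSummable_excess).hasSum_integral
  refine le_of_tendsto' hs.tendsto_sum_nat fun n => ?_
  simp only [hγ.integral_weight_mul_excess_mul hH hind hRm hR0 hR1 hUm hUC hUc]
  rw [← Finset.mul_sum, hγ.sum_integral_weight_mul_excess hH hind hRm hR0 hR1]
  refine mul_nonpos_of_nonneg_of_nonpos hc (sub_nonpos.2 ((neg_nonpos.2 ?_).trans ?_))
  · refine integral_nonneg_of_ae ?_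
    filter_upwards [hγ.potential_nonneg n] with ω h
    exact mul_nonneg (hR0 n ω) h
  · refine Finset.sum_nonneg fun s _ => integral_nonneg_of_ae ?_
    filter_upwards [hγ.potential_nonneg (s + 1), hRa s] with ω h h'
    exact mul_nonneg (sub_nonneg.2 h') h

include hγ hH hind hRm hR0 hR1 hUm hUC hUc in
/-- The total excess vanishes if the weights only decrease where the potential is zero. -/
theorem integral_tsum_weight_mul_excess_eq_zero
    (hz : ∀ s, ∀ᵐ ω ∂P, R s ω ≠ R (s + 1) ω → γ (s + 1) ω = runMin γ (s + 1) ω) :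
    ∫ ω, ∑' s, R s ω * (a.excess γ s ω * U s ω) ∂P = 0 := by
  have hs := (hγ.absSummable_weight hH hRm hR0 hR1 hUm hUC hγ.absSummable_excess).hasSum_integral
  refine tendsto_nhds_unique hs.tendsto_sum_nat ?_
  simp only [hγ.integral_weight_mul_excess_mul hH hind hRm hR0 hR1 hUm hUC hUc]
  have hz' : ∀ s, ∫ ω, (R s ω - R (s + 1) ω) * a.potential γ (s + 1) ω ∂P = 0 := fun s => by
    refine integral_eq_zero_of_ae ?_
    filter_upwards [hz s, hγ.potential_eq_zero (s + 1)] with ω h1 h2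
    by_cases h : R s ω = R (s + 1) ω
    · simp [h]
    · simp [h2 (h1 h)]
  have e : ∀ n, ∑ s ∈ Finset.range n, c * ∫ ω, R s ω * a.excess γ s ω ∂P =
      c * -∫ ω, R n ω * a.potential γ n ω ∂P := fun n => by
    rw [← Finset.mul_sum, hγ.sum_integral_weight_mul_excess hH hind hRm hR0 hR1,
      Finset.sum_eq_zero fun s _ => hz' s, sub_zero]
  simp only [e]
  -- The boundary term lies between 0 and the expected potential, which is the tail of a convergent
  -- series.
  have hlim : Tendsto (fun n => ∫ ω, R n ω * a.potential γ n ω ∂P) atTop (nhds 0) := by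
    refine squeeze_zero (fun n => integral_nonneg_of_ae ?_) (fun n => integral_mono_ae
      (integrable_mul_of_mem_Icc (aestronglyMeasurable_weight hH hRm n) (hR0 n) (hR1 n)
        (integrable_potential a γ n)) (integrable_potential a γ n) ?_) hγ.tendsto_integral_potential
    · filter_upwards [hγ.potential_nonneg n] with ω h
      exact mul_nonneg (hR0 n ω) h
    · filter_upwards [hγ.potential_nonneg n, hR1 n] with ω h h1
      exact mul_le_of_le_one_left h h1
  simpa using (hlim.neg).const_mul c

end IsIndex

end DiscountedArm

theorem integral_exp_neg_mul {q : ℝ} (hq : 0 < q) (a b : ℝ) :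
    ∫ r in a..b, Real.exp (-q * r) = (Real.exp (-q * a) - Real.exp (-q * b)) / q := by
  have h : ∀ x ∈ Set.uIcc a b,
      HasDerivAt (fun r => -(Real.exp (-q * r) / q)) (Real.exp (-q * x)) x := by
    intro x _
    have h1 : HasDerivAt (fun r : ℝ => -q * r) (-q) x := by
      simpa using (hasDerivAt_id x).const_mul (-q)
    refine ((h1.exp.div_const q).neg).congr_deriv ?_
    field_simp
  rw [intervalIntegral.integral_eq_sub_of_hasDerivAt h
    ((by fun_prop : Continuous fun r => Real.exp (-q * r)).intervalIntegrable _ _)]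
  ring

/-! ### The arms of the bandit as discounted arms. -/

namespace RenewalBandit

variable {Ω : Type*} {mΩ : MeasurableSpace Ω} {P : Measure Ω} [IsProbabilityMeasure P] {J : ℕ}
  (B : RenewalBandit P J) {q : ℝ}

theorem measurable_W' (j : Fin J) (s : ℕ) : Measurable (B.W j s) :=
  (B.measurable_W j s).mono ((B.F j).le _) le_rfl

theorem measurable_T (j : Fin J) (s : ℕ) : Measurable[B.F j s] (B.T j s) := by
  exact Finset.measurable_sum (m := B.F j s) _ fun u hu =>
    (B.measurable_W j u).mono ((B.F j).mono (Finset.mem_range.1 hu)) le_rfl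

theorem T_succ (j : Fin J) (s : ℕ) (ω : Ω) : B.T j (s + 1) ω = B.T j s ω + B.W j s ω :=
  Finset.sum_range_succ _ _

theorem ae_pos_W : ∀ᵐ ω ∂P, ∀ j s, 0 < B.W j s ω :=
  ae_all_iff.2 fun j => ae_all_iff.2 fun s => B.pos_W j s

/-- The discount factor `exp (-q T j s)`. -/
noncomputable def discount (q : ℝ) (j : Fin J) (s : ℕ) (ω : Ω) : ℝ := Real.exp (-q * B.T j s ω)

/-- The discounted duration of the operation number `s` of arm `j`, discounted to its onset. -/
noncomputable def activeTime (q : ℝ) (j : Fin J) (s : ℕ) (ω : Ω) : ℝ :=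
  (1 - Real.exp (-q * B.W j s ω)) / q

theorem discount_succ (j : Fin J) (s : ℕ) (ω : Ω) :
    B.discount q j (s + 1) ω = B.discount q j s ω * Real.exp (-q * B.W j s ω) := by
  unfold discount
  rw [T_succ, mul_add, Real.exp_add]

theorem integral_discount (hq : 0 < q) (j : Fin J) (s : ℕ) (ω : Ω) :
    ∫ r in (B.T j s ω)..(B.T j (s + 1) ω), Real.exp (-q * r) =
      B.discount q j s ω * B.activeTime q j s ω := by
  rw [integral_exp_neg_mul hq]
  change (B.discount q j s ω - B.discount q j (s + 1) ω) / q = _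
  rw [discount_succ]
  unfold activeTime
  ring

theorem measurable_discount (j : Fin J) (s : ℕ) : Measurable[B.F j s] (B.discount q j s) :=
  Real.measurable_exp.comp (measurable_const.mul (B.measurable_T j s))

theorem measurable_activeTime (j : Fin J) (s : ℕ) :
    Measurable[B.F j (s + 1)] (B.activeTime q j s) :=
  (measurable_const.sub (Real.measurable_exp.comp
    (measurable_const.mul (B.measurable_W j s)))).div_const q

theorem exp_neg_lt_one (hq : 0 < q) {w : ℝ} (hw : 0 < w) : Real.exp (-q * w) < 1 :=
  Real.exp_lt_one_iff.2 (by nlinarith)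

theorem activeTime_pos (hq : 0 < q) {j : Fin J} {s : ℕ} {ω : Ω} (h : 0 < B.W j s ω) :
    0 < B.activeTime q j s ω :=
  div_pos (sub_pos.2 (exp_neg_lt_one hq h)) hq

theorem abs_activeTime_le (hq : 0 < q) (j : Fin J) (s : ℕ) :
    ∀ᵐ ω ∂P, |B.activeTime q j s ω| ≤ 1 / q := by
  filter_upwards [B.pos_W j s] with ω h
  rw [abs_of_pos (B.activeTime_pos hq h)]
  unfold activeTime
  gcongr
  linarith [Real.exp_pos (-q * B.W j s ω)]

theorem condExp_comp_W (j : Fin J) (s : ℕ) {g : ℝ → ℝ} (hg : Measurable g) :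
    P[fun ω => g (B.W j s ω) | B.F j s] =ᵐ[P] fun _ => ∫ ω, g (B.W j 0 ω) ∂P := by
  have h1 : StronglyMeasurable[MeasurableSpace.comap (B.W j s) inferInstance]
      fun ω => g (B.W j s ω) := (hg.comp (comap_measurable _)).stronglyMeasurable
  refine (condExp_indep_eq (B.measurable_W' j s).comap_le ((B.F j).le s) h1
    (B.indep_W j s)).trans (Eventually.of_forall fun _ => ?_)
  exact ((B.ident_W j s).comp hg).integral_eq

theorem integrable_exp_W (hq : 0 < q) (j : Fin J) (s : ℕ) :
    Integrable (fun ω => Real.exp (-q * B.W j s ω)) P := by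
  refine Integrable.of_bound (Real.measurable_exp.comp
    (measurable_const.mul (B.measurable_W' j s))).aestronglyMeasurable 1 ?_
  filter_upwards [B.pos_W j s] with ω h
  rw [Real.norm_of_nonneg (Real.exp_pos _).le]
  exact (exp_neg_lt_one hq h).le

theorem integral_exp_W_lt_one (hq : 0 < q) (j : Fin J) :
    ∫ ω, Real.exp (-q * B.W j 0 ω) ∂P < 1 := by
  have h1 : 0 < ∫ ω, (1 - Real.exp (-q * B.W j 0 ω)) ∂P := by
    have hpos : ∀ᵐ ω ∂P, 0 < 1 - Real.exp (-q * B.W j 0 ω) :=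
      (B.pos_W j 0).mono fun ω h => sub_pos.2 (exp_neg_lt_one hq h)
    rw [integral_pos_iff_support_of_nonneg_ae (hpos.mono fun ω h => h.le)
      ((integrable_const 1).sub (B.integrable_exp_W hq j 0))]
    have h2 : P (Function.support fun ω => 1 - Real.exp (-q * B.W j 0 ω)) = P Set.univ := by
      refine measure_congr ?_
      filter_upwards [hpos] with ω h
      exact eq_true h.ne'
    rw [h2, measure_univ]
    exact one_pos
  rw [integral_sub (integrable_const 1) (B.integrable_exp_W hq j 0)] at h1
  simpa using h1

theorem integrable_discount_succ (hq : 0 < q) (j : Fin J) (s : ℕ) {Z : Ω → ℝ}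
    (hi : Integrable (fun ω => B.discount q j s ω * Z ω) P) :
    Integrable (fun ω => B.discount q j (s + 1) ω * Z ω) P := by
  have h := hi.mul_bdd (c := 1) (B.integrable_exp_W hq j s).1 (by
    filter_upwards [B.pos_W j s] with ω h
    rw [Real.norm_of_nonneg (Real.exp_pos _).le]
    exact (exp_neg_lt_one hq h).le)
  exact h.congr (Eventually.of_forall fun ω => by simp only [discount_succ]; ring)

theorem integral_discount_succ (hq : 0 < q) (j : Fin J) (s : ℕ) {Z : Ω → ℝ}
    (hZ : Measurable[B.F j s] Z) (hi : Integrable (fun ω => B.discount q j s ω * Z ω) P) :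
    ∫ ω, B.discount q j (s + 1) ω * Z ω ∂P =
      (∫ ω, Real.exp (-q * B.W j 0 ω) ∂P) * ∫ ω, B.discount q j s ω * Z ω ∂P := by
  set f : Ω → ℝ := fun ω => B.discount q j s ω * Z ω with hf
  set g : Ω → ℝ := fun ω => Real.exp (-q * B.W j s ω) with hg
  have hfm : StronglyMeasurable[B.F j s] f := ((B.measurable_discount j s).mul hZ).stronglyMeasurable
  have e : (fun ω => B.discount q j (s + 1) ω * Z ω) = f * g := by
    funext ω
    simp only [discount_succ, hf, hg, Pi.mul_apply]
    ring
  have hfg : Integrable (f * g) P := e ▸ B.integrable_discount_succ hq j s hi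
  rw [e, ← integral_condExp ((B.F j).le s), ← integral_const_mul]
  refine integral_congr_ae ?_
  filter_upwards [condExp_mul_of_stronglyMeasurable_left hfm hfg (B.integrable_exp_W hq j s),
    B.condExp_comp_W j s (g := fun w => Real.exp (-q * w)) (by fun_prop)] with ω h1 h2
  rw [h1, Pi.mul_apply, h2, mul_comm]

theorem absSummable_discount_mul_X (hq : 0 < q) (hX : B.RewardsIntegrable q) (j : Fin J) :
    AbsSummable P fun s ω => B.discount q j s ω * B.X j s ω := by
  have hXm : ∀ s, Measurable (B.X j s) := fun s => (B.measurable_X j s).mono ((B.F j).le s) le_rfl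
  have hdm : ∀ s, Measurable (B.discount q j s) := fun s =>
    (B.measurable_discount j s).mono ((B.F j).le s) le_rfl
  have hUm : ∀ s, Measurable (B.activeTime q j s) := fun s =>
    (B.measurable_activeTime j s).mono ((B.F j).le _) le_rfl
  have hdX : ∀ s, Measurable fun ω => B.discount q j s ω * B.X j s ω := fun s =>
    (hdm s).mul (hXm s)
  refine ⟨fun s => (hdX s).aestronglyMeasurable, ?_⟩
  set c := ∫⁻ ω, ENNReal.ofReal (B.activeTime q j 0 ω) ∂P with hc
  have hc0 : c ≠ 0 := by
    intro h
    rw [hc, lintegral_eq_zero_iff (hUm 0).ennreal_ofReal] at h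
    obtain ⟨ω, h1, h2⟩ := (h.and (B.pos_W j 0)).exists
    exact (ENNReal.ofReal_pos.2 (B.activeTime_pos hq h2)).ne' h1
  -- The duration of operation s is independent of its reward and discount, so the integrability
  -- assumption is the wanted sum multiplied by the positive constant `c`.
  have key : ∀ s, ∫⁻ ω, ENNReal.ofReal (|B.X j s ω| *
      ∫ r in (B.T j s ω)..(B.T j (s + 1) ω), Real.exp (-q * r)) ∂P =
      (∫⁻ ω, ‖B.discount q j s ω * B.X j s ω‖ₑ ∂P) * c := by
    intro s
    have hmf : Measurable[B.F j s] fun ω => ‖B.discount q j s ω * B.X j s ω‖ₑ :=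
      measurable_enorm.comp ((B.measurable_discount j s).mul (B.measurable_X j s))
    have hmg : Measurable[MeasurableSpace.comap (B.W j s) inferInstance]
        fun ω => ENNReal.ofReal (B.activeTime q j s ω) := by
      have hg : Measurable fun w : ℝ => ENNReal.ofReal ((1 - Real.exp (-q * w)) / q) := by fun_prop
      exact hg.comp (comap_measurable (B.W j s))
    have h1 := lintegral_mul_eq_lintegral_mul_lintegral_of_independent_measurableSpace
      ((B.F j).le s) (B.measurable_W' j s).comap_le (B.indep_W j s).symm hmf hmg
    have h2 : ∫⁻ ω, ENNReal.ofReal (B.activeTime q j s ω) ∂P = c :=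
      ((B.ident_W j s).comp (u := fun w : ℝ => ENNReal.ofReal ((1 - Real.exp (-q * w)) / q))
        (by fun_prop)).lintegral_eq
    rw [h2] at h1
    rw [← h1]
    refine lintegral_congr fun ω => ?_
    have hd : 0 < B.discount q j s ω := Real.exp_pos _
    rw [B.integral_discount hq, ← ofReal_norm, norm_mul, Real.norm_eq_abs, Real.norm_eq_abs,
      ← ENNReal.ofReal_mul (by positivity), abs_of_pos hd]
    ring_nf
  have h := hX j
  rw [lintegral_tsum fun s => ?_] at h
  · simp only [key] at h
    rw [ENNReal.tsum_mul_right] at h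
    intro htop
    rw [htop, ENNReal.top_mul hc0] at h
    exact lt_irrefl _ h
  · simp only [B.integral_discount hq]
    exact ((hXm s).abs.mul ((hdm s).mul (hUm s))).ennreal_ofReal.aemeasurable

/-- Arm `j` of the bandit, with its discounting. -/
noncomputable def discountedArm (hq : 0 < q) (hX : B.RewardsIntegrable q) (j : Fin J) :
    DiscountedArm P where
  F := B.F j
  X := B.X j
  d := B.discount q j
  β := ∫ ω, Real.exp (-q * B.W j 0 ω) ∂P
  measurable_X := B.measurable_X j
  measurable_d := B.measurable_discount j
  d_pos s ω := Real.exp_pos _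
  d_zero ω := by simp [discount, T]
  β_nonneg := integral_nonneg fun ω => (Real.exp_pos _).le
  β_lt_one := B.integral_exp_W_lt_one hq j
  integrable_d_succ s Z _ hi := B.integrable_discount_succ hq j s hi
  integral_d_succ s Z hZ hi := B.integral_discount_succ hq j s hZ hi
  absSummable_reward := B.absSummable_discount_mul_X hq hX j

theorem discountedSum_eq (j : Fin J) (s : ℕ) (τ : Ω → WithTop ℕ) (Y : ℕ → Ω → ℝ) :
    B.discountedSum q j s τ Y = fun ω => Real.exp (q * B.T j s ω) * B.discountedSum₀ q j s τ Y ω := by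
  funext ω
  unfold discountedSum discountedSum₀
  rw [← tsum_mul_left]
  refine tsum_congr fun u => ?_
  by_cases h : u ∈ {u : ℕ | s ≤ u ∧ (u : WithTop ℕ) < τ ω}
  · rw [Set.indicator_of_mem h, Set.indicator_of_mem h, ← mul_assoc, ← Real.exp_add,
      Finset.sum_Ico_eq_sub _ h.1]
    congr 2
    unfold T
    ring
  · rw [Set.indicator_of_notMem h, Set.indicator_of_notMem h, mul_zero]

section Index

variable (hq : 0 < q) (hX : B.RewardsIntegrable q) {j : Fin J} {s : ℕ} {τ : Ω → WithTop ℕ}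

include hq hX in
theorem ratio₀_ae_eq (hτ : τ ∈ B.stoppingTimesAfter j s) :
    B.ratio₀ q j s τ =ᵐ[P] (B.discountedArm hq hX j).rate s τ := by
  have e : B.discountedSum₀ q j s τ (fun _ _ => 1) =
      blockSum s τ (B.discountedArm hq hX j).d := by
    unfold discountedSum₀ blockSum
    simp only [mul_one]
    rfl
  have h1 := genCondExp_eq_condExp (P := P) ((B.F j).le s)
    (DiscountedArm.integrable_blockSum_reward (a := B.discountedArm hq hX j) hτ)
  have h2 := genCondExp_eq_condExp (P := P) ((B.F j).le s)
    (DiscountedArm.integrable_blockSum_d (a := B.discountedArm hq hX j) hτ)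
  filter_upwards [h1, h2] with ω h1 h2
  unfold ratio₀
  rw [e, h2]
  exact congrArg (· / _) h1

include hq hX in
-- Changing the reference time of the discounting multiplies numerator and denominator by the known
-- factor e^{qT_s}.
theorem ratio_ae_eq (hτ : τ ∈ B.stoppingTimesAfter j s) :
    B.ratio q j s τ =ᵐ[P] (B.discountedArm hq hX j).rate s τ := by
  have e : B.discountedSum₀ q j s τ (fun _ _ => 1) =
      blockSum s τ (B.discountedArm hq hX j).d := by
    unfold discountedSum₀ blockSum
    simp only [mul_one]
    rfl
  have hm : Measurable[B.F j s] fun ω => Real.exp (q * B.T j s ω) :=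
    Real.measurable_exp.comp (measurable_const.mul (B.measurable_T j s))
  have h1 := genCondExp_mul (P := P) ((B.F j).le s) hm (fun ω => (Real.exp_pos _).le)
    (DiscountedArm.integrable_blockSum_reward (a := B.discountedArm hq hX j) hτ)
  have h2 := genCondExp_mul (P := P) ((B.F j).le s) hm (fun ω => (Real.exp_pos _).le)
    (DiscountedArm.integrable_blockSum_d (a := B.discountedArm hq hX j) hτ)
  filter_upwards [h1, h2] with ω h1 h2
  unfold ratio
  rw [discountedSum_eq, discountedSum_eq, e, h2]
  refine (congrArg (· / _) h1).trans ?_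
  exact mul_div_mul_left _ _ (Real.exp_pos _).ne'

include hq hX in
theorem isEssSup_ratio_iff (g : Ω → ℝ) :
    IsEssSup P (B.ratio q j s '' B.stoppingTimesAfter j s) g ↔
      IsEssSup P ((B.discountedArm hq hX j).rate s '' (B.discountedArm hq hX j).stopsAfter s) g :=
  ⟨fun h => h.congr_image fun _ hτ => B.ratio_ae_eq hq hX hτ,
    fun h => h.congr_image fun _ hτ => (B.ratio_ae_eq hq hX hτ).symm⟩

include hq hX in
theorem exists_isGittinsIndex : ∃ Γ : Fin J → ℕ → Ω → ℝ, B.IsGittinsIndex q Γ := by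
  have h := fun j s => (B.discountedArm hq hX j).exists_isEssSup_rate s
  choose Γ hΓ using h
  exact ⟨Γ, fun j s => (B.isEssSup_ratio_iff hq hX _).2 (hΓ j s)⟩

/-- Completeness makes any version of the index adapted, so no version has to be chosen. -/
theorem measurable_of_ae_eq {g g' : Ω → ℝ} (hg' : Measurable[B.F j s] g') (h : g =ᵐ[P] g') :
    Measurable[B.F j s] g := by
  intro A hA
  have h0 : P {ω | g ω ≠ g' ω} = 0 := h
  have e : g ⁻¹' A = (g' ⁻¹' A \ {ω | g ω ≠ g' ω}) ∪ (g ⁻¹' A ∩ {ω | g ω ≠ g' ω}) := by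
    ext ω
    by_cases hω : g ω = g' ω <;> simp [hω]
  rw [e]
  exact ((hg' hA).diff (B.complete j s _ h0)).union
    (B.complete j s _ (measure_mono_null Set.inter_subset_right h0))

theorem IsGittinsIndex.isIndex {B : RenewalBandit P J} {Γ : Fin J → ℕ → Ω → ℝ}
    (hΓ : B.IsGittinsIndex q Γ) (hq : 0 < q) (hX : B.RewardsIntegrable q) (j : Fin J) :
    (B.discountedArm hq hX j).IsIndex (Γ j) := by
  intro s
  have h := (B.isEssSup_ratio_iff hq hX _).1 (hΓ j s)
  obtain ⟨g', hg', he⟩ := DiscountedArm.exists_measurable_version h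
  exact ⟨B.measurable_of_ae_eq hg' he, h⟩

theorem IsGittinsIndex.isEssSup_ratio₀ {B : RenewalBandit P J} {Γ : Fin J → ℕ → Ω → ℝ}
    (hΓ : B.IsGittinsIndex q Γ) (hq : 0 < q) (hX : B.RewardsIntegrable q) (j : Fin J) (s : ℕ) :
    IsEssSup P (B.ratio₀ q j s '' B.stoppingTimesAfter j s) (Γ j s) :=
  ((B.isEssSup_ratio_iff hq hX _).1 (hΓ j s)).congr_image fun _ hτ =>
    (B.ratio₀_ae_eq hq hX hτ).symm

end Index

end RenewalBandit

/-! ### Deterministic scheduling of jobs under discounting. -/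

section Rearrangement

/-- The integral of `exp (-q r)` over `[0, x]`. -/
noncomputable def discountedLength (q x : ℝ) : ℝ := (1 - Real.exp (-q * x)) / q

variable {q : ℝ}

theorem discountedLength_zero (q : ℝ) : discountedLength q 0 = 0 := by simp [discountedLength]

theorem discountedLength_mono (hq : 0 < q) : Monotone (discountedLength q) := by
  intro x y h
  refine div_le_div_of_nonneg_right (sub_le_sub_left (Real.exp_le_exp.2 ?_) 1) hq.le
  exact mul_le_mul_of_nonpos_left h (by linarith)

theorem discountedLength_add (q x w : ℝ) : discountedLength q (x + w) =
    discountedLength q x + Real.exp (-q * x) * discountedLength q w := by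
  unfold discountedLength
  rw [mul_add, Real.exp_add]
  ring

theorem discountedLength_nonneg (hq : 0 < q) {x : ℝ} (hx : 0 ≤ x) : 0 ≤ discountedLength q x := by
  rw [← discountedLength_zero q]
  exact discountedLength_mono hq hx

/-- Scattered time slots are worth at most one interval of the same total length that starts at time
0. -/
theorem sum_discountedLength_le (hq : 0 < q) {w : ℕ → ℝ} (hw : ∀ t, 0 ≤ w t) (p : ℕ → Prop)
    [DecidablePred p] (N : ℕ) :
    ∑ t ∈ (Finset.range N).filter p,
      Real.exp (-q * ∑ u ∈ Finset.range t, w u) * discountedLength q (w t) ≤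
      discountedLength q (∑ t ∈ (Finset.range N).filter p, w t) := by
  induction N with
  | zero => simp [discountedLength_zero]
  | succ N ih =>
    rw [Finset.range_add_one, Finset.filter_insert]
    split_ifs with h
    · rw [Finset.sum_insert (by simp), Finset.sum_insert (by simp), add_comm (w N),
        discountedLength_add, add_comm]
      refine add_le_add ih (mul_le_mul_of_nonneg_right (Real.exp_le_exp.2 ?_)
        (discountedLength_nonneg hq (hw N)))
      refine mul_le_mul_of_nonpos_left ?_ (by linarith)
      exact Finset.sum_le_sum_of_subset_of_nonneg (Finset.filter_subset _ _) fun t _ _ => hw t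
    · exact ih

variable {ι : Type*} {v w : ι → ℝ} {p p' : ℕ → ι}

/-- The discounted duration of the job `p t` when the jobs `p 0, p 1, …` are run in succession. -/
noncomputable def slot (q : ℝ) (w : ι → ℝ) (p : ℕ → ι) (t : ℕ) : ℝ :=
  Real.exp (-q * ∑ u ∈ Finset.range t, w (p u)) * discountedLength q (w (p t))

theorem sum_slot (q : ℝ) (w : ι → ℝ) (p : ℕ → ι) (N : ℕ) :
    ∑ t ∈ Finset.range N, slot q w p t = discountedLength q (∑ u ∈ Finset.range N, w (p u)) := by
  induction N with
  | zero => simp [discountedLength_zero]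
  | succ N ih =>
    rw [Finset.sum_range_succ, ih, Finset.sum_range_succ, discountedLength_add]
    rfl

/-- Running jobs in the order of decreasing rates maximizes the total discounted reward. -/
theorem tsum_slot_le_of_antitone (hq : 0 < q) (hw : ∀ x, 0 ≤ w x) (hp : Function.Injective p)
    (hp' : Function.Injective p') (hanti : Antitone fun k => v (p' k))
    (hrest : ∀ x, x ∉ Set.range p' → ∀ k, v x ≤ v (p' k))
    (hlim : Tendsto (fun n => Real.exp (-q * ∑ u ∈ Finset.range n, w (p u))) atTop (nhds 0))
    (hlim' : Tendsto (fun n => Real.exp (-q * ∑ u ∈ Finset.range n, w (p' u))) atTop (nhds 0))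
    (hs : Summable fun t => v (p t) * slot q w p t)
    (hs' : Summable fun t => v (p' t) * slot q w p' t) :
    ∑' t, v (p t) * slot q w p t ≤ ∑' t, v (p' t) * slot q w p' t := by
  classical
  set T : ℕ → ℝ := fun n => ∑ u ∈ Finset.range n, w (p u) with hT
  set T' : ℕ → ℝ := fun n => ∑ u ∈ Finset.range n, w (p' u) with hT'
  set α : ℕ → ℝ := fun k => v (p' k) with hα
  have hslot : ∀ t, 0 ≤ slot q w p t := fun t =>
    mul_nonneg (Real.exp_pos _).le (discountedLength_nonneg hq (hw _))
  set K : ℕ → Finset ι := fun k => (Finset.range (k + 1)).image p' with hK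
  -- layers of the values above the level of the job `p' n`
  have layer : ∀ n x, v x ≤ α n + ∑ k ∈ Finset.range n, (α k - α (k + 1)) *
      (if x ∈ K k then 1 else 0) := by
    intro n x
    by_cases hx : ∃ i < n, p' i = x
    · obtain ⟨i, hi, rfl⟩ := hx
      have hmem : ∀ k, p' i ∈ K k ↔ i ≤ k := fun k => by
        simp only [hK, Finset.mem_image, Finset.mem_range, Nat.lt_succ_iff]
        exact ⟨fun ⟨i', h, h'⟩ => hp' h' ▸ h, fun h => ⟨i, h, rfl⟩⟩
      have e : ∀ m, i ≤ m → ∑ k ∈ Finset.range m, (α k - α (k + 1)) *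
          (if p' i ∈ K k then 1 else 0) = α i - α m := by
        intro m hm
        induction m, hm using Nat.le_induction with
        | base =>
          rw [sub_self]
          refine Finset.sum_eq_zero fun k hk => ?_
          rw [if_neg (by rw [hmem]; exact not_le.2 (Finset.mem_range.1 hk)), mul_zero]
        | succ m hm ih => rw [Finset.sum_range_succ, ih, if_pos ((hmem m).2 hm)]; ring
      rw [e n hi.le]
      simp [hα]
    · push Not at hx
      have h1 : v x ≤ α n := by
        by_cases hr : x ∈ Set.range p'
        · obtain ⟨i, rfl⟩ := hr
          exact hanti (not_lt.1 fun h => hx i h rfl)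
        · exact hrest x hr n
      refine h1.trans (le_add_of_nonneg_right (Finset.sum_nonneg fun k _ => ?_))
      refine mul_nonneg (sub_nonneg.2 (hanti (Nat.le_succ k))) ?_
      split_ifs <;> norm_num
  -- Each layer is the time spent on the first k + 1 jobs of `p'`. Any order gives it at most the
  -- discounted length of these jobs run at once from the start, which is what `p'` does.
  have bound : ∀ n N, ∑ t ∈ Finset.range N, v (p t) * slot q w p t ≤
      α n * discountedLength q (T N) +
        ∑ k ∈ Finset.range n, (α k - α (k + 1)) * discountedLength q (T' (k + 1)) := by
    intro n N
    have h1 : ∑ t ∈ Finset.range N, v (p t) * slot q w p t ≤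
        ∑ t ∈ Finset.range N, (α n * slot q w p t + ∑ k ∈ Finset.range n, (α k - α (k + 1)) *
          ((if p t ∈ K k then 1 else 0) * slot q w p t)) := by
      refine Finset.sum_le_sum fun t _ => ?_
      refine (mul_le_mul_of_nonneg_right (layer n (p t)) (hslot t)).trans_eq ?_
      rw [add_mul, Finset.sum_mul]
      simp only [mul_assoc]
    refine h1.trans ?_
    rw [Finset.sum_add_distrib, ← Finset.mul_sum, sum_slot, Finset.sum_comm]
    refine add_le_add le_rfl (Finset.sum_le_sum fun k _ => ?_)
    rw [← Finset.mul_sum]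
    refine mul_le_mul_of_nonneg_left ?_ (sub_nonneg.2 (hanti (Nat.le_succ k)))
    simp only [ite_mul, one_mul, zero_mul]
    rw [← Finset.sum_filter]
    refine (sum_discountedLength_le hq (fun t => hw (p t)) (fun t => p t ∈ K k) N).trans
      (discountedLength_mono hq ?_)
    rw [← Finset.sum_image (s := (Finset.range N).filter fun t => p t ∈ K k) (f := w) hp.injOn]
    refine (Finset.sum_le_sum_of_subset_of_nonneg (t := K k) ?_ fun x _ _ => hw x).trans_eq
      (Finset.sum_image hp'.injOn)
    intro x hx
    obtain ⟨t, ht, rfl⟩ := Finset.mem_image.1 hx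
    exact (Finset.mem_filter.1 ht).2
  have abel : ∀ n, ∑ k ∈ Finset.range n, (α k - α (k + 1)) * discountedLength q (T' (k + 1)) =
      ∑ k ∈ Finset.range n, α k * slot q w p' k - α n * discountedLength q (T' n) := by
    intro n
    induction n with
    | zero => simp [hT', discountedLength_zero]
    | succ n ih =>
      have h1 : discountedLength q (T' (n + 1)) = discountedLength q (T' n) + slot q w p' n := by
        simp only [hT']
        rw [← sum_slot, ← sum_slot, Finset.sum_range_succ]
      rw [Finset.sum_range_succ, ih, Finset.sum_range_succ, h1]
      ring
  have limT : Tendsto (fun N => discountedLength q (T N)) atTop (nhds (1 / q)) := by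
    have := (hlim.const_sub 1).div_const q
    rwa [sub_zero] at this
  have upper : ∀ n, ∑' t, v (p t) * slot q w p t ≤ ∑ k ∈ Finset.range n, α k * slot q w p' k +
      max (α 0) 0 * (Real.exp (-q * T' n) / q) := by
    intro n
    have h1 := le_of_tendsto_of_tendsto' hs.hasSum.tendsto_sum_nat
      ((limT.const_mul (α n)).add_const _) (bound n)
    rw [abel] at h1
    have h2 : α n * (1 / q) - α n * discountedLength q (T' n) =
        α n * (Real.exp (-q * T' n) / q) := by
      unfold discountedLength
      ring
    -- The rates α_n may be unbounded below, but only an upper bound is needed, and they are at most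
    -- α_0.
    have h3 : α n * (Real.exp (-q * T' n) / q) ≤ max (α 0) 0 * (Real.exp (-q * T' n) / q) := by
      gcongr
      exact (hanti (Nat.zero_le n)).trans (le_max_left _ _)
    linarith
  have limU := hs'.hasSum.tendsto_sum_nat.add ((hlim'.div_const q).const_mul (max (α 0) 0))
  simp only [zero_div, mul_zero, add_zero] at limU
  exact ge_of_tendsto' limU upper

end Rearrangement

/-! ### Strategies along a single path: operations, weights, and the order chosen by the index. -/

namespace RenewalBandit

namespace Strategy

variable {Ω : Type*} {mΩ : MeasurableSpace Ω} {P : Measure Ω} {J : ℕ} {B : RenewalBandit P J}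
  (π : B.Strategy) {q : ℝ} {ω : Ω}

/-- The operation carried out in period `t`: the arm, and the number of its previous operations. -/
noncomputable def position (t : ℕ) (ω : Ω) : Fin J × ℕ := (π.arm t ω, π.count t ω (π.arm t ω))

theorem count_succ_eq (t : ℕ) (ω : Ω) :
    π.count (t + 1) ω = π.count t ω + Pi.single (π.arm t ω) 1 := (π.count_succ t ω).choose_spec

theorem count_succ_arm (t : ℕ) (ω : Ω) :
    π.count (t + 1) ω (π.arm t ω) = π.count t ω (π.arm t ω) + 1 := by
  rw [count_succ_eq]
  simp

theorem count_succ_of_ne {t : ℕ} {j : Fin J} (h : j ≠ π.arm t ω) :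
    π.count (t + 1) ω j = π.count t ω j := by
  rw [count_succ_eq]
  simp [h]

theorem arm_eq_iff (t : ℕ) (ω : Ω) (j : Fin J) :
    π.arm t ω = j ↔ π.count (t + 1) ω = π.count t ω + Pi.single j 1 := by
  constructor
  · rintro rfl
    exact π.count_succ_eq t ω
  · intro h
    by_contra hne
    have h1 := π.count_succ_arm t ω
    rw [h] at h1
    simp [hne] at h1

theorem count_mono (ω : Ω) (j : Fin J) : Monotone fun t => π.count t ω j := by
  refine monotone_nat_of_le_succ fun t => ?_
  by_cases h : j = π.arm t ω
  · rw [h, count_succ_arm]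
    exact Nat.le_succ _
  · rw [π.count_succ_of_ne h]

theorem count_lt_of_lt {t t' : ℕ} (h : t < t') :
    π.count t ω (π.arm t ω) < π.count t' ω (π.arm t ω) := by
  have h1 := π.count_mono ω (π.arm t ω) (Nat.succ_le_of_lt h)
  have h2 := π.count_succ_arm t ω
  simp only [Nat.succ_eq_add_one] at h1
  omega

theorem position_injective (ω : Ω) : Function.Injective fun t => π.position t ω := by
  intro t t' h
  simp only [position, Prod.mk.injEq] at h
  obtain ⟨h1, h2⟩ := h
  rcases lt_trichotomy t t' with hlt | heq | hlt
  · have := π.count_lt_of_lt (ω := ω) hlt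
    rw [h2, h1] at this
    exact absurd this (lt_irrefl _)
  · exact heq
  · have := π.count_lt_of_lt (ω := ω) hlt
    rw [← h2, ← h1] at this
    exact absurd this (lt_irrefl _)

theorem exists_position_eq {t s : ℕ} {j : Fin J} (h : s < π.count t ω j) :
    ∃ u < t, π.position u ω = (j, s) := by
  induction t with
  | zero => simp [π.count_zero] at h
  | succ t ih =>
    by_cases hs : s < π.count t ω j
    · obtain ⟨u, hu, h'⟩ := ih hs
      exact ⟨u, hu.trans (Nat.lt_succ_self t), h'⟩
    · have hj : j = π.arm t ω := by
        by_contra hne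
        rw [π.count_succ_of_ne hne] at h
        exact hs h
      subst hj
      rw [count_succ_arm] at h
      exact ⟨t, Nat.lt_succ_self t, Prod.ext rfl (by simp only [position]; omega)⟩

/-- The time spent on arms other than `j` before period `t`. -/
noncomputable def otherTime (j : Fin J) (t : ℕ) (ω : Ω) : ℝ :=
  ∑ i ∈ Finset.univ.erase j, B.T i (π.count t ω i) ω

theorem time_eq_sum (t : ℕ) (ω : Ω) : π.time t ω = ∑ i, B.T i (π.count t ω i) ω := by
  induction t with
  | zero => simp [time, π.count_zero, T]
  | succ t ih =>
    have h : π.time (t + 1) ω = π.time t ω + π.duration t ω := Finset.sum_range_succ _ _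
    rw [h, ih, ← Finset.add_sum_erase _ _ (Finset.mem_univ (π.arm t ω)),
      ← Finset.add_sum_erase _ (fun i => B.T i (π.count (t + 1) ω i) ω)
      (Finset.mem_univ (π.arm t ω)), count_succ_arm]
    have e : ∑ i ∈ Finset.univ.erase (π.arm t ω), B.T i (π.count (t + 1) ω i) ω =
        ∑ i ∈ Finset.univ.erase (π.arm t ω), B.T i (π.count t ω i) ω :=
      Finset.sum_congr rfl fun i hi => by rw [π.count_succ_of_ne (Finset.ne_of_mem_erase hi)]
    have h2 : B.T (π.arm t ω) (π.count t ω (π.arm t ω) + 1) ω =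
        B.T (π.arm t ω) (π.count t ω (π.arm t ω)) ω + π.duration t ω := Finset.sum_range_succ _ _
    rw [e, h2]
    ring

theorem time_eq (j : Fin J) (t : ℕ) (ω : Ω) :
    π.time t ω = B.T j (π.count t ω j) ω + π.otherTime j t ω := by
  rw [time_eq_sum, otherTime, Finset.add_sum_erase _ (fun i => B.T i (π.count t ω i) ω)
    (Finset.mem_univ j)]

open Classical in
/-- The factor by which the operation of other arms has discounted the operation number `s` of arm
`j` at its onset; zero if it is never carried out. -/
noncomputable def weight (q : ℝ) (j : Fin J) (s : ℕ) (ω : Ω) : ℝ :=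
  ∑' t : ℕ, if π.position t ω = (j, s) then Real.exp (-q * π.otherTime j t ω) else 0

theorem weight_of_position {t : ℕ} {j : Fin J} {s : ℕ} (h : π.position t ω = (j, s)) :
    π.weight q j s ω = Real.exp (-q * π.otherTime j t ω) := by
  unfold weight
  rw [tsum_eq_single t, if_pos h]
  intro t' ht'
  rw [if_neg]
  exact fun h' => ht' (π.position_injective ω (h'.trans h.symm))

theorem weight_of_forall_ne {j : Fin J} {s : ℕ} (h : ∀ t, π.position t ω ≠ (j, s)) :
    π.weight q j s ω = 0 := by
  unfold weight
  exact (tsum_congr fun t => if_neg (h t)).trans tsum_zero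

theorem weight_nonneg (j : Fin J) (s : ℕ) (ω : Ω) : 0 ≤ π.weight q j s ω :=
  tsum_nonneg fun t => by split_ifs <;> positivity

theorem T_mono (hω : ∀ j s, 0 < B.W j s ω) (j : Fin J) : Monotone fun s => B.T j s ω :=
  monotone_nat_of_le_succ fun s => by
    simp only [T, Finset.sum_range_succ]
    linarith [hω j s]

theorem T_nonneg (hω : ∀ j s, 0 < B.W j s ω) (j : Fin J) (s : ℕ) : 0 ≤ B.T j s ω :=
  Finset.sum_nonneg fun u _ => (hω j u).le

theorem otherTime_nonneg (hω : ∀ j s, 0 < B.W j s ω) (j : Fin J) (t : ℕ) :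
    0 ≤ π.otherTime j t ω := Finset.sum_nonneg fun i _ => T_nonneg hω i _

theorem otherTime_mono (hω : ∀ j s, 0 < B.W j s ω) (j : Fin J) :
    Monotone fun t => π.otherTime j t ω := fun _ _ h =>
  Finset.sum_le_sum fun i _ => T_mono hω i (π.count_mono ω i h)

/-- At most one term of the sum in `weight` is nonzero, since each operation is carried out at most
once. -/
theorem weight_le_one (hq : 0 < q) (hω : ∀ j s, 0 < B.W j s ω) (j : Fin J) (s : ℕ) :
    π.weight q j s ω ≤ 1 := by
  by_cases h : ∃ t, π.position t ω = (j, s)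
  · obtain ⟨t, ht⟩ := h
    rw [π.weight_of_position ht, Real.exp_le_one_iff]
    nlinarith [π.otherTime_nonneg hω j t]
  · rw [π.weight_of_forall_ne (not_exists.1 h)]
    exact zero_le_one

/-- The next operation starts later, after at least as much time on other arms; one that is never
carried out has weight 0. -/
theorem weight_succ_le (hq : 0 < q) (hω : ∀ j s, 0 < B.W j s ω) (j : Fin J) (s : ℕ) :
    π.weight q j (s + 1) ω ≤ π.weight q j s ω := by
  by_cases h : ∃ t, π.position t ω = (j, s + 1)
  · obtain ⟨t, ht⟩ := h
    have hlt : s < π.count t ω j := by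
      simp only [position, Prod.mk.injEq] at ht
      obtain ⟨rfl, h2⟩ := ht
      omega
    obtain ⟨u, hu, hu'⟩ := π.exists_position_eq hlt
    rw [π.weight_of_position ht, π.weight_of_position hu', Real.exp_le_exp]
    have : π.otherTime j u ω ≤ π.otherTime j t ω := π.otherTime_mono hω j hu.le
    nlinarith
  · rw [π.weight_of_forall_ne (not_exists.1 h)]
    exact π.weight_nonneg j s ω

/-- Collecting at rate `Z` during the operations: the sum over the periods is a sum over all
operations of all arms. -/
theorem weight_position_mul (hq : 0 < q) (Z : Fin J × ℕ → ℝ) (t : ℕ) (ω : Ω) :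
    π.weight q (π.position t ω).1 (π.position t ω).2 ω *
      (B.discount q (π.position t ω).1 (π.position t ω).2 ω * Z (π.position t ω) *
        B.activeTime q (π.position t ω).1 (π.position t ω).2 ω) =
    Z (π.position t ω) * ∫ r in (π.time t ω)..(π.time (t + 1) ω), Real.exp (-q * r) := by
  have h : π.time (t + 1) ω = π.time t ω + π.duration t ω := Finset.sum_range_succ _ _
  have hw : π.weight q (π.position t ω).1 (π.position t ω).2 ω =
      Real.exp (-q * π.otherTime (π.arm t ω) t ω) := π.weight_of_position (t := t) rfl
  rw [hw, integral_exp_neg_mul hq, h, mul_add, Real.exp_add, π.time_eq (π.arm t ω), mul_add,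
    Real.exp_add]
  simp only [position, discount, activeTime, duration]
  ring

theorem weight_mul_eq_zero (Z : Fin J × ℕ → ℝ) {x : Fin J × ℕ}
    (hx : x ∉ Set.range fun t => π.position t ω) :
    π.weight q x.1 x.2 ω * (B.discount q x.1 x.2 ω * Z x * B.activeTime q x.1 x.2 ω) = 0 := by
  rw [π.weight_of_forall_ne fun t ht => hx ⟨t, ht⟩, zero_mul]

theorem summable_period_iff (hq : 0 < q) (Z : Fin J × ℕ → ℝ) (ω : Ω) :
    (Summable fun t => Z (π.position t ω) *
      ∫ r in (π.time t ω)..(π.time (t + 1) ω), Real.exp (-q * r)) ↔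
    Summable fun x : Fin J × ℕ => π.weight q x.1 x.2 ω *
      (B.discount q x.1 x.2 ω * Z x * B.activeTime q x.1 x.2 ω) := by
  rw [← (π.position_injective ω).summable_iff fun x hx => π.weight_mul_eq_zero Z hx]
  exact summable_congr fun t => (π.weight_position_mul hq Z t ω).symm

theorem tsum_period_eq (hq : 0 < q) (Z : Fin J × ℕ → ℝ) (ω : Ω) :
    ∑' t, Z (π.position t ω) * ∫ r in (π.time t ω)..(π.time (t + 1) ω), Real.exp (-q * r) =
    ∑' x : Fin J × ℕ, π.weight q x.1 x.2 ω *
      (B.discount q x.1 x.2 ω * Z x * B.activeTime q x.1 x.2 ω) := by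
  rw [← (π.position_injective ω).tsum_eq (Function.support_subset_iff'.2
    fun x hx => π.weight_mul_eq_zero Z hx)]
  exact tsum_congr fun t => (π.weight_position_mul hq Z t ω).symm

theorem integral_period_eq_slot (hq : 0 < q) (t : ℕ) (ω : Ω) :
    ∫ r in (π.time t ω)..(π.time (t + 1) ω), Real.exp (-q * r) =
      slot q (fun x : Fin J × ℕ => B.W x.1 x.2 ω) (fun t => π.position t ω) t := by
  have h : π.time (t + 1) ω = π.time t ω + π.duration t ω := Finset.sum_range_succ _ _
  rw [integral_exp_neg_mul hq, h, mul_add, Real.exp_add]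
  have h2 : Real.exp (-q * π.time t ω) * discountedLength q (π.duration t ω) =
    slot q (fun x : Fin J × ℕ => B.W x.1 x.2 ω) (fun t => π.position t ω) t := rfl
  rw [← h2]
  unfold discountedLength
  ring

/-- By pigeonhole, after t periods some arm has been operated at least t / J times, so the elapsed
time grows with the slowest arm. -/
theorem tendsto_exp_time [NeZero J] (hq : 0 < q) (hω : ∀ j s, 0 < B.W j s ω)
    (hT : ∀ j, Tendsto (fun s => B.discount q j s ω) atTop (nhds 0)) :
    Tendsto (fun t => Real.exp (-q * π.time t ω)) atTop (nhds 0) := by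
  have hD : Tendsto (fun s => ∑ j, B.discount q j s ω) atTop (nhds 0) := by
    simpa using tendsto_finsetSum Finset.univ fun j _ => hT j
  have hdiv : Tendsto (fun t : ℕ => t / J) atTop atTop :=
    Nat.tendsto_div_const_atTop (NeZero.ne J)
  refine squeeze_zero (fun t => (Real.exp_pos _).le) (fun t => ?_) (hD.comp hdiv)
  obtain ⟨j, hj⟩ : ∃ j, t / J ≤ π.count t ω j := by
    by_contra hn
    push Not at hn
    have h1 : ∑ j, π.count t ω j < ∑ _j : Fin J, t / J :=
      Finset.sum_lt_sum_of_nonempty Finset.univ_nonempty fun j _ => hn j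
    rw [π.sum_count, Finset.sum_const, Finset.card_univ, Fintype.card_fin, smul_eq_mul] at h1
    exact absurd (Nat.mul_div_le t J) (not_le.2 h1)
  have h1 : B.T j (t / J) ω ≤ π.time t ω := by
    rw [π.time_eq j]
    have := T_mono hω j hj
    simp only at this
    linarith [π.otherTime_nonneg hω j t]
  calc Real.exp (-q * π.time t ω) ≤ B.discount q j (t / J) ω :=
        Real.exp_le_exp.2 (by nlinarith)
    _ ≤ ∑ j, B.discount q j (t / J) ω :=
        Finset.single_le_sum (f := fun j => B.discount q j (t / J) ω)
          (fun i _ => (Real.exp_pos _).le) (Finset.mem_univ j)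

section IndexStrategy

variable {π} {Γ : Fin J → ℕ → Ω → ℝ}
  (hΓ : ∀ t j, Γ j (π.count t ω j) ω ≤ Γ (π.arm t ω) (π.count t ω (π.arm t ω)) ω)

include hΓ in
/-- The current index of an idle arm is at most the index of every earlier operation. -/
theorem index_idle_le (t : ℕ) {i : Fin J} (hi : i ≠ π.arm t ω) {k : Fin J} {u : ℕ}
    (hu : u < π.count (t + 1) ω k) : Γ i (π.count (t + 1) ω i) ω ≤ Γ k u ω := by
  induction t generalizing i k u with
  | zero =>
    rw [π.count_succ_of_ne hi]
    have hk : k = π.arm 0 ω := by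
      by_contra hne
      rw [π.count_succ_of_ne hne, π.count_zero] at hu
      exact absurd hu (Nat.not_lt_zero _)
    subst hk
    rw [count_succ_arm, π.count_zero] at hu
    have h := hΓ 0 i
    rw [π.count_zero] at h ⊢
    have hu0 : u = 0 := by simpa using hu
    rw [hu0]
    exact h
  | succ t ih =>
    rw [π.count_succ_of_ne hi]
    by_cases hold : u < π.count (t + 1) ω k
    · by_cases hi' : i = π.arm t ω
      · exact (hΓ (t + 1) i).trans (ih (fun h => hi (hi'.trans h.symm)) hold)
      · exact ih hi' hold
    · have hk : k = π.arm (t + 1) ω := by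
        by_contra hne
        rw [π.count_succ_of_ne hne] at hu
        exact hold hu
      subst hk
      rw [count_succ_arm] at hu
      have : u = π.count (t + 1) ω (π.arm (t + 1) ω) := by omega
      rw [this]
      exact hΓ (t + 1) i

include hΓ in
-- An idle arm's current index is at most every index met so far on the operated arm, hence at most
-- their running minimum.
theorem runMin_index_le (t : ℕ) (j : Fin J) : runMin (Γ j) (π.count t ω j) ω ≤
    runMin (Γ (π.arm t ω)) (π.count t ω (π.arm t ω)) ω := by
  by_cases hj : j = π.arm t ω
  · rw [← hj]
  have h0 : runMin (Γ j) (π.count t ω j) ω ≤ Γ j (π.count t ω j) ω := runMin_le le_rfl ω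
  refine h0.trans (le_runMin fun u hu => ?_)
  rcases hu.lt_or_eq with hu | rfl
  · cases t with
    | zero => simp [π.count_zero] at hu
    | succ t =>
      by_cases ha : π.arm (t + 1) ω = π.arm t ω
      · exact index_idle_le hΓ t (fun h => hj (h.trans ha.symm)) hu
      · exact (hΓ (t + 1) j).trans (index_idle_le hΓ t ha hu)
  · exact hΓ t j

include hΓ in
theorem antitone_runMin_position :
    Antitone fun t => runMin (Γ (π.position t ω).1) (π.position t ω).2 ω :=
  antitone_nat_of_succ_le fun t => (runMin_antitone _ ω (π.count_mono ω _ (Nat.le_succ t))).trans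
    (runMin_index_le hΓ t _)

include hΓ in
theorem runMin_le_of_notMem_range {x : Fin J × ℕ} (hx : x ∉ Set.range fun t => π.position t ω)
    (t : ℕ) : runMin (Γ x.1) x.2 ω ≤ runMin (Γ (π.position t ω).1) (π.position t ω).2 ω := by
  have h : π.count t ω x.1 ≤ x.2 := by
    by_contra hn
    obtain ⟨u, -, hu⟩ := π.exists_position_eq (not_le.1 hn)
    exact hx ⟨u, hu⟩
  exact (runMin_antitone _ ω h).trans (runMin_index_le hΓ t _)

include hΓ in
-- A change of weight means that the arm is idle in the period after operation s, whether it is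
-- resumed later or never. By `index_idle_le` its current index is then at most all of its own
-- earlier ones.
theorem index_eq_runMin_of_weight_ne {j : Fin J} {s : ℕ}
    (h : π.weight q j s ω ≠ π.weight q j (s + 1) ω) : Γ j (s + 1) ω = runMin (Γ j) (s + 1) ω := by
  have hex : ∃ t, π.position t ω = (j, s) := by
    by_contra hn
    refine h ?_
    rw [π.weight_of_forall_ne (not_exists.1 hn), π.weight_of_forall_ne]
    intro t ht
    have hlt : s < π.count t ω j := by
      simp only [position, Prod.mk.injEq] at ht
      obtain ⟨rfl, h2⟩ := ht
      omega
    obtain ⟨u, -, hu⟩ := π.exists_position_eq hlt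
    exact hn ⟨u, hu⟩
  obtain ⟨t, ht⟩ := hex
  have hj : π.arm t ω = j := congrArg Prod.fst ht
  have hs : π.count t ω j = s := by
    have := congrArg Prod.snd ht
    rwa [← hj]
  have hs1 : π.count (t + 1) ω j = s + 1 := by
    have := π.count_succ_arm t ω
    rwa [hj, hs] at this
  have hne : j ≠ π.arm (t + 1) ω := by
    intro hj'
    refine h ?_
    have hpos : π.position (t + 1) ω = (j, s + 1) :=
      Prod.ext hj'.symm (by change π.count (t + 1) ω (π.arm (t + 1) ω) = s + 1; rw [← hj', hs1])
    rw [π.weight_of_position ht, π.weight_of_position hpos]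
    congr 2
    refine Finset.sum_congr rfl fun i hi => ?_
    rw [π.count_succ_of_ne (by rw [hj]; exact Finset.ne_of_mem_erase hi)]
  have hs2 : π.count (t + 1 + 1) ω j = s + 1 := by rw [π.count_succ_of_ne hne, hs1]
  refine le_antisymm (le_runMin fun u hu => ?_) (runMin_le le_rfl ω)
  rcases hu.lt_or_eq with hu | rfl
  · have := index_idle_le hΓ (t + 1) hne (k := j) (u := u) (by rw [hs2]; exact hu)
    rwa [hs2] at this
  · exact le_rfl

end IndexStrategy

end Strategy

end RenewalBandit

theorem measurable_tsum_real {α ι : Type*} [Countable ι] {m : MeasurableSpace α} {f : ι → α → ℝ}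
    (h : ∀ i, Measurable[m] (f i)) : Measurable[m] fun x => ∑' i, f i x := Measurable.tsum h

/-! ### Information available to a strategy, and measurability of the weights. -/

namespace RenewalBandit

variable {Ω : Type*} {mΩ : MeasurableSpace Ω} {P : Measure Ω} [IsProbabilityMeasure P] {J : ℕ}
  (B : RenewalBandit P J) {q : ℝ}

/-- The information of all arms other than `j`. -/
abbrev others (j : Fin J) : MeasurableSpace Ω :=
  ⨆ i ∈ ({j}ᶜ : Set (Fin J)), ⨆ s, (B.F i s : MeasurableSpace Ω)

theorem iSup_F_le (j : Fin J) : ⨆ s, (B.F j s : MeasurableSpace Ω) ≤ mΩ := iSup_le (B.F j).le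

theorem others_le (j : Fin J) : B.others j ≤ mΩ := iSup₂_le fun i _ => B.iSup_F_le i

theorem info_le (n : Fin J → ℕ) : B.info n ≤ mΩ := iSup_le fun j => (B.F j).le _

theorem info_mono {n n' : Fin J → ℕ} (h : n ≤ n') : B.info n ≤ B.info n' :=
  iSup_mono fun j => (B.F j).mono (h j)

theorem F_le_info (n : Fin J → ℕ) (j : Fin J) : (B.F j (n j) : MeasurableSpace Ω) ≤ B.info n :=
  le_iSup (fun j => (B.F j (n j) : MeasurableSpace Ω)) j

theorem F_le_others {i j : Fin J} (h : i ≠ j) (s : ℕ) :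
    (B.F i s : MeasurableSpace Ω) ≤ B.others j :=
  (le_iSup (fun s => (B.F i s : MeasurableSpace Ω)) s).trans
    (le_iSup₂ (f := fun i (_ : i ∈ ({j}ᶜ : Set (Fin J))) => ⨆ s, (B.F i s : MeasurableSpace Ω)) i h)

theorem info_le_sup_others (n : Fin J → ℕ) (j : Fin J) :
    B.info n ≤ (B.F j (n j) : MeasurableSpace Ω) ⊔ B.others j := by
  refine iSup_le fun i => ?_
  by_cases h : i = j
  · subst h
    exact le_sup_left
  · exact (B.F_le_others h _).trans le_sup_right

theorem indep_others (j : Fin J) :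
    Indep (⨆ s, (B.F j s : MeasurableSpace Ω)) (B.others j) P := by
  have h := indep_iSup_of_disjoint B.iSup_F_le B.indep_arms
    (S := {j}) (T := {j}ᶜ) disjoint_compl_right
  rwa [iSup_singleton] at h

namespace Strategy

variable {B} (π : B.Strategy)

/-- The arm selected in period `t` is determined by the information at its onset. -/
theorem measurableSet_count_arm (t : ℕ) (n : Fin J → ℕ) (j : Fin J) :
    MeasurableSet[B.info n] {ω | π.count t ω = n ∧ π.arm t ω = j} := by
  -- Admissibility only places the choice of arm i in the information after that choice, with arm i
  -- advanced by one.
  have hE : ∀ i, MeasurableSet[B.info (n + Pi.single i 1)]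
      {ω | π.count t ω = n ∧ π.arm t ω = i} := by
    intro i
    have e : {ω | π.count t ω = n ∧ π.arm t ω = i} =
        {ω | π.count t ω = n} ∩ {ω | π.count (t + 1) ω = n + Pi.single i 1} := by
      ext ω
      simp only [Set.mem_ofPred_eq, Set.mem_inter_iff]
      refine and_congr_right fun h => ?_
      rw [π.arm_eq_iff, h]
    rw [e]
    exact (B.info_mono le_self_add _ (π.measurableSet_count t n)).inter
      (π.measurableSet_count (t + 1) _)
  set n₂ : MeasurableSpace Ω := ⨆ i ∈ ({j}ᶜ : Set (Fin J)), (B.F i (n i) : MeasurableSpace Ω)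
    with hn₂
  set m₂ : MeasurableSpace Ω := ⨆ i ∈ ({j}ᶜ : Set (Fin J)), (B.F i (n i + 1) : MeasurableSpace Ω)
    with hm₂
  have hmem₂ : ∀ i ≠ j, (B.F i (n i) : MeasurableSpace Ω) ≤ n₂ := fun i hi =>
    le_iSup₂ (f := fun i (_ : i ∈ ({j}ᶜ : Set (Fin J))) => (B.F i (n i) : MeasurableSpace Ω)) i hi
  have hmem₂' : ∀ i ≠ j, (B.F i (n i + 1) : MeasurableSpace Ω) ≤ m₂ := fun i hi =>
    le_iSup₂ (f := fun i (_ : i ∈ ({j}ᶜ : Set (Fin J))) =>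
      (B.F i (n i + 1) : MeasurableSpace Ω)) i hi
  have hnm : n₂ ≤ m₂ := iSup₂_mono fun i _ => (B.F i).mono (Nat.le_succ _)
  have hm₂' : m₂ ≤ B.others j := iSup₂_le fun i hi => B.F_le_others hi _
  have hind : Indep (B.F j (n j + 1) : MeasurableSpace Ω) m₂ P :=
    indep_of_indep_of_le_left (indep_of_indep_of_le_right (B.indep_others j) hm₂')
      (le_iSup (fun s => (B.F j s : MeasurableSpace Ω)) _)
  have hA₁ : MeasurableSet[(B.F j (n j + 1) : MeasurableSpace Ω) ⊔ n₂]
      {ω | π.count t ω = n ∧ π.arm t ω = j} := by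
    refine (iSup_le fun i => ?_ : B.info (n + Pi.single j 1) ≤ _) _ (hE j)
    by_cases h : i = j
    · subst h
      simp
    · have : (n + Pi.single j 1 : Fin J → ℕ) i = n i := by simp [h]
      rw [this]
      exact (hmem₂ i h).trans le_sup_right
  -- Choosing j is also the complement of choosing another arm, and those events do not advance arm
  -- j. Independence then removes the extra step of every arm, and completeness removes the null
  -- set.
  have hA₂ : MeasurableSet[(B.F j (n j) : MeasurableSpace Ω) ⊔ m₂]
      {ω | π.count t ω = n ∧ π.arm t ω = j} := by
    have hle : ∀ k ≠ j, B.info (n + Pi.single k 1) ≤ (B.F j (n j) : MeasurableSpace Ω) ⊔ m₂ := by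
      intro k hk
      refine iSup_le fun i => ?_
      by_cases h : i = j
      · subst h
        have : (n + Pi.single k 1 : Fin J → ℕ) i = n i := by simp [hk.symm]
        rw [this]
        exact le_sup_left
      · refine (((B.F i).mono ?_).trans (hmem₂' i h)).trans le_sup_right
        by_cases hik : i = k
        · subst hik
          simp
        · simp [hik]
    have e : {ω | π.count t ω = n ∧ π.arm t ω = j} = {ω | π.count t ω = n} \
        ⋃ k ∈ ({j}ᶜ : Set (Fin J)), {ω | π.count t ω = n ∧ π.arm t ω = k} := by
      ext ω
      simp only [Set.mem_ofPred_eq, Set.mem_sdiff, Set.mem_iUnion, Set.mem_compl_iff,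
        Set.mem_singleton_iff, exists_prop]
      constructor
      · rintro ⟨h1, h2⟩
        exact ⟨h1, fun ⟨k, hk, _, h3⟩ => hk (h3.symm.trans h2)⟩
      · rintro ⟨h1, h2⟩
        refine ⟨h1, ?_⟩
        by_contra h3
        exact h2 ⟨_, h3, h1, rfl⟩
    rw [e]
    refine MeasurableSet.diff ?_ ?_
    · refine (iSup_le fun i => ?_ : B.info n ≤ _) _ (π.measurableSet_count t n)
      by_cases h : i = j
      · subst h
        exact le_sup_left
      · exact ((hmem₂ i h).trans hnm).trans le_sup_right
    · exact MeasurableSet.biUnion (Set.to_countable _) fun k hk => hle k hk _ (hE k)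
  obtain ⟨A', hA', he⟩ := exists_measurableSet_ae_eq_of_indep ((B.F j).mono (Nat.le_succ (n j)))
    hnm ((B.F j).le _) (hm₂'.trans (B.others_le j)) hind hA₁ hA₂
  have hle : (B.F j (n j) : MeasurableSpace Ω) ⊔ n₂ ≤ B.info n :=
    sup_le (B.F_le_info n j) (iSup₂_le fun i _ => B.F_le_info n i)
  have hnull : ∀ N : Set Ω, P N = 0 → MeasurableSet[B.info n] N := fun N hN =>
    B.F_le_info n j _ (B.complete j (n j) N hN)
  obtain ⟨h1, h2⟩ := ae_eq_set.1 he
  have e : {ω | π.count t ω = n ∧ π.arm t ω = j} =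
      (A' \ (A' \ {ω | π.count t ω = n ∧ π.arm t ω = j})) ∪
        ({ω | π.count t ω = n ∧ π.arm t ω = j} \ A') := by
    ext ω
    simp only [Set.mem_union, Set.mem_sdiff]
    tauto
  rw [e]
  exact ((hle _ hA').diff (hnull _ h2)).union (hnull _ h1)

theorem measurable_weight (q : ℝ) (j : Fin J) (s : ℕ) :
    Measurable[(B.F j s : MeasurableSpace Ω) ⊔ B.others j] (π.weight q j s) := by
  classical
  unfold weight
  refine measurable_tsum_real (m := (B.F j s : MeasurableSpace Ω) ⊔ B.others j) fun t => ?_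
  -- Once the counts are fixed, the time spent on other arms is a function of those arms alone, and
  -- the event lies in the information at these counts.
  have e : (fun ω => if π.position t ω = (j, s) then Real.exp (-q * π.otherTime j t ω) else 0) =
      fun ω => ∑' n : Fin J → ℕ, if π.count t ω = n ∧ π.arm t ω = j then
        (if n j = s then Real.exp (-q * ∑ i ∈ Finset.univ.erase j, B.T i (n i) ω) else 0) else 0 := by
    funext ω
    rw [tsum_eq_single (π.count t ω) fun n hn => if_neg fun h => hn h.1.symm]
    by_cases h1 : π.arm t ω = j
    · subst h1
      simp [position, otherTime]
    · simp [position, h1]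
  rw [e]
  refine measurable_tsum_real (m := (B.F j s : MeasurableSpace Ω) ⊔ B.others j) fun n => ?_
  by_cases hn : n j = s
  · subst hn
    simp only [if_true]
    refine Measurable.ite (B.info_le_sup_others n j _ (π.measurableSet_count_arm t n j)) ?_
      measurable_const
    refine Real.measurable_exp.comp (measurable_const.mul ?_)
    exact Finset.measurable_sum (m := (B.F j (n j) : MeasurableSpace Ω) ⊔ B.others j) _ fun i hi =>
      (B.measurable_T i (n i)).mono
        ((B.F_le_others (Finset.ne_of_mem_erase hi) _).trans le_sup_right) le_rfl
  · simp only [if_neg hn, ite_self]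
    exact measurable_const

end Strategy

end RenewalBandit

theorem AbsSummable.prod {Ω ι κ : Type*} {mΩ : MeasurableSpace Ω} {P : Measure Ω} [Fintype ι]
    [Countable κ] {f : ι → κ → Ω → ℝ} (hf : ∀ i, AbsSummable P (f i)) :
    AbsSummable P fun x : ι × κ => f x.1 x.2 := by
  refine ⟨fun x => (hf x.1).1 x.2, ?_⟩
  rw [ENNReal.tsum_prod (f := fun i k => ∫⁻ ω, ‖f i k ω‖ₑ ∂P), tsum_fintype]
  exact ENNReal.sum_ne_top.2 fun i _ => (hf i).2

/-! ### Comparison of strategies and optimality. -/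

namespace RenewalBandit

variable {Ω : Type*} {mΩ : MeasurableSpace Ω} {P : Measure Ω} [IsProbabilityMeasure P] {J : ℕ}
  {B : RenewalBandit P J} {q : ℝ}

theorem measurable_activeTime_iSup (B : RenewalBandit P J) (q : ℝ) (j : Fin J) (s : ℕ) :
    StronglyMeasurable[⨆ s, (B.F j s : MeasurableSpace Ω)] (B.activeTime q j s) :=
  ((B.measurable_activeTime j s).mono
    (le_iSup (fun s => (B.F j s : MeasurableSpace Ω)) (s + 1)) le_rfl).stronglyMeasurable

theorem condExp_activeTime (B : RenewalBandit P J) (q : ℝ) (j : Fin J) (s : ℕ) :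
    P[B.activeTime q j s | B.F j s] =ᵐ[P] fun _ => ∫ ω, B.activeTime q j 0 ω ∂P :=
  B.condExp_comp_W j s (g := fun w => (1 - Real.exp (-q * w)) / q) (by fun_prop)

namespace Strategy

variable (π : B.Strategy)

/-- The total discounted income when the operation number `s` of arm `j` earns at rate `Z j s`. -/
noncomputable def income (q : ℝ) (Z : Fin J → ℕ → Ω → ℝ) (ω : Ω) : ℝ :=
  ∑' t, Z (π.position t ω).1 (π.position t ω).2 ω *
    ∫ r in (π.time t ω)..(π.time (t + 1) ω), Real.exp (-q * r)

section Weight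

variable (hq : 0 < q) (hX : B.RewardsIntegrable q) (j : Fin J) {A : Set Ω}
  (hA : MeasurableSet[B.info 0] A)

include hA in
theorem stronglyMeasurable_indicator_weight (s : ℕ) :
    StronglyMeasurable[(B.F j s : MeasurableSpace Ω) ⊔ B.others j]
      (A.indicator (π.weight q j s)) := by
  refine (π.measurable_weight q j s).stronglyMeasurable.indicator ?_
  exact (B.info_le_sup_others 0 j).trans
    (sup_le_sup_right ((B.F j).mono (Nat.zero_le s)) _) _ hA

theorem indicator_weight_nonneg (s : ℕ) (ω : Ω) : 0 ≤ A.indicator (π.weight q j s) ω :=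
  Set.indicator_nonneg (fun _ _ => π.weight_nonneg j s _) ω

include hq in
theorem indicator_weight_le_one (s : ℕ) : ∀ᵐ ω ∂P, A.indicator (π.weight q j s) ω ≤ 1 :=
  B.ae_pos_W.mono fun _ hω =>
    Set.indicator_apply_le' (fun _ => π.weight_le_one hq hω j s) fun _ => zero_le_one

include hq in
theorem indicator_weight_succ_le (s : ℕ) :
    ∀ᵐ ω ∂P, A.indicator (π.weight q j (s + 1)) ω ≤ A.indicator (π.weight q j s) ω :=
  B.ae_pos_W.mono fun _ hω => Set.indicator_le_indicator (π.weight_succ_le hq hω j s)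

end Weight

section Income

variable {Z Z' : Fin J → ℕ → Ω → ℝ}

theorem absSummable_weight_mul (hq : 0 < q) (hX : B.RewardsIntegrable q)
    (hZ : ∀ j, AbsSummable P (Z j)) :
    AbsSummable P fun (x : Fin J × ℕ) ω =>
      π.weight q x.1 x.2 ω * (Z x.1 x.2 ω * B.activeTime q x.1 x.2 ω) := by
  obtain ⟨Γ, hΓ⟩ := B.exists_isGittinsIndex hq hX
  refine AbsSummable.prod (f := fun j s ω => π.weight q j s ω *
    (Z j s ω * B.activeTime q j s ω)) fun j => ?_
  have h := (hΓ.isIndex hq hX j).absSummable_weight (B.others_le j)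
    (π.stronglyMeasurable_indicator_weight (q := q) j MeasurableSet.univ)
    (π.indicator_weight_nonneg j) (π.indicator_weight_le_one hq j)
    (B.measurable_activeTime_iSup q j) (B.abs_activeTime_le hq j) (hZ j)
  simpa only [Set.indicator_univ] using h

theorem income_eq (hq : 0 < q) (Z : Fin J → ℕ → Ω → ℝ) (ω : Ω) :
    π.income q Z ω = ∑' x : Fin J × ℕ, π.weight q x.1 x.2 ω *
      (B.discount q x.1 x.2 ω * Z x.1 x.2 ω * B.activeTime q x.1 x.2 ω) :=
  π.tsum_period_eq hq (fun x => Z x.1 x.2 ω) ω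

variable (hq : 0 < q) (hX : B.RewardsIntegrable q)
  (hZ : ∀ j, AbsSummable P fun s ω => B.discount q j s ω * Z j s ω)
  (hZ' : ∀ j, AbsSummable P fun s ω => B.discount q j s ω * Z' j s ω)

include hq hX hZ in
theorem ae_summable_income : ∀ᵐ ω ∂P, Summable fun t =>
    Z (π.position t ω).1 (π.position t ω).2 ω *
      ∫ r in (π.time t ω)..(π.time (t + 1) ω), Real.exp (-q * r) :=
  (π.absSummable_weight_mul hq hX hZ).ae_summable.mono fun ω hω =>
    (π.summable_period_iff hq (fun x => Z x.1 x.2 ω) ω).2 hω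

include hq hX hZ in
theorem integrable_income : Integrable (π.income q Z) P :=
  (π.absSummable_weight_mul hq hX hZ).integrable_tsum.congr
    (Eventually.of_forall fun ω => (π.income_eq hq Z ω).symm)

include hq hX hZ hZ' in
-- Regroups the difference by arms. The indicator of `A` is absorbed into the weights, which keeps
-- them adapted and decreasing because `A` is known at time 0.
theorem setIntegral_income_sub {A : Set Ω} (hA : MeasurableSet[B.info 0] A) :
    ∫ ω in A, π.income q Z ω ∂P - ∫ ω in A, π.income q Z' ω ∂P =
      ∑ j, ∫ ω, ∑' s, A.indicator (π.weight q j s) ω *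
        ((B.discount q j s ω * Z j s ω - B.discount q j s ω * Z' j s ω) *
          B.activeTime q j s ω) ∂P := by
  have h := π.absSummable_weight_mul hq hX fun j => (hZ j).sub (hZ' j)
  have h1 := π.absSummable_weight_mul hq hX hZ
  have h2 := π.absSummable_weight_mul hq hX hZ'
  have hAm : MeasurableSet A := B.info_le 0 _ hA
  have harm : ∀ j, AbsSummable P fun s ω => π.weight q j s ω *
      ((B.discount q j s ω * Z j s ω - B.discount q j s ω * Z' j s ω) * B.activeTime q j s ω) :=
    fun j => h.comp_injective (e := fun s : ℕ => (j, s)) (Prod.mk_right_injective j)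
  have e : ∀ j, ∫ ω, ∑' s, A.indicator (π.weight q j s) ω *
      ((B.discount q j s ω * Z j s ω - B.discount q j s ω * Z' j s ω) * B.activeTime q j s ω) ∂P =
      ∫ ω in A, ∑' s, π.weight q j s ω *
      ((B.discount q j s ω * Z j s ω - B.discount q j s ω * Z' j s ω) *
        B.activeTime q j s ω) ∂P := by
    intro j
    rw [← integral_indicator hAm]
    refine integral_congr_ae (Eventually.of_forall fun ω => ?_)
    by_cases hω : ω ∈ A <;> simp [hω]
  simp only [e]
  rw [← integral_sub (π.integrable_income hq hX hZ).integrableOn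
    (π.integrable_income hq hX hZ').integrableOn,
    ← integral_finsetSum _ fun j _ => (harm j).integrable_tsum.integrableOn]
  refine integral_congr_ae (ae_restrict_of_ae ?_)
  filter_upwards [h.ae_summable, h1.ae_summable, h2.ae_summable] with ω hs hs1 hs2
  rw [π.income_eq hq, π.income_eq hq, ← hs1.tsum_sub hs2, ← tsum_fintype (L := .unconditional _),
    ← hs.tsum_prod]
  exact tsum_congr fun x => by ring

end Income

section Optimal

variable {Γ : Fin J → ℕ → Ω → ℝ} (hΓ : B.IsGittinsIndex q Γ) (hq : 0 < q)
  (hX : B.RewardsIntegrable q)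

theorem integral_activeTime_nonneg (B : RenewalBandit P J) (hq : 0 < q) (j : Fin J) :
    0 ≤ ∫ ω, B.activeTime q j 0 ω ∂P :=
  integral_nonneg_of_ae ((B.pos_W j 0).mono fun _ h => (B.activeTime_pos hq h).le)

include hΓ hX hq in
theorem setIntegral_totalReward_le {A : Set Ω} (hA : MeasurableSet[B.info 0] A) :
    ∫ ω in A, π.totalReward q ω ∂P ≤
      ∫ ω in A, π.income q (fun j => runMin (Γ j)) ω ∂P := by
  have h := π.setIntegral_income_sub hq hX (B.absSummable_discount_mul_X hq hX)
    (fun j => (hΓ.isIndex hq hX j).absSummable_runMin) hA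
  refine sub_nonpos.1 (h.trans_le (Finset.sum_nonpos fun j _ => ?_))
  exact (hΓ.isIndex hq hX j).integral_tsum_weight_mul_excess_nonpos (B.others_le j)
    (B.indep_others j) (π.stronglyMeasurable_indicator_weight (q := q) j hA)
    (π.indicator_weight_nonneg j) (π.indicator_weight_le_one hq j)
    (π.indicator_weight_succ_le hq j)
    (B.measurable_activeTime_iSup q j) (B.abs_activeTime_le hq j) (B.condExp_activeTime q j)
    (integral_activeTime_nonneg B hq j)

include hΓ hX hq in
theorem setIntegral_totalReward_eq {A : Set Ω} (hA : MeasurableSet[B.info 0] A)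
    (hπ : π.FollowsIndex Γ) :
    ∫ ω in A, π.totalReward q ω ∂P =
      ∫ ω in A, π.income q (fun j => runMin (Γ j)) ω ∂P := by
  have h := π.setIntegral_income_sub hq hX (B.absSummable_discount_mul_X hq hX)
    (fun j => (hΓ.isIndex hq hX j).absSummable_runMin) hA
  refine sub_eq_zero.1 (h.trans (Finset.sum_eq_zero fun j _ => ?_))
  refine (hΓ.isIndex hq hX j).integral_tsum_weight_mul_excess_eq_zero (B.others_le j)
    (B.indep_others j) (π.stronglyMeasurable_indicator_weight (q := q) j hA)
    (π.indicator_weight_nonneg j) (π.indicator_weight_le_one hq j)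
    (B.measurable_activeTime_iSup q j) (B.abs_activeTime_le hq j) (B.condExp_activeTime q j)
    fun s => ?_
  filter_upwards [ae_all_iff.2 hπ] with ω hω hne
  refine index_eq_runMin_of_weight_ne (π := π) hω (q := q) fun he => hne ?_
  by_cases hA : ω ∈ A <;> simp [hA, he]

include hΓ hX hq in
theorem income_runMin_le [NeZero J] (π' : B.Strategy) (hπ : π.FollowsIndex Γ) :
    π'.income q (fun j => runMin (Γ j)) ≤ᵐ[P] π.income q (fun j => runMin (Γ j)) := by
  have hM := fun j => (hΓ.isIndex hq hX j).absSummable_runMin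
  have hT : ∀ᵐ ω ∂P, ∀ j, Tendsto (fun s => B.discount q j s ω) atTop (nhds 0) :=
    ae_all_iff.2 fun j => (B.discountedArm hq hX j).absSummable_d.ae_summable.mono
      fun ω hω => hω.tendsto_atTop_zero
  filter_upwards [B.ae_pos_W, hT, ae_all_iff.2 hπ, π.ae_summable_income hq hX hM,
    π'.ae_summable_income hq hX hM] with ω hω hT hπω hs hs'
  unfold income
  simp only [integral_period_eq_slot _ hq] at hs hs' ⊢
  exact tsum_slot_le_of_antitone (v := fun x : Fin J × ℕ => runMin (Γ x.1) x.2 ω) hq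
    (fun x => (hω x.1 x.2).le) (π'.position_injective ω) (π.position_injective ω)
    (antitone_runMin_position hπω) (fun x hx t => runMin_le_of_notMem_range hπω hx t)
    (π'.tendsto_exp_time hq hω hT) (π.tendsto_exp_time hq hω hT) hs' hs

include hΓ hX hq in
-- Over each initial event, the reward of `π'` is at most its income at the running minima, which is
-- at most that of `π`, which is the reward of `π`.
theorem isOptimal_of_followsIndex [NeZero J] (hπ : π.FollowsIndex Γ) : π.IsOptimal q := by
  intro π'
  have hM := fun j => (hΓ.isIndex hq hX j).absSummable_runMin
  have hi : ∀ π : B.Strategy, Integrable (π.totalReward q) P := fun π =>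
    π.integrable_income hq hX (B.absSummable_discount_mul_X hq hX)
  refine condExp_le_of_forall_setIntegral_le (B.info_le 0) (hi π') integrable_condExp
    stronglyMeasurable_condExp fun A hA => ?_
  rw [value, setIntegral_condExp (B.info_le 0) (hi π) hA, π.setIntegral_totalReward_eq hΓ hq hX hA hπ]
  exact (π'.setIntegral_totalReward_le hΓ hq hX hA).trans (setIntegral_mono_ae
    (π'.integrable_income hq hX hM).integrableOn (π.integrable_income hq hX hM).integrableOn
    (π.income_runMin_le hΓ hq hX π' hπ))

end Optimal

end Strategy

/-! ### Construction of an index strategy. -/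

section Existence

variable (Γ : Fin J → ℕ → Ω → ℝ)

open Classical in
/-- The arms of maximal index after `n j` operations of each arm `j`. -/
noncomputable def bestArms (n : Fin J → ℕ) (ω : Ω) : Finset (Fin J) :=
  Finset.univ.filter fun j => ∀ i, Γ i (n i) ω ≤ Γ j (n j) ω

theorem bestArms_nonempty [NeZero J] (n : Fin J → ℕ) (ω : Ω) : (bestArms Γ n ω).Nonempty := by
  obtain ⟨j, hj⟩ := Finite.exists_max fun j => Γ j (n j) ω
  exact ⟨j, by simpa [bestArms] using hj⟩

/-- The first arm of maximal index. -/
noncomputable def bestArm [NeZero J] (n : Fin J → ℕ) (ω : Ω) : Fin J :=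
  (bestArms Γ n ω).min' (bestArms_nonempty Γ n ω)

theorem le_bestArm [NeZero J] (n : Fin J → ℕ) (ω : Ω) (i : Fin J) :
    Γ i (n i) ω ≤ Γ (bestArm Γ n ω) (n (bestArm Γ n ω)) ω := by
  have h := Finset.min'_mem _ (bestArms_nonempty Γ n ω)
  exact (Finset.mem_filter.1 h).2 i

theorem measurableSet_bestArm [NeZero J] (hΓ : ∀ j s, Measurable[B.F j s] (Γ j s))
    (n : Fin J → ℕ) (j : Fin J) : MeasurableSet[B.info n] {ω | bestArm Γ n ω = j} := by
  have hmem : ∀ k, MeasurableSet[B.info n] {ω | k ∈ bestArms Γ n ω} := by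
    intro k
    have e : {ω | k ∈ bestArms Γ n ω} = ⋂ i, {ω | Γ i (n i) ω ≤ Γ k (n k) ω} := by
      ext ω
      simp [bestArms]
    rw [e]
    exact MeasurableSet.iInter fun i => measurableSet_le
      ((hΓ i (n i)).mono (B.F_le_info n i) le_rfl) ((hΓ k (n k)).mono (B.F_le_info n k) le_rfl)
  -- Breaking ties by the smallest label makes the choice measurable.
  have e : {ω | bestArm Γ n ω = j} =
      {ω | j ∈ bestArms Γ n ω} ∩ ⋂ k ∈ Set.Iio j, {ω | k ∈ bestArms Γ n ω}ᶜ := by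
    ext ω
    simp only [Set.mem_ofPred_eq, Set.mem_inter_iff, Set.mem_iInter, Set.mem_Iio,
      Set.mem_compl_iff]
    constructor
    · rintro rfl
      exact ⟨Finset.min'_mem _ _, fun k hk hk' => absurd (Finset.min'_le _ _ hk') (not_le.2 hk)⟩
    · rintro ⟨h1, h2⟩
      exact le_antisymm (Finset.min'_le _ _ h1)
        (not_lt.1 fun h => h2 _ h (Finset.min'_mem _ _))
  rw [e]
  exact (hmem j).inter (MeasurableSet.biInter (Set.to_countable _) fun k _ => (hmem k).compl)

/-- The numbers of operations when an arm of maximal index is always operated. -/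
noncomputable def indexCount [NeZero J] : ℕ → Ω → Fin J → ℕ
  | 0, _ => 0
  | t + 1, ω => indexCount t ω + Pi.single (bestArm Γ (indexCount t ω) ω) 1

theorem measurableSet_indexCount [NeZero J] (hΓ : ∀ j s, Measurable[B.F j s] (Γ j s)) (t : ℕ)
    (n : Fin J → ℕ) : MeasurableSet[B.info n] {ω | indexCount Γ t ω = n} := by
  induction t generalizing n with
  | zero => exact @MeasurableSet.const _ (B.info n) ((0 : Fin J → ℕ) = n)
  | succ t ih =>
    have e : {ω | indexCount Γ (t + 1) ω = n} =
        ⋃ (p : (Fin J → ℕ) × Fin J) (_ : p ∈ {p | p.1 + Pi.single p.2 1 = n}),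
          {ω | indexCount Γ t ω = p.1} ∩ {ω | bestArm Γ p.1 ω = p.2} := by
      ext ω
      simp only [Set.mem_ofPred_eq, Set.mem_iUnion, Set.mem_inter_iff, exists_prop]
      constructor
      · intro h
        exact ⟨(indexCount Γ t ω, bestArm Γ (indexCount Γ t ω) ω), h, rfl, rfl⟩
      · rintro ⟨p, h, h1, h2⟩
        rw [← h, ← h2, ← h1]
        rfl
    rw [e]
    refine MeasurableSet.biUnion (Set.to_countable _) fun p hp => ?_
    have hle : B.info p.1 ≤ B.info n := B.info_mono (le_self_add.trans_eq hp)
    exact (hle _ (ih p.1)).inter (hle _ (measurableSet_bestArm Γ hΓ p.1 p.2))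

theorem exists_followsIndex [NeZero J] (hΓ : ∀ j s, Measurable[B.F j s] (Γ j s)) :
    ∃ π : B.Strategy, π.FollowsIndex Γ := by
  let π : B.Strategy :=
    { count := indexCount Γ
      count_zero := fun _ => rfl
      sum_count := fun t ω => by
        induction t with
        | zero => simp [indexCount]
        | succ t ih => simp [indexCount, Finset.sum_add_distrib, ih]
      count_succ := fun t ω => ⟨bestArm Γ (indexCount Γ t ω) ω, rfl⟩
      measurableSet_count := measurableSet_indexCount Γ hΓ }
  refine ⟨π, fun t => Eventually.of_forall fun ω j => ?_⟩
  have h : π.arm t ω = bestArm Γ (π.count t ω) ω := (π.arm_eq_iff t ω _).2 rfl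
  rw [h]
  exact le_bestArm Γ (π.count t ω) ω j

end Existence

end RenewalBandit

theorem theorem2p1 {Ω : Type*} {mΩ : MeasurableSpace Ω} {P : Measure Ω} [IsProbabilityMeasure P]
    {J : ℕ} (hJ : 0 < J) (B : RenewalBandit P J) {q : ℝ} (hq : 0 < q)
    (hX : B.RewardsIntegrable q) :
    -- the value of every admissible strategy is well defined
    (∀ π : B.Strategy, (∀ᵐ ω ∂P, Summable fun t => π.periodReward q t ω) ∧
      Integrable (π.totalReward q) P) ∧
    -- the Gittins index process exists, as a real-valued process
    (∃ Γ : Fin J → ℕ → Ω → ℝ, B.IsGittinsIndex q Γ) ∧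
    ∀ Γ : Fin J → ℕ → Ω → ℝ, B.IsGittinsIndex q Γ →
      -- the two expressions for the index agree
      (∀ j s, IsEssSup P (B.ratio₀ q j s '' B.stoppingTimesAfter j s) (Γ j s)) ∧
      -- there is a Gittins index strategy, and every such strategy is optimal
      (∃ π : B.Strategy, π.FollowsIndex Γ) ∧
      ∀ π : B.Strategy, π.FollowsIndex Γ → π.IsOptimal q := by
  have : NeZero J := ⟨hJ.ne'⟩
  refine ⟨fun π => ⟨π.ae_summable_income hq hX (B.absSummable_discount_mul_X hq hX),
    π.integrable_income hq hX (B.absSummable_discount_mul_X hq hX)⟩,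
    B.exists_isGittinsIndex hq hX, fun Γ hΓ => ⟨fun j s => hΓ.isEssSup_ratio₀ hq hX j s,
    RenewalBandit.exists_followsIndex Γ fun j s => ((hΓ.isIndex hq hX j) s).1,
    fun π hπ => π.isOptimal_of_followsIndex hΓ hq hX hπ⟩⟩
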